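/- **Model.** Let $\mathsf S$ be a finite set of link states. For $s\in\mathsf S$ let $\kappa_s>0$, $\alpha_s>2$ (path-loss constant and slope), $\mu_s\in\mathbb R$, $\sigma_s\ge 0$ (mean and standard deviation in dB of the log-normal shadowing $\mathcal X_s$, i.e. $10\log_{10}\mathcal X_s\sim\mathcal N(\mu_s,\sigma_s^2)$), $m_s,\Omega_s>0$ (fading parameter and mean). Let $\lambda_{\rm BS},\lambda_{\rm MT},P_{\rm BS},\sigma_N^2>0$, $N_{\rm RB}\ge 1$ an integer, $P_{\rm RB}=P_{\rm BS}/N_{\rm RB}$. Let $0=D_0\le D_1\le\dots\le D_B<D_{B+1}=\infty$ and $q_s^b\ge 0$ ($1\le b\le B+1$) with $\sum_s q_s^b=1$ for every $b$, and let $p_s(r)=q_s^b$ for $r\in[D_{b-1},D_b)$ (multi-ball link state model). For $q\in\{{\rm BS},{\rm MT}\}$ let $G_q(\theta)=\sum_{l=1}^{K_q}\gamma_q^{(l)}\mathbf 1\{\varphi_q^{(l-1)}\le|\theta|<\varphi_q^{(l)}\}$ with $0=\varphi_q^{(0)}<\dots<\varphi_q^{(K_q)}=\pi$, $\gamma_q^{(l)}\ge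 0$, and $\omega_q^{(l)}=2(\varphi_q^{(l)}-\varphi_q^{(l-1)})$ (multi-lobe antenna patterns). Let $G^{(0)}>0$ be the gain of the intended link, the product of the boresight gains of the actual antenna patterns of base station and terminal. *Load.* Let the cell area $A$ be gamma distributed with shape $3.5$ and mean $1/\lambda_{\rm BS}$; let $N$, given $A$, be Poisson with mean $\lambda_{\rm MT}A$, and let $N'$ be defined in the same way from the area-biased law of $A$. Put $p_{\rm off}=\sum_{n=0}^{N_{\rm RB}}(1-n/N_{\rm RB})\Pr\{N=n\}$, $p_{\rm sel}=\sum_{n\ge0}\min\{1,N_{\rm RB}/(n+1)\}\Pr\{N'=n\}$ and $\lambda^{(\rm I)}_{\rm BS}=(1-p_{\rm off})\lambda_{\rm BS}$. *Base stations.* Under the intensity-matching approximation, the base stations in state $s$, for $s\in\mathsf S$, form independent Poisson point processes on $\mathbb R^2$ with densities $\lambda_{\rm BS}\,\mathbb E\{\mathcal X_s^{2/\alpha_s}\}\,p_s(\|y\|)$; the path-loss of a base station at $y$ is $L=\kappa_s\|y\|^{\alpha_s}$. The base stations carry independent marks: active on the resource block with probability $1-p_{\rm off}$; fading gain $g$,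 gamma distributed with shape $m_s$ and mean $\Omega_s$; two angles, uniform on $[-\pi,\pi)$, which give the interfering gain $G=G_{\rm BS}(\theta_{\rm BS})G_{\rm MT}(\theta_{\rm MT})$. Let $L^{(0)}$ be the smallest path-loss, $g^{(0)}$ the fading gain of the base station that attains it, $$I_{\rm agg}(x)=\sum_{\text{active},\;L>x}P_{\rm RB}Gg/L,\quad {\rm SINR}=\frac{P_{\rm RB}G^{(0)}g^{(0)}/L^{(0)}}{\sigma_N^2+I_{\rm agg}(L^{(0)})},\quad {\rm ASE}=\frac{\lambda_{\rm MT}p_{\rm sel}}{\ln 2}\,\mathbb E\{\ln(1+{\rm SINR})\}.$$ *Short-hands.* Let $\mathcal H(x)=1$ for $x\ge 0$ and $0$ for $x<0$, $\overline{\mathcal H}=1-\mathcal H$, $\Theta_s=\exp(2\tilde\mu_s/\alpha_s+2\tilde\sigma_s^2/\alpha_s^2)$ with $\tilde\mu_s=\mu_s\ln(10)/10$, $\tilde\sigma_s=\sigma_s\ln(10)/10$, $x_{s,b}=\kappa_sD_b^{\alpha_s}$, $\mathcal M_{g_s}(z)=(1+z\Omega_s/m_s)^{-m_s}$, $\overline{\mathcal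 M}_{g_s}=1-\mathcal M_{g_s}$, $$\begin{aligned}\widehat\Lambda_s(x)=\pi\lambda_{\rm BS}\Theta_s\Big\{&\sum_{b=1}^{B}q_s^b\,\overline{\mathcal H}(x-x_{s,b})\mathcal H(x-x_{s,b-1})\big((x/\kappa_s)^{2/\alpha_s}-D_{b-1}^2\big)+\sum_{b=1}^{B}q_s^b\,\mathcal H(x-x_{s,b})(D_b^2-D_{b-1}^2)\\&+q_s^{B+1}\mathcal H(x-x_{s,B})\big((x/\kappa_s)^{2/\alpha_s}-D_B^2\big)\Big\},\end{aligned}$$ $$\widehat\Lambda^{(1)}_s(x)=\pi\lambda_{\rm BS}\Theta_s\tfrac{2}{\alpha_s}\kappa_s^{-2/\alpha_s}x^{2/\alpha_s-1}\Big\{\sum_{b=1}^{B}q_s^b\,\overline{\mathcal H}(x-x_{s,b})\mathcal H(x-x_{s,b-1})+q_s^{B+1}\mathcal H(x-x_{s,B})\Big\},$$ $\mathcal L_s(x)=\widehat\Lambda_s^{(1)}(x)\exp(-\sum_{r}\widehat\Lambda_r(x))$, $$\mathcal F_s(x)=1-\sum_{l_1=1}^{K_{\rm BS}}\sum_{l_2=1}^{K_{\rm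 MT}}\frac{\omega_{\rm BS}^{(l_1)}}{2\pi}\frac{\omega_{\rm MT}^{(l_2)}}{2\pi}\,{}_2F_1\Big(m_s,-\tfrac2{\alpha_s},1-\tfrac2{\alpha_s},-x\tfrac{\Omega_s}{m_s}\gamma_{\rm BS}^{(l_1)}\gamma_{\rm MT}^{(l_2)}\Big),$$ $$\begin{aligned}\widehat{\mathcal T}_r(z,x)=\pi\lambda^{(\rm I)}_{\rm BS}\Theta_r\Big\{&\big(\tfrac{x}{\kappa_r}\big)^{2/\alpha_r}\mathcal F_r(z)\sum_{b=1}^{B}q_r^b\,\overline{\mathcal H}(x-x_{r,b})\mathcal H(x-x_{r,b-1})\\&+\sum_{b=1}^{B}q_r^b\Big(D_{b-1}^2\mathcal F_r\big(\tfrac{xz}{x_{r,b-1}}\big)\overline{\mathcal H}(x-x_{r,b-1})-D_b^2\mathcal F_r\big(\tfrac{xz}{x_{r,b}}\big)\overline{\mathcal H}(x-x_{r,b})\Big)\\&+q_r^{B+1}\Big(D_B^2\mathcal F_r\big(\tfrac{xz}{x_{r,B}}\big)\overline{\mathcal H}(x-x_{r,B})+\big(\tfrac{x}{\kappa_r}\big)^{2/\alpha_r}\mathcal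 F_r(z)\mathcal H(x-x_{r,B})\Big)\Big\},\end{aligned}$$ where a term with factor $D_b^2=0$ is $0$. **Proposition.** (i) The mean number of base stations in state $s$ of path-loss less than $x$ is $\widehat\Lambda_s(x)$ for every $x>0$, and $\widehat\Lambda_s^{(1)}$ is the derivative of $\widehat\Lambda_s$ at every $x>0$ other than the points $x_{s,b}$. Almost surely exactly one base station attains $L^{(0)}$. (ii) For $x>0$, $I_{\rm agg}(x)$ is almost surely finite, and for $z\ge0$ the moment generating function of the normalised interference is $\mathbb E\{\exp(-\tfrac{zx}{P_{\rm RB}}I_{\rm agg}(x))\}=\mathcal M_{I_{\rm agg}(x)}(z|x):=\exp\big(\sum_{r\in\mathsf S}\widehat{\mathcal T}_r(z,x)\big)$. (iii) $\ln(1+{\rm SINR})$ is integrable, the integrands below are integrable on $(0,\infty)^2$, and $${\rm ASE}=\frac{\lambda_{\rm MT}p_{\rm sel}}{\ln 2}\sum_{s\in\mathsf S}\int_0^\infty\!\!\int_0^\infty\exp\Big(-\frac{zx\sigma_N^2}{G^{(0)}P_{\rm RB}}\Big)\mathcal M_{I_{\rm agg}(x)}\Big(\frac{z}{G^{(0)}}\Big|x\Big)\overline{\mathcal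 M}_{g_s}(z)\,\mathcal L_s(x)\,\frac{dz\,dx}{z}.$$ -/

import Mathlib

open MeasureTheory ProbabilityTheory
open scoped ENNReal NNReal

noncomputable section

namespace CellNet

/-! ## Poisson point processes and the Gauss hypergeometric function -/

/-- `η` is a Poisson point process on `E` with intensity measure `Λ`, defined on the probability
space `(Ω, P)`: a random counting measure such that the number of points in every measurable set
of finite intensity is Poisson distributed, and the numbers of points in pairwise disjoint
measurable sets are independent. -/
structure IsPoissonPointProcess {Ω E : Type*} [MeasurableSpace Ω] [MeasurableSpace E]
    (P : Measure Ω) (Λ : Measure E) (η : Ω → Measure E) : Prop where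
  measurable : Measurable η
  counting : ∀ᵐ ω ∂P, ∃ (I : Set ℕ) (x : ℕ → E),
    η ω = Measure.sum fun i : I => Measure.dirac (x i)
  poisson : ∀ A : Set E, MeasurableSet A → Λ A ≠ ∞ →
    P.map (fun ω => η ω A) = (poissonMeasure (Λ A).toNNReal).map (fun n : ℕ => (n : ℝ≥0∞))
  indep : ∀ (n : ℕ) (A : Fin n → Set E), (∀ i, MeasurableSet (A i)) →
    Pairwise (fun i j => Disjoint (A i) (A j)) → iIndepFun (fun i ω => η ω (A i)) P

/-- The Gauss hypergeometric function `₂F₁(a, b; c; z)` for real `z < 1`: the power series for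
`|z| < 1`, and for `z ≤ -1` its analytic continuation along the negative half-line, given by
Pfaff's transformation `₂F₁(a, b; c; z) = (1 - z)^(-a) ₂F₁(a, c - b; c; z / (z - 1))`, in which
`z / (z - 1)` lies in `[1/2, 1)`. -/
def gaussHyp (a b c z : ℝ) : ℝ :=
  if |z| < 1 then ₂F₁ a b c z
  else (1 - z) ^ (-a) * ₂F₁ a (c - b) c (z / (z - 1))

/-- The Heaviside function `H`, with `H 0 = 1`. -/
def heaviside (x : ℝ) : ℝ := if 0 ≤ x then 1 else 0

/-- The complementary Heaviside function `1 - H`. -/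
def coHeaviside (x : ℝ) : ℝ := 1 - heaviside x

/-! ## Antennas -/

/-- A multi-lobe antenna radiation pattern with `K` lobes, the `l`-th of which has gain `gain l`
and occupies the angles `phase l ≤ |θ| < phase (l + 1)`. -/
structure LobePattern where
  K : ℕ
  phase : Fin (K + 1) → ℝ
  gain : Fin K → ℝ
  phase_zero : phase 0 = 0
  phase_last : phase (Fin.last K) = Real.pi
  phase_strictMono : StrictMono phase
  gain_nonneg : ∀ l, 0 ≤ gain l

/-- The gain in the direction `θ`. -/
def LobePattern.value (A : LobePattern) (θ : ℝ) : ℝ :=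
  ∑ l : Fin A.K, if A.phase l.castSucc ≤ |θ| ∧ |θ| < A.phase l.succ then A.gain l else 0

/-- The total angular width `ω^(l)` of the `l`-th lobe. -/
def LobePattern.width (A : LobePattern) (l : Fin A.K) : ℝ :=
  2 * (A.phase l.succ - A.phase l.castSucc)

/-! ## The network -/

/-- Parameters of the approximated cellular network, with link states `S`. -/
structure Network (S : Type*) [Fintype S] where
  /-- density of base stations -/
  lamBS : ℝ
  /-- density of mobile terminals -/
  lamMT : ℝ
  /-- number of resource blocks -/
  nRB : ℕ
  /-- power budget of a base station -/
  powBS : ℝ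
  /-- noise power in a resource block -/
  noise : ℝ
  /-- path-loss constants -/
  kap : S → ℝ
  /-- path-loss slopes -/
  alp : S → ℝ
  /-- shadowing means (dB) -/
  mu : S → ℝ
  /-- shadowing standard deviations (dB) -/
  sig : S → ℝ
  /-- fading parameters -/
  m : S → ℝ
  /-- fading means -/
  Om : S → ℝ
  /-- number of balls -/
  B : ℕ
  /-- radii of the balls, `D 0 = 0` included -/
  D : Fin (B + 1) → ℝ
  /-- `q s b` is the probability of state `s` at distances in `[D b, D (b + 1))`; for `b = B`, the
  upper end is infinite -/
  q : S → Fin (B + 1) → ℝ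
  /-- multi-lobe antenna pattern of the base stations -/
  antBS : LobePattern
  /-- multi-lobe antenna pattern of the mobile terminals -/
  antMT : LobePattern
  /-- actual antenna pattern of the base stations; only the intended link uses it -/
  patBS : ℝ → ℝ
  /-- actual antenna pattern of the mobile terminals; only the intended link uses it -/
  patMT : ℝ → ℝ
  lamBS_pos : 0 < lamBS
  lamMT_pos : 0 < lamMT
  nRB_pos : 0 < nRB
  powBS_pos : 0 < powBS
  noise_pos : 0 < noise
  kap_pos : ∀ s, 0 < kap s
  alp_gt_two : ∀ s, 2 < alp s
  sig_nonneg : ∀ s, 0 ≤ sig s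
  m_pos : ∀ s, 0 < m s
  Om_pos : ∀ s, 0 < Om s
  D_zero : D 0 = 0
  D_mono : Monotone D
  q_nonneg : ∀ s b, 0 ≤ q s b
  q_sum : ∀ b, ∑ s, q s b = 1
  patBS_pos : 0 < patBS 0
  patMT_pos : 0 < patMT 0

/-- A base station as seen from the typical mobile terminal at the origin: link state, position in
the plane, activity on the resource block, angle of its antenna off boresight, angle of the mobile
terminal's antenna off boresight, and fading power gain. -/
abbrev Link (S : Type*) : Type _ :=
  S × EuclideanSpace ℝ (Fin 2) × Bool × ℝ × ℝ × ℝ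

namespace Link
variable {S : Type*}
def state (p : Link S) : S := p.1
def pos (p : Link S) : EuclideanSpace ℝ (Fin 2) := p.2.1
def active (p : Link S) : Bool := p.2.2.1
def angleBS (p : Link S) : ℝ := p.2.2.2.1
def angleMT (p : Link S) : ℝ := p.2.2.2.2.1
def fading (p : Link S) : ℝ := p.2.2.2.2.2
end Link

namespace Network
variable {S : Type*} [Fintype S] (M : Network S)

/-! ### Load: scheduling and inactivity probabilities -/

/-- Distribution of the area of a cell: gamma with parameter `3.5` and mean `1 / lamBS`. -/
def cellArea : Measure ℝ := gammaMeasure (3.5 : ℝ) ((3.5 : ℝ) * M.lamBS)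

/-- Probability that `n` mobile terminals are associated to a base station. -/
def probLoad (n : ℕ) : ℝ :=
  ∫ a, (poissonMeasure (M.lamMT * a).toNNReal).real {n} ∂M.cellArea

/-- Probability that `n` further mobile terminals are associated to the base station that serves a
given mobile terminal. The cell that contains a given terminal has the area-biased distribution. -/
def probOtherLoad (n : ℕ) : ℝ :=
  ∫ a, M.lamBS * a * (poissonMeasure (M.lamMT * a).toNNReal).real {n} ∂M.cellArea

/-- Probability that a mobile terminal is scheduled: it always is if there are fewer than `nRB`
others, and with probability `nRB / (n + 1)` if there are `n ≥ nRB` others. -/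
def pSel : ℝ := ∑' n : ℕ, min 1 ((M.nRB : ℝ) / (n + 1)) * M.probOtherLoad n

/-- Probability that a base station does not transmit on a given resource block. -/
def pOff : ℝ := ∑ n ∈ Finset.range (M.nRB + 1), (1 - (n : ℝ) / M.nRB) * M.probLoad n

/-- Density of the active base stations. -/
def lamI : ℝ := (1 - M.pOff) * M.lamBS

/-- Transmit power per resource block. -/
def powRB : ℝ := M.powBS / M.nRB

/-- Antenna gain of the intended link (no pointing errors). -/
def gain0 : ℝ := M.patBS 0 * M.patMT 0

/-! ### The point process of base stations -/

/-- Multi-ball link state model: probability that a link of length `r` is in state `s`. -/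
def stateProb (s : S) (r : ℝ) : ℝ :=
  (∑ b : Fin M.B, if M.D b.castSucc ≤ r ∧ r < M.D b.succ then M.q s b.castSucc else 0)
    + if M.D (Fin.last M.B) ≤ r then M.q s (Fin.last M.B) else 0

/-- The fractional moment `E[X_s ^ (2 / α_s)]` of the log-normal shadowing `X_s`, for which
`10 log₁₀ X_s` is normal with mean `mu s` and standard deviation `sig s`. -/
def shadowMoment (s : S) : ℝ :=
  ∫ y, ((10 : ℝ) ^ (y / 10)) ^ (2 / M.alp s) ∂gaussianReal (M.mu s) (M.sig s ^ 2).toNNReal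

/-- Intensity on the plane of the base stations in state `s`. -/
def planeIntensity (s : S) : Measure (EuclideanSpace ℝ (Fin 2)) :=
  (volume : Measure (EuclideanSpace ℝ (Fin 2))).withDensity fun x =>
    ENNReal.ofReal (M.lamBS * M.shadowMoment s * M.stateProb s ‖x‖)

/-- Law of the activity mark. -/
def activeLaw : Measure Bool :=
  ENNReal.ofReal (1 - M.pOff) • Measure.dirac true + ENNReal.ofReal M.pOff • Measure.dirac false

/-- Uniform distribution on `[-π, π)`. -/
def angleLaw : Measure ℝ :=
  ProbabilityTheory.cond volume (Set.Ico (-Real.pi) Real.pi)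

/-- Gamma distribution with fading parameter `m s` and mean `Om s`. -/
def fadingLaw (s : S) : Measure ℝ := gammaMeasure (M.m s) (M.m s / M.Om s)

/-- Intensity measure of the marked process of base stations: all marks are independent of each
other and of the positions. The Poisson process with this intensity is the superposition over `s`
of independent Poisson processes with plane intensities `planeIntensity s`, independently marked. -/
def intensity [MeasurableSpace S] : Measure (Link S) :=
  ∑ s : S, (Measure.dirac s).prod ((M.planeIntensity s).prod
    (M.activeLaw.prod (angleLaw.prod (angleLaw.prod (M.fadingLaw s)))))

/-! ### Rate -/

/-- Path-loss of a link (the inverse of its average received power). -/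
def loss (p : Link S) : ℝ := M.kap p.state * ‖p.pos‖ ^ M.alp p.state

/-- Antenna gain of an interfering link. -/
def gainI (p : Link S) : ℝ := M.antBS.value p.angleBS * M.antMT.value p.angleMT

section
variable [MeasurableSpace S]

/-- `L^(0)`: the smallest path-loss among the points of the configuration `c`. -/
def servingLoss (c : Measure (Link S)) : ℝ := sInf {x : ℝ | 0 < c {p | M.loss p ≤ x}}

/-- `I_agg(x)`: aggregate interference of the active base stations of path-loss above `x`. -/
def interference (c : Measure (Link S)) (x : ℝ) : ℝ≥0∞ :=
  ∫⁻ p in {p | p.active = true ∧ x < M.loss p},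
    ENNReal.ofReal (M.powRB * M.gainI p * p.fading / M.loss p) ∂c

/-- Power received from the serving base station, the one of path-loss `L^(0)`. -/
def signal (c : Measure (Link S)) : ℝ≥0∞ :=
  ∫⁻ p in {p | M.loss p = M.servingLoss c},
    ENNReal.ofReal (M.powRB * M.gain0 * p.fading / M.loss p) ∂c

/-- Signal-to-interference-plus-noise ratio at the typical mobile terminal. -/
def sinr (c : Measure (Link S)) : ℝ :=
  (M.signal c / (ENNReal.ofReal M.noise + M.interference c (M.servingLoss c))).toReal

/-- Area spectral efficiency of the network with base stations `η`. -/
def ase {Ω : Type*} [MeasurableSpace Ω] (P : Measure Ω) (η : Ω → Measure (Link S)) : ℝ :=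
  M.lamMT * M.pSel / Real.log 2 * ∫ ω, Real.log (1 + M.sinr (η ω)) ∂P

end

/-! ### Closed-form expressions -/

/-- The scaling factor `Θ_s`. -/
def theta (s : S) : ℝ :=
  Real.exp (2 * (M.mu s * Real.log 10 / 10) / M.alp s
    + 2 * (M.sig s * Real.log 10 / 10) ^ 2 / M.alp s ^ 2)

/-- Path-loss `κ_s D_b ^ α_s` at the radius `D_b`. -/
def edge (s : S) (b : Fin (M.B + 1)) : ℝ := M.kap s * M.D b ^ M.alp s

/-- Intensity `Λ_s([0, x))` of the path-losses in state `s`. -/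
def Lam (s : S) (x : ℝ) : ℝ :=
  Real.pi * M.lamBS * M.theta s * (∑ b : Fin M.B, M.q s b.castSucc *
      (coHeaviside (x - M.edge s b.succ) * heaviside (x - M.edge s b.castSucc) *
        ((x / M.kap s) ^ (2 / M.alp s) - M.D b.castSucc ^ 2)))
  + Real.pi * M.lamBS * M.theta s * (∑ b : Fin M.B, M.q s b.castSucc *
      (heaviside (x - M.edge s b.succ) * (M.D b.succ ^ 2 - M.D b.castSucc ^ 2)))
  + Real.pi * M.lamBS * M.theta s * M.q s (Fin.last M.B) *
      (heaviside (x - M.edge s (Fin.last M.B)) *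
        ((x / M.kap s) ^ (2 / M.alp s) - M.D (Fin.last M.B) ^ 2))

/-- First derivative of `Λ_s([0, x))`. -/
def LamDeriv (s : S) (x : ℝ) : ℝ :=
  Real.pi * M.lamBS * M.theta s * (2 / M.alp s) * M.kap s ^ (-(2 / M.alp s)) *
      x ^ (2 / M.alp s - 1) * (∑ b : Fin M.B, M.q s b.castSucc *
        (coHeaviside (x - M.edge s b.succ) * heaviside (x - M.edge s b.castSucc)))
  + Real.pi * M.lamBS * M.theta s * (2 / M.alp s) * M.kap s ^ (-(2 / M.alp s)) *
      x ^ (2 / M.alp s - 1) * (M.q s (Fin.last M.B) * heaviside (x - M.edge s (Fin.last M.B)))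

/-- `𝓛_s(x)`. -/
def servingDensity (s : S) (x : ℝ) : ℝ := M.LamDeriv s x * Real.exp (-∑ r, M.Lam r x)

/-- Moment generating function `M_{g_s}(z) = E[exp(-z g_s)]` of the fading. -/
def mgfFading (s : S) (z : ℝ) : ℝ := (1 + z * M.Om s / M.m s) ^ (-M.m s)

/-- `𝓕_s(z)`. -/
def hypF (s : S) (z : ℝ) : ℝ :=
  1 - ∑ i : Fin M.antBS.K, ∑ j : Fin M.antMT.K,
    M.antBS.width i / (2 * Real.pi) * (M.antMT.width j / (2 * Real.pi)) *
      gaussHyp (M.m s) (-(2 / M.alp s)) (1 - 2 / M.alp s)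
        (-(z * (M.Om s / M.m s) * M.antBS.gain i * M.antMT.gain j))

/-- `𝓣_r(z, x)`. -/
def T (r : S) (z x : ℝ) : ℝ :=
  Real.pi * M.lamI * M.theta r * (x / M.kap r) ^ (2 / M.alp r) * M.hypF r z *
      (∑ b : Fin M.B, M.q r b.castSucc *
        (coHeaviside (x - M.edge r b.succ) * heaviside (x - M.edge r b.castSucc)))
  + Real.pi * M.lamI * M.theta r * (∑ b : Fin M.B, M.q r b.castSucc *
      (M.D b.castSucc ^ 2 * M.hypF r (x * z / M.edge r b.castSucc) *
          coHeaviside (x - M.edge r b.castSucc)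
        - M.D b.succ ^ 2 * M.hypF r (x * z / M.edge r b.succ) *
          coHeaviside (x - M.edge r b.succ)))
  + Real.pi * M.lamI * M.theta r * M.q r (Fin.last M.B) *
      (M.D (Fin.last M.B) ^ 2 * M.hypF r (x * z / M.edge r (Fin.last M.B)) *
          coHeaviside (x - M.edge r (Fin.last M.B))
        + (x / M.kap r) ^ (2 / M.alp r) * M.hypF r z *
          heaviside (x - M.edge r (Fin.last M.B)))

/-- Moment generating function `exp (∑_r 𝓣_r(z, x))` of the interference. -/
def mgfInterference (z x : ℝ) : ℝ := Real.exp (∑ r, M.T r z x)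

/-- Integrand of the two-fold integral. -/
def integrand (s : S) (x z : ℝ) : ℝ :=
  Real.exp (-(z * x * M.noise / (M.gain0 * M.powRB))) * M.mgfInterference (z / M.gain0) x *
    (1 - M.mgfFading s z) * M.servingDensity s x / z

end Network
end CellNet

end

noncomputable section

namespace CellNet

open Set Filter
open scoped Topology

/-! ### The function `exp (-x)` on `[0, ∞]` -/

/-! The marked base stations form one Poisson process with intensity `Λ`, and everything rests on
its Laplace functional E exp(-∫ h dη) = exp(-∫ (1 - e^{-h}) dΛ) (`lintegral_expNeg`). It is obtained
from the Poisson counts of disjoint sets through simple functions. Weights take values in [0, ∞]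
with exp(-∞) = 0, so a weight ∞ on a set encodes the event that the set contains no point. Void
probabilities and Laplace transforms are thereby treated by the same formula.

The probabilistic core is `lintegral_lowest`, the joint law of the point p of lowest level (the
serving station) and of a shot noise of the points above it: relative to `Λ(dp)`, the density is
exp(-Λ{ℓ ≤ ℓ(p)}) times the Laplace functional of the points of level above ℓ(p). The levels are cut
into dyadic cells. In a cell, the events "nothing below", "exactly one point here" and the weight of
the points above concern disjoint regions and hence factorize (`lintegral_tsum_cellSel`). Almost
surely there is a unique lowest point, isolated from the other levels (`ae_hasLowestPoint`), so for
a fine enough grid exactly one cell is selected, and dominated convergence gives the formula. The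
dominating density exp(-Λ{ℓ ≤ ℓ(p)}) has mass at most 1, by the same cell identity and Fatou's
lemma.

The interference exponent reduces in polar coordinates to integrals ∫_R^∞ 2r (1 - (1 + c
r^{-α})^{-m}) dr. With δ = 2/α, the function Φ(w) = ₂F₁(m, -δ; 1 - δ; -w) satisfies δΦ - wΦ' = δ(1 +
w)^{-m}, which says exactly that -r²(Φ(c r^{-α}) - 1) is a primitive of the integrand. It vanishes
at infinity because α > 2 (`lintegral_tail_gaussHyp`). Summing over rings, lobes and states yields
the closed form `T`.

For the rate, Frullani's integral log(1 + u/v) = ∫ (1 - e^{-zu}) e^{-zv} dz/z is applied with u the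
serving fading gain and v the serving path-loss times noise plus interference, divided by the
intended gain and the transmit power. The integrand is nonnegative, so the expectation may be taken
first for fixed z, where `lintegral_lowest` applies with an exponential weight. Integrability is
proved separately in `lintegral_rateDensity_ne_top`: the noise controls large z, a fractional power
of z bounds one minus the fading transform near zero, and the density of the serving path-loss
controls x. -/

/-- The exponential `exp (-x)` of an extended nonnegative real, with `expNeg ∞ = 0`. -/
def expNeg (x : ℝ≥0∞) : ℝ≥0∞ := EReal.exp (-(x : EReal))

@[simp] lemma expNeg_zero : expNeg 0 = 1 := by simp [expNeg]

@[simp] lemma expNeg_top : expNeg ∞ = 0 := by simp [expNeg]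

lemma continuous_expNeg : Continuous expNeg :=
  ENNReal.continuous_exp.comp (continuous_neg.comp continuous_coe_ennreal_ereal)

lemma measurable_expNeg : Measurable expNeg := continuous_expNeg.measurable

lemma antitone_expNeg : Antitone expNeg := fun x y h => by
  simpa [expNeg] using h

lemma expNeg_le_one (x : ℝ≥0∞) : expNeg x ≤ 1 := by
  simpa using antitone_expNeg (zero_le : 0 ≤ x)

lemma expNeg_ne_top (x : ℝ≥0∞) : expNeg x ≠ ∞ :=
  ne_top_of_le_ne_top ENNReal.one_ne_top (expNeg_le_one x)

lemma expNeg_add (x y : ℝ≥0∞) : expNeg (x + y) = expNeg x * expNeg y := by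
  rw [expNeg, expNeg, expNeg, ← EReal.exp_add, EReal.coe_ennreal_add,
    EReal.neg_add (by simp) (by simp), sub_eq_add_neg]

lemma expNeg_sum {ι : Type*} (s : Finset ι) (f : ι → ℝ≥0∞) :
    expNeg (∑ i ∈ s, f i) = ∏ i ∈ s, expNeg (f i) := by
  classical
  induction s using Finset.induction_on with
  | empty => simp
  | insert a s ha ih => rw [Finset.sum_insert ha, Finset.prod_insert ha, expNeg_add, ih]

lemma expNeg_mul_natCast (x : ℝ≥0∞) (n : ℕ) : expNeg (x * n) = expNeg x ^ n := by
  have := expNeg_sum (Finset.range n) (fun _ => x)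
  simpa [mul_comm] using this

lemma expNeg_ofReal {r : ℝ} (hr : 0 ≤ r) :
    expNeg (ENNReal.ofReal r) = ENNReal.ofReal (Real.exp (-r)) := by
  rw [expNeg, EReal.coe_ennreal_ofReal, max_eq_left hr, ← EReal.coe_neg, EReal.exp_coe]

lemma expNeg_of_ne_top {x : ℝ≥0∞} (hx : x ≠ ∞) :
    expNeg x = ENNReal.ofReal (Real.exp (-x.toReal)) := by
  rw [← expNeg_ofReal ENNReal.toReal_nonneg, ENNReal.ofReal_toReal hx]

lemma one_sub_expNeg_le (x : ℝ≥0∞) : 1 - expNeg x ≤ x := by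
  rcases eq_or_ne x ∞ with rfl | hx
  · simp
  · rw [expNeg_of_ne_top hx, ← ENNReal.ofReal_one, ← ENNReal.ofReal_sub _ (Real.exp_pos _).le]
    refine ENNReal.ofReal_le_of_le_toReal ?_
    linarith [Real.add_one_le_exp (-x.toReal)]

lemma one_sub_expNeg_mono : Monotone (fun x => 1 - expNeg x) :=
  fun _ _ h => tsub_le_tsub_left (antitone_expNeg h) _

lemma measurable_one_sub_expNeg : Measurable (fun x => 1 - expNeg x) :=
  measurable_expNeg.const_sub 1

lemma continuous_one_sub_expNeg : Continuous (fun x => 1 - expNeg x) := by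
  refine continuous_iff_continuousAt.2 fun x => ?_
  exact ENNReal.Tendsto.sub tendsto_const_nhds (continuous_expNeg.tendsto x)
    (Or.inl ENNReal.one_ne_top)

/-! ### Counts of a Poisson point process -/

namespace IsPoissonPointProcess

variable {Ω E : Type*} [MeasurableSpace Ω] [MeasurableSpace E]
  {P : Measure Ω} {Λ : Measure E} {η : Ω → Measure E}

lemma measurable_count (hη : IsPoissonPointProcess P Λ η) {A : Set E} (hA : MeasurableSet A) :
    Measurable fun ω => η ω A :=
  (Measure.measurable_coe hA).comp hη.measurable

lemma measurable_lintegral (hη : IsPoissonPointProcess P Λ η) {f : E → ℝ≥0∞}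
    (hf : Measurable f) : Measurable fun ω => ∫⁻ x, f x ∂η ω :=
  (Measure.measurable_lintegral hf).comp hη.measurable

lemma lintegral_comp_count (hη : IsPoissonPointProcess P Λ η) {A : Set E}
    (hA : MeasurableSet A) (hfin : Λ A ≠ ∞) {φ : ℝ≥0∞ → ℝ≥0∞} (hφ : Measurable φ) :
    ∫⁻ ω, φ (η ω A) ∂P = ∑' n : ℕ, φ n *
      ENNReal.ofReal (Real.exp (-(Λ A).toReal) * (Λ A).toReal ^ n / n.factorial) := by
  rw [← lintegral_map hφ (hη.measurable_count hA), hη.poisson A hA hfin,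
    lintegral_map hφ (measurable_from_nat), lintegral_countable']
  simp_rw [poissonMeasure_singleton]
  rfl

/-- This is the generating function E y^N = exp(-(1 - y)λ) of a Poisson variable at y = exp(-c). The
value c = ∞ is allowed: since ∞ * 0 = 0, it gives the void probability. -/
lemma lintegral_expNeg_mul_count (hη : IsPoissonPointProcess P Λ η) {A : Set E}
    (hA : MeasurableSet A) (hfin : Λ A ≠ ∞) (c : ℝ≥0∞) :
    ∫⁻ ω, expNeg (c * η ω A) ∂P = expNeg ((1 - expNeg c) * Λ A) := by
  rw [hη.lintegral_comp_count hA hfin (φ := fun x => expNeg (c * x))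
    (measurable_expNeg.comp (measurable_const.mul measurable_id))]
  set l := (Λ A).toReal with hl
  have hl0 : 0 ≤ l := ENNReal.toReal_nonneg
  set y := (expNeg c).toReal with hy
  have hyc : expNeg c = ENNReal.ofReal y := (ENNReal.ofReal_toReal (expNeg_ne_top c)).symm
  have hy0 : 0 ≤ y := ENNReal.toReal_nonneg
  have hy1 : y ≤ 1 := by
    have := ENNReal.toReal_mono ENNReal.one_ne_top (expNeg_le_one c)
    simpa using this
  have hs : HasSum (fun n : ℕ => Real.exp (-l) * ((l * y) ^ n / n.factorial))
      (Real.exp (-l) * Real.exp (l * y)) := by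
    refine HasSum.mul_left _ ?_
    rw [Real.exp_eq_exp_ℝ]
    exact NormedSpace.expSeries_div_hasSum_exp (l * y)
  have hterm : ∀ n : ℕ, expNeg (c * n) * ENNReal.ofReal (Real.exp (-l) * l ^ n / n.factorial)
      = ENNReal.ofReal (Real.exp (-l) * ((l * y) ^ n / n.factorial)) := fun n => by
    rw [expNeg_mul_natCast, hyc, ← ENNReal.ofReal_pow hy0, ← ENNReal.ofReal_mul (by positivity)]
    congr 1
    rw [mul_pow]; ring
  simp_rw [hterm]
  rw [← ENNReal.ofReal_tsum_of_nonneg (fun n => by positivity) hs.summable, hs.tsum_eq,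
    ← Real.exp_add, ← ENNReal.ofReal_toReal hfin, ← hl, hyc, ← ENNReal.ofReal_one,
    ← ENNReal.ofReal_sub _ hy0, ← ENNReal.ofReal_mul (by linarith),
    expNeg_ofReal (mul_nonneg (by linarith) hl0)]
  congr 2
  ring

lemma lintegral_count_eq_one (hη : IsPoissonPointProcess P Λ η) {A : Set E}
    (hA : MeasurableSet A) (hfin : Λ A ≠ ∞) :
    ∫⁻ ω, ({1} : Set ℝ≥0∞).indicator 1 (η ω A) ∂P = Λ A * expNeg (Λ A) := by
  rw [hη.lintegral_comp_count hA hfin (measurable_one.indicator (measurableSet_singleton _)),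
    tsum_eq_single 1]
  · simp only [Nat.cast_one, mem_singleton_iff, indicator_of_mem, Pi.one_apply, pow_one,
      Nat.factorial_one, div_one, one_mul]
    rw [expNeg_of_ne_top hfin, mul_comm, ENNReal.ofReal_mul ENNReal.toReal_nonneg,
      ENNReal.ofReal_toReal hfin]
  · intro n hn
    rw [indicator_of_notMem, zero_mul]
    simpa using hn

lemma lintegral_count (hη : IsPoissonPointProcess P Λ η) {A : Set E}
    (hA : MeasurableSet A) (hfin : Λ A ≠ ∞) : ∫⁻ ω, η ω A ∂P = Λ A := by
  rw [hη.lintegral_comp_count hA hfin (φ := fun x => x) measurable_id]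
  set l := (Λ A).toReal with hl
  have hl0 : 0 ≤ l := ENNReal.toReal_nonneg
  have hs : HasSum (fun n : ℕ => Real.exp (-l) * l * (l ^ n / n.factorial))
      (Real.exp (-l) * l * Real.exp l) := by
    refine HasSum.mul_left _ ?_
    rw [Real.exp_eq_exp_ℝ]
    exact NormedSpace.expSeries_div_hasSum_exp l
  rw [tsum_eq_zero_add' ENNReal.summable]
  have hterm : ∀ n : ℕ, ((n + 1 : ℕ) : ℝ≥0∞) *
      ENNReal.ofReal (Real.exp (-l) * l ^ (n + 1) / (n + 1).factorial)
      = ENNReal.ofReal (Real.exp (-l) * l * (l ^ n / n.factorial)) := fun n => by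
    rw [← ENNReal.ofReal_natCast, ← ENNReal.ofReal_mul (by positivity)]
    congr 1
    rw [Nat.factorial_succ]
    push_cast
    field_simp
    ring
  simp_rw [hterm]
  rw [← ENNReal.ofReal_tsum_of_nonneg (fun n => by positivity) hs.summable, hs.tsum_eq,
    mul_right_comm, ← Real.exp_add]
  simp [hl, hfin]

/-- Campbell's formula for the mean measure. -/
lemma bind_eq (hη : IsPoissonPointProcess P Λ η) [SigmaFinite Λ] : P.bind η = Λ := by
  have hm : ∀ A, MeasurableSet A → P.bind η A = ∫⁻ ω, η ω A ∂P := fun A hA =>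
    Measure.bind_apply hA hη.measurable.aemeasurable
  have hfin : ∀ A, MeasurableSet A → Λ A ≠ ∞ → P.bind η A = Λ A := fun A hA h => by
    rw [hm A hA, hη.lintegral_count hA h]
  ext A hA
  have hU : A = ⋃ n, A ∩ spanningSets Λ n := by
    rw [← inter_iUnion, iUnion_spanningSets, inter_univ]
  have hmono : Monotone fun n => A ∩ spanningSets Λ n := fun i j h =>
    inter_subset_inter_right _ (monotone_spanningSets Λ h)
  -- The mean formula for counts is available only on sets of finite intensity, hence the exhaustion
  -- by spanning sets.
  rw [hU, hmono.measure_iUnion, hmono.measure_iUnion]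
  refine iSup_congr fun n => hfin _ (hA.inter (measurableSet_spanningSets Λ n)) ?_
  exact measure_ne_top_of_subset inter_subset_right (measure_spanningSets_lt_top Λ n).ne

lemma lintegral_lintegral (hη : IsPoissonPointProcess P Λ η) [SigmaFinite Λ]
    {f : E → ℝ≥0∞} (hf : Measurable f) : ∫⁻ ω, ∫⁻ x, f x ∂η ω ∂P = ∫⁻ x, f x ∂Λ := by
  rw [← Measure.lintegral_bind hη.measurable.aemeasurable hf.aemeasurable, hη.bind_eq]

/-! ### The Laplace functional -/

lemma iIndepFun_count (hη : IsPoissonPointProcess P Λ η) {ι : Type*} [Fintype ι]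
    (A : ι → Set E) (hA : ∀ i, MeasurableSet (A i))
    (hd : Pairwise fun i j => Disjoint (A i) (A j)) : iIndepFun (fun i ω => η ω (A i)) P := by
  have e := Fintype.equivFin ι
  have h := hη.indep (Fintype.card ι) (fun i => A (e.symm i)) (fun i => hA _)
    (fun i j hij => hd (e.symm.injective.ne hij))
  simpa using h.precomp e.injective

lemma lintegral_prod_count (hη : IsPoissonPointProcess P Λ η) {ι : Type*} [Fintype ι]
    (A : ι → Set E) (hA : ∀ i, MeasurableSet (A i))
    (hd : Pairwise fun i j => Disjoint (A i) (A j)) (φ : ι → ℝ≥0∞ → ℝ≥0∞)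
    (hφ : ∀ i, Measurable (φ i)) :
    ∫⁻ ω, ∏ i, φ i (η ω (A i)) ∂P = ∏ i, ∫⁻ ω, φ i (η ω (A i)) ∂P :=
  lintegral_prod_eq_prod_lintegral_of_indepFun Finset.univ _
    ((hη.iIndepFun_count A hA hd).comp φ hφ) fun i => (hφ i).comp (hη.measurable_count (hA i))

/-- The integral of a simple function is a finite combination of counts in its level sets, so
independence of counts in disjoint sets factorizes the expectation. In the index type `Option R`,
`none` stands for `A` and `some c` for the fibre of `c`. The value 0 is left out: its fibre contains
`A` and may have infinite intensity. -/
lemma lintegral_comp_count_mul_expNeg_simpleFunc (hη : IsPoissonPointProcess P Λ η)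
    {A : Set E} (hA : MeasurableSet A)
    {φ : ℝ≥0∞ → ℝ≥0∞} (hφ : Measurable φ) (g : SimpleFunc E ℝ≥0∞) (hgA : ∀ x ∈ A, g x = 0)
    (hg : ∀ c, c ≠ 0 → Λ (g ⁻¹' {c}) ≠ ∞) :
    ∫⁻ ω, φ (η ω A) * expNeg (∫⁻ x, g x ∂η ω) ∂P
      = (∫⁻ ω, φ (η ω A) ∂P) * expNeg (∫⁻ x, (1 - expNeg (g x)) ∂Λ) := by
  classical
  let R := g.range.filter (· ≠ 0)
  let B : Option R → Set E := fun o => o.elim A fun c => g ⁻¹' {(c : ℝ≥0∞)}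
  let ψ : Option R → ℝ≥0∞ → ℝ≥0∞ := fun o => o.elim φ fun c x => expNeg (c * x)
  have hB : ∀ o, MeasurableSet (B o) := by
    rintro (_ | c)
    · exact hA
    · exact g.measurableSet_fiber c
  have hψ : ∀ o, Measurable (ψ o) := by
    rintro (_ | c)
    · exact hφ
    · exact measurable_expNeg.comp (measurable_const.mul measurable_id)
  have hR : ∀ c : R, (c : ℝ≥0∞) ≠ 0 := fun c => (Finset.mem_filter.1 c.2).2
  have hd : Pairwise fun i j => Disjoint (B i) (B j) := by
    have key : ∀ c : R, Disjoint A (g ⁻¹' {(c : ℝ≥0∞)}) := fun c => by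
      refine Set.disjoint_left.2 fun x hx hx' => hR c ?_
      rw [← hgA x hx]; exact hx'.symm
    rintro (_ | c) (_ | d) h
    · exact absurd rfl h
    · exact key d
    · exact (key c).symm
    · refine Set.disjoint_left.2 fun x hx hx' => h ?_
      have : (c : ℝ≥0∞) = d := by rw [← show g x = c from hx]; exact hx'
      rw [Subtype.ext this]
  have hsum : ∀ (μ : Measure E) (F : ℝ≥0∞ → ℝ≥0∞), F 0 = 0 →
      ∫⁻ x, F (g x) ∂μ = ∑ c : R, F c * μ (g ⁻¹' {(c : ℝ≥0∞)}) := fun μ F hF => by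
    have h1 : ∫⁻ x, F (g x) ∂μ = ∑ c ∈ g.range, F c * μ (g ⁻¹' {c}) := by
      rw [← SimpleFunc.map_lintegral]
      exact ((g.map F).lintegral_eq_lintegral μ).symm ▸ rfl
    rw [h1, Finset.sum_coe_sort R (fun c => F c * μ (g ⁻¹' {c})), Finset.sum_filter_of_ne]
    rintro c - hc rfl
    exact hc (by rw [hF, zero_mul])
  have h1 := hη.lintegral_prod_count B hB hd ψ hψ
  simp only [Fintype.prod_option] at h1
  have h2 : ∀ ω, expNeg (∫⁻ x, g x ∂η ω) = ∏ c : R, expNeg (c * η ω (g ⁻¹' {(c : ℝ≥0∞)})) :=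
    fun ω => by rw [hsum (η ω) (fun x => x) rfl, expNeg_sum]
  simp_rw [h2]
  refine h1.trans ?_
  congr 1
  rw [hsum Λ (fun x => 1 - expNeg x) (by simp), expNeg_sum]
  refine Finset.prod_congr rfl fun c _ => ?_
  exact hη.lintegral_expNeg_mul_count (g.measurableSet_fiber _) (hg c (hR c)) c

/-- The Laplace functional, jointly with the number of points in a set on which the integrand
vanishes. -/
lemma lintegral_comp_count_mul_expNeg [IsProbabilityMeasure P]
    (hη : IsPoissonPointProcess P Λ η) [SigmaFinite Λ]
    {A : Set E} (hA : MeasurableSet A) {φ : ℝ≥0∞ → ℝ≥0∞} (hφ : Measurable φ) (hφ1 : ∀ x, φ x ≤ 1)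
    {h : E → ℝ≥0∞} (hh : Measurable h) (hhA : ∀ x ∈ A, h x = 0) :
    ∫⁻ ω, φ (η ω A) * expNeg (∫⁻ x, h x ∂η ω) ∂P
      = (∫⁻ ω, φ (η ω A) ∂P) * expNeg (∫⁻ x, (1 - expNeg (h x)) ∂Λ) := by
  classical
  -- The restriction to spanning sets gives the nonzero fibres of the approximation finite
  -- intensity.
  let g : ℕ → SimpleFunc E ℝ≥0∞ := fun n =>
    (SimpleFunc.eapprox h n).restrict (spanningSets Λ n)
  have hgapp : ∀ n x, g n x = (spanningSets Λ n).indicator (SimpleFunc.eapprox h n) x :=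
    fun n x => SimpleFunc.restrict_apply _ (measurableSet_spanningSets Λ n) x
  have hle : ∀ n x, SimpleFunc.eapprox h n x ≤ h x := fun n x => by
    rw [← SimpleFunc.iSup_eapprox_apply hh x]; exact le_iSup (fun n => SimpleFunc.eapprox h n x) n
  have hgle : ∀ n x, g n x ≤ h x := fun n x => by
    rw [hgapp]; exact (indicator_le_self _ _ x).trans (hle n x)
  have hmono : ∀ x, Monotone fun n => g n x := fun x i j hij => by
    simp only [hgapp]
    exact (indicator_le_indicator (SimpleFunc.monotone_eapprox h hij x)).trans
      (indicator_le_indicator_of_subset (monotone_spanningSets Λ hij) (fun _ => zero_le) x)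
  have hlim : ∀ x, Tendsto (fun n => g n x) atTop (𝓝 (h x)) := fun x => by
    have h1 : Tendsto (fun n => SimpleFunc.eapprox h n x) atTop (𝓝 (h x)) := by
      rw [← SimpleFunc.iSup_eapprox_apply hh x]
      exact tendsto_atTop_iSup fun i j hij => SimpleFunc.monotone_eapprox h hij x
    refine h1.congr' ?_
    have hx : x ∈ ⋃ n, spanningSets Λ n := by rw [iUnion_spanningSets]; trivial
    obtain ⟨N, hN⟩ := mem_iUnion.1 hx
    filter_upwards [eventually_ge_atTop N] with n hn
    rw [hgapp, indicator_of_mem (monotone_spanningSets Λ hn hN)]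
  have hgA : ∀ n, ∀ x ∈ A, g n x = 0 := fun n x hx =>
    le_antisymm ((hgle n x).trans (hhA x hx).le) zero_le
  have hgfin : ∀ n c, c ≠ 0 → Λ (g n ⁻¹' {c}) ≠ ∞ := fun n c hc => by
    refine measure_ne_top_of_subset (fun x hx => ?_) (measure_spanningSets_lt_top Λ n).ne
    by_contra hx'
    have : g n x = c := hx
    rw [hgapp, indicator_of_notMem hx'] at this
    exact hc this.symm
  have hconv : ∀ μ : Measure E, ∀ F : ℝ≥0∞ → ℝ≥0∞, Monotone F → Continuous F →
      Tendsto (fun n => ∫⁻ x, F (g n x) ∂μ) atTop (𝓝 (∫⁻ x, F (h x) ∂μ)) := fun μ F hF hFc =>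
    lintegral_tendsto_of_tendsto_of_monotone
      (fun n => (hFc.measurable.comp (g n).measurable).aemeasurable)
      (.of_forall fun x i j hij => hF (hmono x hij))
      (.of_forall fun x => (hFc.tendsto _).comp (hlim x))
  -- The inner integrals converge monotonically, the outer one by domination: both factors are at
  -- most 1.
  have hL : Tendsto (fun n => ∫⁻ ω, φ (η ω A) * expNeg (∫⁻ x, g n x ∂η ω) ∂P) atTop
      (𝓝 (∫⁻ ω, φ (η ω A) * expNeg (∫⁻ x, h x ∂η ω) ∂P)) := by
    refine tendsto_lintegral_of_dominated_convergence (fun _ => 1) (fun n => ?_)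
      (fun n => .of_forall fun ω => mul_le_one' (hφ1 _) (expNeg_le_one _)) (by simp)
      (.of_forall fun ω => ?_)
    · exact (hφ.comp (hη.measurable_count hA)).mul
        (measurable_expNeg.comp (hη.measurable_lintegral (g n).measurable))
    · refine ENNReal.Tendsto.const_mul ((continuous_expNeg.tendsto _).comp
        (hconv (η ω) (fun x => x) monotone_id continuous_id)) (Or.inr ?_)
      exact ne_top_of_le_ne_top ENNReal.one_ne_top (hφ1 _)
  refine tendsto_nhds_unique hL ?_
  simp_rw [fun n => hη.lintegral_comp_count_mul_expNeg_simpleFunc hA hφ (g n) (hgA n) (hgfin n)]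
  refine ENNReal.Tendsto.const_mul ((continuous_expNeg.tendsto _).comp
    (hconv Λ (fun x => 1 - expNeg x) one_sub_expNeg_mono continuous_one_sub_expNeg)) (Or.inr ?_)
  refine ne_top_of_le_ne_top ENNReal.one_ne_top ((lintegral_mono fun ω => hφ1 _).trans ?_)
  simp

/-- The Laplace functional of a Poisson point process. -/
lemma lintegral_expNeg [IsProbabilityMeasure P] (hη : IsPoissonPointProcess P Λ η)
    [SigmaFinite Λ] {h : E → ℝ≥0∞} (hh : Measurable h) :
    ∫⁻ ω, expNeg (∫⁻ x, h x ∂η ω) ∂P = expNeg (∫⁻ x, (1 - expNeg (h x)) ∂Λ) := by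
  have := hη.lintegral_comp_count_mul_expNeg MeasurableSet.empty (φ := fun _ => 1)
    measurable_const (fun _ => le_rfl) hh (by simp)
  simpa using this

end IsPoissonPointProcess

/-! ### Configurations of points -/

/-- A countable sum of Dirac masses. -/
def IsConfiguration {E : Type*} [MeasurableSpace E] (μ : Measure E) : Prop :=
  ∃ (I : Set ℕ) (x : ℕ → E), μ = Measure.sum fun i : I => Measure.dirac (x i)

namespace IsConfiguration

variable {E : Type*} [MeasurableSpace E] {μ : Measure E}

/-- A counting measure has no values strictly between 0 and 1. This turns limits of masses into
exact statements about points. -/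
lemma one_le (hμ : IsConfiguration μ) {A : Set E} (hA : MeasurableSet A) (h : μ A ≠ 0) :
    1 ≤ μ A := by
  obtain ⟨I, x, rfl⟩ := hμ
  rw [Measure.sum_apply _ hA] at h ⊢
  obtain ⟨i, hi⟩ : ∃ i : I, Measure.dirac (x i) A ≠ 0 := by
    by_contra! h'
    exact h (by simp [h'])
  refine le_trans ?_ (ENNReal.le_tsum i)
  rw [Measure.dirac_apply' _ hA] at hi ⊢
  by_cases hx : x i ∈ A <;> simp_all

lemma exists_lintegral_eq (hμ : IsConfiguration μ) {A : Set E} (hA : MeasurableSet A)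
    (h : μ A ≠ 0) (h2 : μ A < 2) :
    μ A = 1 ∧ ∃ p ∈ A, ∀ f : E → ℝ≥0∞, Measurable f → ∫⁻ q in A, f q ∂μ = f p := by
  classical
  obtain ⟨I, x, rfl⟩ := hμ
  rw [Measure.sum_apply _ hA] at h h2
  have hd : ∀ i : I, Measure.dirac (x i) A = A.indicator 1 (x i) := fun i =>
    Measure.dirac_apply' _ hA
  simp_rw [hd] at h h2
  obtain ⟨i, hi⟩ : ∃ i : I, x i ∈ A := by
    by_contra! h'
    exact h (by simp [h'])
  -- Indices rather than points are compared: coinciding points are counted with multiplicity, so a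
  -- second index in `A` already forces mass 2.
  have huniq : ∀ j : I, j ≠ i → x j ∉ A := fun j hj hjA => by
    refine h2.not_ge ?_
    refine le_trans ?_ (ENNReal.sum_le_tsum {j, i})
    rw [Finset.sum_pair hj, indicator_of_mem hjA, indicator_of_mem hi]
    norm_num
  have key : ∀ f : E → ℝ≥0∞, Measurable f →
      ∫⁻ q in A, f q ∂(Measure.sum fun i : I => Measure.dirac (x i)) = f (x i) := fun f hf => by
    rw [← lintegral_indicator hA, lintegral_sum_measure, tsum_eq_single i]
    · rw [lintegral_dirac' _ (hf.indicator hA), indicator_of_mem hi]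
    · intro j hj
      rw [lintegral_dirac' _ (hf.indicator hA), indicator_of_notMem (huniq j hj)]
  refine ⟨?_, x i, hi, key⟩
  rw [Measure.sum_apply _ hA]
  simpa using key 1 measurable_one

end IsConfiguration

/-! ### Dyadic cells of the level -/

section Level

variable {E : Type*} (ℓ : E → ℝ)

/-- The points of a dyadic grid. -/
def dyadic (n k : ℕ) : ℝ := k / 2 ^ n

/-- The index of the dyadic cell that contains `x`. -/
def dyadicIndex (n : ℕ) (x : ℝ) : ℕ := ⌊x * 2 ^ n⌋₊

lemma dyadic_le {n k : ℕ} {x : ℝ} (hx : 0 ≤ x) : dyadic n k ≤ x ↔ k ≤ dyadicIndex n x := by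
  rw [dyadic, dyadicIndex, Nat.le_floor_iff (by positivity), div_le_iff₀ (by positivity)]

lemma lt_dyadic {n k : ℕ} {x : ℝ} (hx : 0 ≤ x) : x < dyadic n k ↔ dyadicIndex n x < k := by
  rw [← not_le, dyadic_le hx, not_le]

lemma dyadic_succ (n k : ℕ) : dyadic n (k + 1) = dyadic n k + 1 / 2 ^ n := by
  simp [dyadic, add_div]

lemma dyadic_mono (n : ℕ) : Monotone (dyadic n) := fun i j h => by
  unfold dyadic; gcongr

/-- The points with level in a dyadic interval. -/
def cell (n k : ℕ) : Set E := {p | dyadic n k ≤ ℓ p ∧ ℓ p < dyadic n (k + 1)}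

variable {ℓ}

lemma mem_cell (hℓ0 : ∀ p, 0 ≤ ℓ p) {n k : ℕ} {p : E} :
    p ∈ cell ℓ n k ↔ dyadicIndex n (ℓ p) = k := by
  simp only [cell, mem_ofPred_eq, dyadic_le (hℓ0 p), lt_dyadic (hℓ0 p)]
  omega

variable [MeasurableSpace E]

lemma measurableSet_cell (hℓ : Measurable ℓ) (n k : ℕ) : MeasurableSet (cell ℓ n k) :=
  (measurableSet_le measurable_const hℓ).inter (measurableSet_lt hℓ measurable_const)

/-- The cells partition the space, so a sum over cells becomes one integral in which the coefficient
is read off from the cell of the point. In this form the grid can be refined with the point held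
fixed. -/
lemma tsum_mul_setLIntegral_cell (hℓ : Measurable ℓ) (hℓ0 : ∀ p, 0 ≤ ℓ p) (μ : Measure E) (n : ℕ)
    (a : ℕ → ℝ≥0∞) {g : E → ℝ≥0∞} (hg : Measurable g) :
    ∑' k, a k * ∫⁻ p in cell ℓ n k, g p ∂μ = ∫⁻ p, a (dyadicIndex n (ℓ p)) * g p ∂μ := by
  have hU : ⋃ k, cell ℓ n k = univ := eq_univ_of_forall fun p =>
    mem_iUnion.2 ⟨_, (mem_cell hℓ0).2 rfl⟩
  have hd : Pairwise (Function.onFun Disjoint (cell ℓ n)) := fun i j hij =>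
    Set.disjoint_left.2 fun p hi hj => hij (((mem_cell hℓ0).1 hi).symm.trans ((mem_cell hℓ0).1 hj))
  rw [← setLIntegral_univ (μ := μ) (fun p => a (dyadicIndex n (ℓ p)) * g p), ← hU,
    lintegral_iUnion (measurableSet_cell hℓ n) hd]
  refine tsum_congr fun k => ?_
  rw [← lintegral_const_mul _ hg]
  refine setLIntegral_congr_fun (measurableSet_cell hℓ n k) fun p hp => ?_
  simp only [(mem_cell hℓ0).1 hp]

lemma tendsto_dyadic_dyadicIndex_succ {x : ℝ} (hx : 0 ≤ x) :
    Tendsto (fun n => dyadic n (dyadicIndex n x + 1)) atTop (𝓝 x) := by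
  have h0 : Tendsto (fun n : ℕ => (1 : ℝ) / 2 ^ n) atTop (𝓝 0) := by
    simpa using tendsto_pow_atTop_nhds_zero_of_lt_one (r := (1 / 2 : ℝ)) (by norm_num) (by norm_num)
  refine tendsto_of_tendsto_of_tendsto_of_le_of_le tendsto_const_nhds
    (by simpa using h0.const_add x) (fun n => ((lt_dyadic hx).2 (Nat.lt_succ_self _)).le)
    fun n => ?_
  simp only [dyadic_succ]
  exact add_le_add ((dyadic_le hx).2 le_rfl) (one_div _).le

lemma dyadicIndex_bounds {x : ℝ} (hx : 0 ≤ x) (n : ℕ) :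
    dyadic n (dyadicIndex n x) ≤ x ∧ x < dyadic n (dyadicIndex n x + 1) ∧
      dyadic n (dyadicIndex n x + 1) ≤ x + 1 / 2 ^ n := by
  refine ⟨(dyadic_le hx).2 le_rfl, (lt_dyadic hx).2 (Nat.lt_succ_self _), ?_⟩
  rw [dyadic_succ]
  gcongr
  exact (dyadic_le hx).2 le_rfl

variable (ℓ) in
/-- The lowest level of a point of the configuration `μ`. -/
def lowestLevel (μ : Measure E) : ℝ := sInf {x : ℝ | 0 < μ {p | ℓ p ≤ x}}

variable (ℓ) in
/-- The indicator of the configurations with no point of level below a dyadic cell, and exactly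
one point of level in this cell. -/
def cellSel (n k : ℕ) (μ : Measure E) : ℝ≥0∞ :=
  expNeg (∞ * μ {p | ℓ p < dyadic n k}) * ({1} : Set ℝ≥0∞).indicator 1 (μ (cell ℓ n k))

lemma cellSel_eq_one {n k : ℕ} {μ : Measure E} (h0 : μ {p | ℓ p < dyadic n k} = 0)
    (h1 : μ (cell ℓ n k) = 1) : cellSel ℓ n k μ = 1 := by
  simp [cellSel, h0, h1]

lemma of_cellSel_ne_zero {n k : ℕ} {μ : Measure E} (h : cellSel ℓ n k μ ≠ 0) :
    μ {p | ℓ p < dyadic n k} = 0 ∧ μ (cell ℓ n k) = 1 := by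
  constructor
  · by_contra h'
    exact h (by simp [cellSel, h'])
  · by_contra h'
    exact h (by simp [cellSel, h'])

/-- The point in the lower of two selected cells would violate the emptiness below the higher one.
-/
lemma cellSel_unique {n k j : ℕ} {μ : Measure E} (hk : cellSel ℓ n k μ ≠ 0)
    (hj : cellSel ℓ n j μ ≠ 0) : k = j := by
  by_contra hne
  wlog h : k < j generalizing k j with H
  · exact H hj hk (Ne.symm hne) (by omega)
  have h1 := (of_cellSel_ne_zero hk).2
  have h2 := (of_cellSel_ne_zero hj).1
  rw [measure_mono_null (fun p (hp : p ∈ cell ℓ n k) =>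
    lt_of_lt_of_le hp.2 (dyadic_mono n h)) h2] at h1
  exact zero_ne_one h1

lemma tsum_cellSel_mul {n k : ℕ} {μ : Measure E} (h0 : μ {p | ℓ p < dyadic n k} = 0)
    (h1 : μ (cell ℓ n k) = 1) (φ : ℕ → ℝ≥0∞) : ∑' j, cellSel ℓ n j μ * φ j = φ k := by
  have hk := cellSel_eq_one h0 h1
  rw [tsum_eq_single k, hk, one_mul]
  intro j hj
  by_contra h
  refine hj (cellSel_unique (left_ne_zero_of_mul h) ?_)
  rw [hk]; exact one_ne_zero

/-- At most one cell is selected, so the whole sum is a single term. The bound on `φ` is required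
only for cells with exactly one point, where an integral of a function bounded by 1 is at most 1. -/
lemma tsum_cellSel_mul_le {n : ℕ} {μ : Measure E} (φ : ℕ → ℝ≥0∞)
    (hφ : ∀ k, μ (cell ℓ n k) = 1 → φ k ≤ 1) : ∑' j, cellSel ℓ n j μ * φ j ≤ 1 := by
  by_cases h : ∃ k, cellSel ℓ n k μ ≠ 0
  · obtain ⟨k, hk⟩ := h
    obtain ⟨h0, h1⟩ := of_cellSel_ne_zero hk
    rw [tsum_cellSel_mul h0 h1]
    exact hφ k h1
  · push Not at h
    simp [h]

variable (ℓ) in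
/-- A configuration with exactly one point of lowest level, at which level the points do not
accumulate. -/
structure HasLowestPoint (μ : Measure E) : Prop where
  pos : 0 < lowestLevel ℓ μ
  eq_one : μ {p | ℓ p = lowestLevel ℓ μ} = 1
  eq_zero : μ {p | ℓ p < lowestLevel ℓ μ} = 0
  gap : ∃ ε > 0, μ {p | lowestLevel ℓ μ < ℓ p ∧ ℓ p < lowestLevel ℓ μ + ε} = 0

/-- Once the mesh is smaller than the gap above the lowest level, the cell of that level contains
the lowest point and no other, and the points from the upper end of the cell onwards are those
strictly above the lowest level. The dyadic restrictions of the configuration are then eventually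
constant, not merely convergent. -/
lemma HasLowestPoint.eventually {μ : Measure E} (hμ : HasLowestPoint ℓ μ) :
    ∀ᶠ n in atTop, μ {p | ℓ p < dyadic n (dyadicIndex n (lowestLevel ℓ μ))} = 0 ∧
      μ (cell ℓ n (dyadicIndex n (lowestLevel ℓ μ))) = 1 ∧
      μ.restrict (cell ℓ n (dyadicIndex n (lowestLevel ℓ μ))) =
        μ.restrict {p | ℓ p = lowestLevel ℓ μ} ∧
      μ.restrict {p | dyadic n (dyadicIndex n (lowestLevel ℓ μ) + 1) ≤ ℓ p} =
        μ.restrict {p | lowestLevel ℓ μ < ℓ p} := by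
  obtain ⟨ε, hε, hgap⟩ := hμ.gap
  have hlt := hμ.eq_zero
  set L := lowestLevel ℓ μ with hL
  have hL0 : 0 ≤ L := hμ.pos.le
  have h0 : Tendsto (fun n : ℕ => (1 : ℝ) / 2 ^ n) atTop (𝓝 0) := by
    simpa using tendsto_pow_atTop_nhds_zero_of_lt_one (r := (1 / 2 : ℝ)) (by norm_num) (by norm_num)
  filter_upwards [h0.eventually (gt_mem_nhds hε)] with n hn
  obtain ⟨b1, b2, b3⟩ := dyadicIndex_bounds hL0 n
  have hnull : ∀ᵐ p ∂μ, ¬ ℓ p < L ∧ ¬ (L < ℓ p ∧ ℓ p < L + ε) := by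
    rw [ae_iff]
    refine measure_mono_null (fun p hp => ?_) (measure_union_null hlt hgap)
    simp only [mem_ofPred_eq] at hp
    by_cases h : ℓ p < L
    · exact Or.inl h
    · exact Or.inr (by tauto)
  have hc : cell ℓ n (dyadicIndex n L) =ᵐ[μ] {p | ℓ p = L} := by
    refine eventuallyEq_set.2 ?_
    filter_upwards [hnull] with p hp
    simp only [cell, mem_ofPred_eq]
    constructor
    · rintro ⟨h1, h2⟩
      by_contra hne
      rcases lt_or_gt_of_ne hne with h | h
      · exact hp.1 h
      · exact hp.2 ⟨h, by linarith⟩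
    · intro h
      rw [h]; exact ⟨b1, b2⟩
  refine ⟨measure_mono_null (fun p (hp : ℓ p < _) => lt_of_lt_of_le hp b1) hlt, ?_,
    Measure.restrict_congr_set hc, Measure.restrict_congr_set ?_⟩
  · rw [measure_congr hc]; exact hμ.eq_one
  · refine eventuallyEq_set.2 ?_
    filter_upwards [hnull] with p hp
    constructor
    · intro (h : _ ≤ ℓ p)
      show L < ℓ p
      linarith
    · intro (h : L < ℓ p)
      by_contra h'
      have h' : ¬ dyadic n (dyadicIndex n L + 1) ≤ ℓ p := h'
      exact hp.2 ⟨h, by linarith⟩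

end Level

/-! ### Void probabilities, distinct levels and existence of a lowest point. -/

namespace IsPoissonPointProcess

variable {Ω E : Type*} [MeasurableSpace Ω] [MeasurableSpace E]
  {P : Measure Ω} {Λ : Measure E} {η : Ω → Measure E} {ℓ : E → ℝ}

lemma ae_isConfiguration (hη : IsPoissonPointProcess P Λ η) : ∀ᵐ ω ∂P, IsConfiguration (η ω) :=
  hη.counting

lemma ae_count_ne_top (hη : IsPoissonPointProcess P Λ η) {A : Set E} (hA : MeasurableSet A)
    (hfin : Λ A ≠ ∞) : ∀ᵐ ω ∂P, η ω A ≠ ∞ := by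
  have := ae_lt_top (hη.measurable_count hA) (by rwa [hη.lintegral_count hA hfin])
  filter_upwards [this] with ω h using h.ne

lemma ae_count_eq_zero (hη : IsPoissonPointProcess P Λ η) {A : Set E} (hA : MeasurableSet A)
    (h : Λ A = 0) : ∀ᵐ ω ∂P, η ω A = 0 := by
  have := (lintegral_eq_zero_iff (hη.measurable_count hA)).1
    (by rw [hη.lintegral_count hA (by simp [h]), h])
  exact this

lemma measure_count_eq_zero (hη : IsPoissonPointProcess P Λ η) {A : Set E} (hA : MeasurableSet A)
    (hfin : Λ A ≠ ∞) : P {ω | η ω A = 0} = expNeg (Λ A) := by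
  -- With weight ∞ the exponential of the count is the indicator of having no point.
  have h := hη.lintegral_expNeg_mul_count hA hfin ∞
  have h1 : (fun ω => expNeg (∞ * η ω A)) = {ω | η ω A = 0}.indicator 1 := by
    ext ω
    by_cases h0 : η ω A = 0 <;> simp [h0]
  have hm : MeasurableSet {ω | η ω A = 0} := hη.measurable_count hA (measurableSet_singleton 0)
  rw [h1, lintegral_indicator_one hm] at h
  simpa using h

/-- From 1{N ≥ 2} + 1{N = 1} ≤ N, taking means gives P(N ≥ 2) ≤ λ - λe^{-λ} ≤ λ². The square makes
the union bound over small cells vanish in the limit. -/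
lemma measure_two_le_count (hη : IsPoissonPointProcess P Λ η) {A : Set E} (hA : MeasurableSet A)
    (hfin : Λ A ≠ ∞) : P {ω | 2 ≤ η ω A} ≤ Λ A * Λ A := by
  have hm : MeasurableSet {ω | 2 ≤ η ω A} :=
    measurableSet_le measurable_const (hη.measurable_count hA)
  have h : P {ω | 2 ≤ η ω A} + Λ A * expNeg (Λ A) ≤ Λ A := by
    rw [← hη.lintegral_count_eq_one hA hfin, ← lintegral_indicator_one hm,
      ← lintegral_add_left (measurable_one.indicator hm)]
    conv_rhs => rw [← hη.lintegral_count hA hfin]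
    refine lintegral_mono fun ω => ?_
    by_cases h2 : 2 ≤ η ω A
    · have h1 : η ω A ≠ 1 := by
        intro h; rw [h] at h2; exact absurd h2 (by norm_num)
      rw [indicator_of_mem (by exact h2), indicator_of_notMem (by simpa using h1), add_zero]
      exact le_trans (by norm_num) h2
    · rw [indicator_of_notMem (by exact h2), zero_add]
      by_cases h1 : η ω A = 1
      · simp [h1]
      · rw [indicator_of_notMem (by simpa using h1)]; exact zero_le
  have h' : P {ω | 2 ≤ η ω A} ≤ Λ A - Λ A * expNeg (Λ A) :=
    ENNReal.le_sub_of_add_le_right (ENNReal.mul_ne_top hfin (expNeg_ne_top _)) h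
  refine h'.trans ?_
  calc Λ A - Λ A * expNeg (Λ A) = Λ A * (1 - expNeg (Λ A)) := by
        rw [ENNReal.mul_sub (fun _ _ => hfin), mul_one]
    _ ≤ Λ A * Λ A := by gcongr; exact one_sub_expNeg_le _

/-- Almost surely, bounded levels are attained by finitely many points. -/
lemma ae_count_le_ne_top (hη : IsPoissonPointProcess P Λ η) (hℓ : Measurable ℓ)
    (hfin : ∀ x, Λ {p | ℓ p ≤ x} ≠ ∞) : ∀ᵐ ω ∂P, ∀ x, η ω {p | ℓ p ≤ x} ≠ ∞ := by
  have h : ∀ᵐ ω ∂P, ∀ n : ℕ, η ω {p | ℓ p ≤ n} ≠ ∞ := ae_all_iff.2 fun n =>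
    hη.ae_count_ne_top (measurableSet_le hℓ measurable_const) (hfin n)
  filter_upwards [h] with ω hω x
  obtain ⟨n, hn⟩ := exists_nat_ge x
  exact measure_ne_top_of_subset (fun p (hp : ℓ p ≤ x) => le_trans hp hn) (hω n)

/-- The void probabilities exp(-Λ{ℓ ≤ n}) tend to exp(-∞) = 0 because the total intensity is
infinite. -/
lemma ae_exists_count_ne_zero (hη : IsPoissonPointProcess P Λ η) (hℓ : Measurable ℓ)
    (hfin : ∀ x, Λ {p | ℓ p ≤ x} ≠ ∞) (hinf : Λ univ = ∞) :
    ∀ᵐ ω ∂P, ∃ x, η ω {p | ℓ p ≤ x} ≠ 0 := by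
  have hm : ∀ x, MeasurableSet {p | ℓ p ≤ x} := fun x => measurableSet_le hℓ measurable_const
  rw [ae_iff]
  have hle : ∀ n : ℕ, P {ω | ¬ ∃ x, η ω {p | ℓ p ≤ x} ≠ 0} ≤ expNeg (Λ {p | ℓ p ≤ n}) :=
    fun n => by
      rw [← hη.measure_count_eq_zero (hm n) (hfin n)]
      refine measure_mono fun ω hω => ?_
      simp only [mem_ofPred_eq, not_exists, not_not] at hω
      exact hω n
  have hlim : Tendsto (fun n : ℕ => Λ {p | ℓ p ≤ n}) atTop (𝓝 ∞) := by
    have hU : ⋃ n : ℕ, {p | ℓ p ≤ n} = univ := eq_univ_of_forall fun p =>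
      mem_iUnion.2 (exists_nat_ge (ℓ p))
    rw [← hinf, ← hU]
    exact tendsto_measure_iUnion_atTop fun i j hij p (hp : ℓ p ≤ i) =>
      le_trans hp (Nat.cast_le.2 hij)
  have h0 := (continuous_expNeg.tendsto _).comp hlim
  rw [expNeg_top] at h0
  exact le_antisymm (ge_of_tendsto' h0 hle) zero_le

/-- Almost surely, no two points have the same level. -/
lemma ae_count_level_lt_two (hη : IsPoissonPointProcess P Λ η) (hℓ : Measurable ℓ)
    (hℓ0 : ∀ p, 0 ≤ ℓ p) (hfin : ∀ x, Λ {p | ℓ p ≤ x} ≠ ∞) (hatom : ∀ x, Λ {p | ℓ p = x} = 0) :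
    ∀ᵐ ω ∂P, ∀ x, 0 ≤ x → η ω {p | ℓ p = x} < 2 := by
  have hcfin : ∀ n k, Λ (cell ℓ n k) ≠ ∞ := fun n k =>
    measure_ne_top_of_subset (fun p hp => hp.2.le) (hfin (dyadic n (k + 1)))
  -- The cell of `x` lies in a band around `x` that shrinks to the level set of `x`, which has zero
  -- intensity.
  have hcell : ∀ x, 0 ≤ x → Tendsto (fun n => Λ (cell ℓ n (dyadicIndex n x))) atTop (𝓝 0) := by
    intro x hx
    let s : ℕ → Set E := fun n => {p | |ℓ p - x| ≤ 1 / 2 ^ n}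
    have hs : ∀ n, MeasurableSet (s n) := fun n =>
      measurableSet_le (hℓ.sub_const x).abs measurable_const
    have hanti : Antitone s := fun i j hij p (hp : |ℓ p - x| ≤ 1 / 2 ^ j) =>
      le_trans hp (by gcongr; norm_num)
    have h0 : Tendsto (fun n : ℕ => (1 : ℝ) / 2 ^ n) atTop (𝓝 0) := by
      simpa using
        tendsto_pow_atTop_nhds_zero_of_lt_one (r := (1 / 2 : ℝ)) (by norm_num) (by norm_num)
    have hI : ⋂ n, s n = {p | ℓ p = x} := by
      ext p
      simp only [s, mem_iInter, mem_ofPred_eq]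
      constructor
      · intro h
        have := ge_of_tendsto' h0 h
        linarith [abs_eq_zero.1 (le_antisymm this (abs_nonneg _))]
      · intro h n
        rw [h]; simp
    have hlim := tendsto_measure_iInter_atTop (μ := Λ) (fun n => (hs n).nullMeasurableSet) hanti
      ⟨0, measure_ne_top_of_subset (fun p (hp : |ℓ p - x| ≤ 1 / 2 ^ 0) => by
        have := (abs_le.1 hp).2
        show ℓ p ≤ x + 1
        norm_num at this; linarith) (hfin (x + 1))⟩
    rw [hI, hatom] at hlim
    refine tendsto_of_tendsto_of_tendsto_of_le_of_le tendsto_const_nhds hlim (fun _ => zero_le)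
      fun n => measure_mono fun p hp => ?_
    obtain ⟨b1, b2, b3⟩ := dyadicIndex_bounds hx n
    have := dyadic_succ n (dyadicIndex n x)
    show |ℓ p - x| ≤ 1 / 2 ^ n
    rw [abs_le]
    exact ⟨by linarith [hp.1], by linarith [hp.2]⟩
  -- If every grid has a cell below `N` with two points, the union bound on each grid bounds the
  -- probability by Σ Λ(cell)² = ∫ Λ(cell of p) Λ(dp) over levels below `N`, which tends to 0 by
  -- dominated convergence.
  have hN : ∀ N : ℕ, ∀ᵐ ω ∂P, ∃ n, ∀ k < N * 2 ^ n, η ω (cell ℓ n k) < 2 := fun N => by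
    let a : ℕ → ℕ → ℝ≥0∞ := fun n k => if k < N * 2 ^ n then Λ (cell ℓ n k) else 0
    have ha : ∀ n p, a n (dyadicIndex n (ℓ p)) =
        {p | ℓ p < N}.indicator (fun p => Λ (cell ℓ n (dyadicIndex n (ℓ p)))) p := fun n p => by
      have hiff : dyadicIndex n (ℓ p) < N * 2 ^ n ↔ ℓ p < N := by
        rw [← lt_dyadic (hℓ0 p), dyadic]
        push_cast
        rw [mul_div_cancel_right₀ _ (by positivity)]
      by_cases h : ℓ p < N
      · rw [indicator_of_mem (by exact h)]
        exact if_pos (hiff.2 h)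
      · rw [indicator_of_notMem (by exact h)]
        exact if_neg fun h' => h (hiff.1 h')
    have hbound : ∀ n, P {ω | ¬ ∃ n, ∀ k < N * 2 ^ n, η ω (cell ℓ n k) < 2} ≤
        ∫⁻ p, a n (dyadicIndex n (ℓ p)) * 1 ∂Λ := fun n => by
      rw [← tsum_mul_setLIntegral_cell hℓ hℓ0 Λ n (a n) measurable_const]
      calc P {ω | ¬ ∃ n, ∀ k < N * 2 ^ n, η ω (cell ℓ n k) < 2}
          ≤ P (⋃ k, {ω | k < N * 2 ^ n ∧ 2 ≤ η ω (cell ℓ n k)}) := by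
            refine measure_mono fun ω hω => ?_
            simp only [mem_ofPred_eq, not_exists, not_forall, not_lt] at hω
            obtain ⟨k, hk, h2⟩ := hω n
            exact mem_iUnion.2 ⟨k, hk, h2⟩
        _ ≤ ∑' k, P {ω | k < N * 2 ^ n ∧ 2 ≤ η ω (cell ℓ n k)} := measure_iUnion_le _
        _ ≤ _ := by
            refine ENNReal.tsum_le_tsum fun k => ?_
            by_cases hk : k < N * 2 ^ n
            · simp only [hk, true_and, a, if_true, setLIntegral_one]
              exact hη.measure_two_le_count (measurableSet_cell hℓ n k) (hcfin n k)
            · simp [hk]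
    have hlim : Tendsto (fun n => ∫⁻ p, a n (dyadicIndex n (ℓ p)) * 1 ∂Λ) atTop
        (𝓝 (∫⁻ p, (fun _ => 0) p ∂Λ)) := by
      have hfl : ∀ n : ℕ, Measurable fun p => dyadicIndex n (ℓ p) := fun n =>
        Nat.measurable_floor.comp (hℓ.mul_const _)
      -- Since `N` is a grid point of every grid, the cell of a point below `N` stays below `N`. Its
      -- intensity is thus at most that of {ℓ ≤ N}, a constant on a set of finite intensity.
      refine tendsto_lintegral_of_dominated_convergence
        ({p | ℓ p < N}.indicator fun _ => Λ {p | ℓ p ≤ N})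
        (fun n => ((measurable_from_nat (f := a n)).comp (hfl n)).mul_const _)
        (fun n => .of_forall fun p => ?_) ?_ (.of_forall fun p => ?_)
      · simp only [mul_one, ha]
        by_cases hq : ℓ p < N
        swap
        · rw [indicator_of_notMem (by exact hq)]; exact zero_le
        rw [indicator_of_mem (by exact hq), indicator_of_mem (by exact hq)]
        refine measure_mono fun p' hp' => ?_
        have h1 : dyadicIndex n (ℓ p') = dyadicIndex n (ℓ p) := (mem_cell hℓ0).1 hp'
        have h2 : dyadicIndex n (ℓ p) < N * 2 ^ n := by
          rw [← lt_dyadic (hℓ0 p), dyadic]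
          push_cast
          rw [mul_div_cancel_right₀ _ (by positivity)]
          exact hq
        rw [← h1, ← lt_dyadic (hℓ0 p'), dyadic] at h2
        push_cast at h2
        rw [mul_div_cancel_right₀ _ (by positivity)] at h2
        exact h2.le
      · rw [lintegral_indicator (measurableSet_lt hℓ measurable_const), setLIntegral_const]
        exact ENNReal.mul_ne_top (hfin N)
          (measure_ne_top_of_subset (fun p (hp : ℓ p < N) => hp.le) (hfin N))
      · simp only [mul_one, ha]
        by_cases h : ℓ p < N
        · simp only [indicator_of_mem (show p ∈ {p | ℓ p < N} from h)]
          exact hcell _ (hℓ0 p)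
        · simp only [indicator_of_notMem (show p ∉ {p | ℓ p < N} from h)]
          exact tendsto_const_nhds
    rw [lintegral_zero] at hlim
    exact le_antisymm (ge_of_tendsto' hlim hbound) zero_le
  filter_upwards [ae_all_iff.2 hN] with ω hω x hx
  obtain ⟨N, hxN⟩ := exists_nat_gt x
  obtain ⟨n, hn⟩ := hω N
  refine lt_of_le_of_lt (measure_mono fun p (hp : ℓ p = x) => ?_) (hn (dyadicIndex n x) ?_)
  · rw [mem_cell hℓ0, hp]
  · rw [← lt_dyadic hx, dyadic]
    push_cast
    rwa [mul_div_cancel_right₀ _ (by positivity)]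

/-- Almost surely, exactly one point has the lowest level. -/
lemma ae_hasLowestPoint (hη : IsPoissonPointProcess P Λ η) (hℓ : Measurable ℓ)
    (hℓ0 : ∀ p, 0 ≤ ℓ p) (hfin : ∀ x, Λ {p | ℓ p ≤ x} ≠ ∞) (hatom : ∀ x, Λ {p | ℓ p = x} = 0)
    (hinf : Λ univ = ∞) : ∀ᵐ ω ∂P, HasLowestPoint ℓ (η ω) := by
  filter_upwards [hη.ae_count_level_lt_two hℓ hℓ0 hfin hatom,
    hη.ae_exists_count_ne_zero hℓ hfin hinf, hη.ae_count_le_ne_top hℓ hfin,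
    hη.ae_isConfiguration, hη.ae_count_eq_zero
      (hℓ (measurableSet_singleton 0)) (hatom 0)] with ω htwo hne hfinω hconf hzero
  set μ := η ω
  have hm : ∀ x, MeasurableSet {p | ℓ p ≤ x} := fun x => measurableSet_le hℓ measurable_const
  set T := {x : ℝ | 0 < μ {p | ℓ p ≤ x}} with hT
  have hTne : T.Nonempty := by
    obtain ⟨x, hx⟩ := hne
    exact ⟨x, pos_iff_ne_zero.2 hx⟩
  have hTlb : ∀ x ∈ T, 0 ≤ x := fun x hx => by
    by_contra h
    refine (ne_of_gt (show 0 < μ {p | ℓ p ≤ x} from hx)) ?_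
    rw [show {p | ℓ p ≤ x} = ∅ from eq_empty_of_forall_notMem fun p (hp : ℓ p ≤ x) => by
      linarith [hℓ0 p]]
    simp
  have hTbdd : BddBelow T := ⟨0, hTlb⟩
  have hLdef : lowestLevel ℓ μ = sInf T := rfl
  set L := lowestLevel ℓ μ with hL
  have hL0 : 0 ≤ L := le_csInf hTne hTlb
  have hlt : μ {p | ℓ p < L} = 0 := by
    have hU : {p | ℓ p < L} = ⋃ n : ℕ, {p | ℓ p ≤ L - 1 / (n + 1)} := by
      ext p
      simp only [mem_ofPred_eq, mem_iUnion]
      constructor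
      · intro h
        obtain ⟨n, hn⟩ := exists_nat_one_div_lt (sub_pos.2 h)
        exact ⟨n, by linarith⟩
      · rintro ⟨n, hn⟩
        have : (0 : ℝ) < 1 / (n + 1) := by positivity
        linarith
    rw [hU, measure_iUnion_null_iff]
    intro n
    by_contra h
    have h1 : L ≤ L - 1 / (n + 1) := csInf_le hTbdd (pos_iff_ne_zero.2 h)
    have : (0 : ℝ) < 1 / (n + 1) := by positivity
    linarith
  -- Positive mass means mass at least 1, a bound that survives the decreasing limit of sublevel
  -- sets to the level `L`. Finiteness of their masses provides continuity from above.
  have hge : ∀ x, L < x → 1 ≤ μ {p | ℓ p ≤ x} := fun x hx => by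
    obtain ⟨y, hy, hyx⟩ := exists_lt_of_csInf_lt hTne (hLdef ▸ hx)
    refine (hconf.one_le (hm y) (ne_of_gt hy)).trans (measure_mono fun p (hp : ℓ p ≤ y) => ?_)
    exact hp.trans hyx.le
  have hle1 : 1 ≤ μ {p | ℓ p ≤ L} := by
    have hI : ⋂ n : ℕ, {p | ℓ p ≤ L + 1 / (n + 1)} = {p | ℓ p ≤ L} := by
      ext p
      simp only [mem_ofPred_eq, mem_iInter]
      constructor
      · intro h
        have := tendsto_one_div_add_atTop_nhds_zero_nat (𝕜 := ℝ)
        exact ge_of_tendsto' (by simpa using this.const_add L) h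
      · intro h n
        have : (0 : ℝ) < 1 / (n + 1) := by positivity
        linarith
    have hlim := tendsto_measure_iInter_atTop (μ := μ)
      (s := fun n : ℕ => {p | ℓ p ≤ L + 1 / (n + 1)}) (fun n => (hm _).nullMeasurableSet)
      (fun i j hij p (hp : ℓ p ≤ L + 1 / (j + 1)) => hp.trans (by gcongr)) ⟨0, hfinω _⟩
    rw [hI] at hlim
    refine ge_of_tendsto' hlim fun n => hge _ ?_
    have : (0 : ℝ) < 1 / (n + 1) := by positivity
    linarith
  have heq : 1 ≤ μ {p | ℓ p = L} := by
    refine hle1.trans ?_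
    have hsub : {p | ℓ p ≤ L} ⊆ {p | ℓ p < L} ∪ {p | ℓ p = L} := fun p (hp : ℓ p ≤ L) =>
      hp.lt_or_eq
    refine (measure_mono hsub).trans ((measure_union_le _ _).trans ?_)
    rw [hlt, zero_add]
  have hone := (hconf.exists_lintegral_eq (hℓ (measurableSet_singleton L))
    (ne_of_gt (lt_of_lt_of_le zero_lt_one heq)) (htwo L hL0)).1
  refine ⟨lt_of_le_of_ne hL0 fun h => ?_, hone, hlt, ?_⟩
  · rw [hL, ← h] at heq
    have : μ {p | ℓ p = 0} = 0 := hzero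
    rw [this] at heq
    simp at heq
  -- These bands decrease to the empty set with finite mass, so their masses tend to 0. Masses below
  -- 1 vanish, which yields a genuine gap.
  · let s : ℕ → Set E := fun n => {p | L < ℓ p ∧ ℓ p < L + 1 / (n + 1)}
    have hs : ∀ n, MeasurableSet (s n) := fun n =>
      (measurableSet_lt measurable_const hℓ).inter (measurableSet_lt hℓ measurable_const)
    have hI : ⋂ n, s n = ∅ := by
      refine eq_empty_of_forall_notMem fun p hp => ?_
      simp only [s, mem_iInter, mem_ofPred_eq] at hp
      obtain ⟨n, hn⟩ := exists_nat_one_div_lt (sub_pos.2 (hp 0).1)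
      linarith [(hp n).2]
    have hlim := tendsto_measure_iInter_atTop (μ := μ) (s := s)
      (fun n => (hs n).nullMeasurableSet)
      (fun i j hij p hp => ⟨hp.1, hp.2.trans_le (by gcongr)⟩)
      ⟨0, measure_ne_top_of_subset (fun p hp => hp.2.le) (hfinω _)⟩
    rw [hI, measure_empty] at hlim
    obtain ⟨n, hn⟩ := (hlim.eventually (gt_mem_nhds zero_lt_one)).exists
    refine ⟨1 / (n + 1), by positivity, ?_⟩
    by_contra h
    exact absurd (hconf.one_le (hs n) h) (not_le.2 hn)

end IsPoissonPointProcess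

/-! ### The law of the lowest point -/

section Lowest

variable {E : Type*} [MeasurableSpace E] {ℓ : E → ℝ} {μ : Measure E}

lemma HasLowestPoint.tendsto_tsum_cellSel (hμ : HasLowestPoint ℓ μ) (φ : ℕ → ℕ → ℝ≥0∞)
    {a : ℝ≥0∞} (h : Tendsto (fun n => φ n (dyadicIndex n (lowestLevel ℓ μ))) atTop (𝓝 a)) :
    Tendsto (fun n => ∑' k, cellSel ℓ n k μ * φ n k) atTop (𝓝 a) := by
  refine h.congr' ?_
  filter_upwards [hμ.eventually] with n hn
  rw [tsum_cellSel_mul hn.1 hn.2.1]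

lemma HasLowestPoint.tendsto_cell (hμ : HasLowestPoint ℓ μ) (f : E → ℝ≥0∞) :
    Tendsto (fun n => ∫⁻ p in cell ℓ n (dyadicIndex n (lowestLevel ℓ μ)), f p ∂μ) atTop
      (𝓝 (∫⁻ p in {p | ℓ p = lowestLevel ℓ μ}, f p ∂μ)) := by
  refine tendsto_const_nhds.congr' ?_
  filter_upwards [hμ.eventually] with n hn
  rw [hn.2.2.1]

lemma HasLowestPoint.tendsto_above (hμ : HasLowestPoint ℓ μ) (f : E → ℝ≥0∞) :
    Tendsto (fun n => ∫⁻ p in {p | dyadic n (dyadicIndex n (lowestLevel ℓ μ) + 1) ≤ ℓ p}, f p ∂μ)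
      atTop (𝓝 (∫⁻ p in {p | lowestLevel ℓ μ < ℓ p}, f p ∂μ)) := by
  refine tendsto_const_nhds.congr' ?_
  filter_upwards [hμ.eventually] with n hn
  rw [hn.2.2.2]

variable (ℓ) in
/-- An integrand whose Laplace functional describes the configurations without points below the
level `b`, with the weight `exp (-∫ g)` for the points above. -/
def voidBelow (g : E → ℝ≥0∞) (b : ℝ) (p : E) : ℝ≥0∞ := if ℓ p < b then ∞ else g p

lemma measurable_voidBelow (hℓ : Measurable ℓ) {g : E → ℝ≥0∞} (hg : Measurable g) (b : ℝ) :
    Measurable (voidBelow ℓ g b) :=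
  Measurable.ite (measurableSet_lt hℓ measurable_const) measurable_const hg

end Lowest

namespace IsPoissonPointProcess

variable {Ω E : Type*} [MeasurableSpace Ω] [MeasurableSpace E]
  {P : Measure Ω} {Λ : Measure E} {η : Ω → Measure E} {ℓ : E → ℝ}

lemma measurable_setLIntegral (hη : IsPoissonPointProcess P Λ η) {f : E → ℝ≥0∞}
    (hf : Measurable f) {s : Set E} (hs : MeasurableSet s) :
    Measurable fun ω => ∫⁻ x in s, f x ∂η ω := by
  simp_rw [← lintegral_indicator hs]
  exact hη.measurable_lintegral (hf.indicator hs)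

lemma measurable_cellSel (hη : IsPoissonPointProcess P Λ η) (hℓ : Measurable ℓ) (n k : ℕ) :
    Measurable fun ω => cellSel ℓ n k (η ω) :=
  (measurable_expNeg.comp
    ((hη.measurable_count (measurableSet_lt hℓ measurable_const)).const_mul _)).mul
    ((measurable_one.indicator (measurableSet_singleton _)).comp
      (hη.measurable_count (measurableSet_cell hℓ n k)))

/-- The lowest level is an infimum over a set that depends on the configuration, so measurability of
its functionals is not evident. They are almost sure limits of sums over deterministic cells, and
each term of these sums is measurable. -/
lemma aemeasurable_of_tendsto_cellSel (hη : IsPoissonPointProcess P Λ η) (hℓ : Measurable ℓ)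
    (hlow : ∀ᵐ ω ∂P, HasLowestPoint ℓ (η ω)) {φ : ℕ → ℕ → Ω → ℝ≥0∞}
    (hφ : ∀ n k, Measurable (φ n k)) {Φ : Ω → ℝ≥0∞}
    (h : ∀ᵐ ω ∂P, Tendsto (fun n => φ n (dyadicIndex n (lowestLevel ℓ (η ω))) ω) atTop
      (𝓝 (Φ ω))) : AEMeasurable Φ P := by
  refine aemeasurable_of_tendsto_metrizable_ae atTop
    (f := fun n ω => ∑' k, cellSel ℓ n k (η ω) * φ n k ω)
    (fun n => (Measurable.tsum fun k =>
      (hη.measurable_cellSel hℓ n k).mul (hφ n k)).aemeasurable) ?_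
  filter_upwards [hlow, h] with ω h1 h2
  exact h1.tendsto_tsum_cellSel (fun n k => φ n k ω) h2

lemma aemeasurable_lowestLevel (hη : IsPoissonPointProcess P Λ η) (hℓ : Measurable ℓ)
    (hlow : ∀ᵐ ω ∂P, HasLowestPoint ℓ (η ω)) :
    AEMeasurable (fun ω => lowestLevel ℓ (η ω)) P := by
  have h : AEMeasurable (fun ω => ENNReal.ofReal (lowestLevel ℓ (η ω))) P := by
    refine hη.aemeasurable_of_tendsto_cellSel hℓ hlow
      (φ := fun n k _ => ENNReal.ofReal (dyadic n (k + 1))) (fun _ _ => measurable_const) ?_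
    filter_upwards [hlow] with ω hω
    exact (ENNReal.continuous_ofReal.tendsto _).comp (tendsto_dyadic_dyadicIndex_succ hω.pos.le)
  refine h.ennreal_toReal.congr ?_
  filter_upwards [hlow] with ω hω
  exact ENNReal.toReal_ofReal hω.pos.le

lemma aemeasurable_lintegral_lowest (hη : IsPoissonPointProcess P Λ η) (hℓ : Measurable ℓ)
    (hlow : ∀ᵐ ω ∂P, HasLowestPoint ℓ (η ω)) {f : E → ℝ≥0∞} (hf : Measurable f) :
    AEMeasurable (fun ω => ∫⁻ p in {p | ℓ p = lowestLevel ℓ (η ω)}, f p ∂η ω) P := by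
  refine hη.aemeasurable_of_tendsto_cellSel hℓ hlow
    (fun n k => hη.measurable_setLIntegral hf (measurableSet_cell hℓ n k)) ?_
  filter_upwards [hlow] with ω hω using hω.tendsto_cell f

lemma aemeasurable_lintegral_above_lowest (hη : IsPoissonPointProcess P Λ η) (hℓ : Measurable ℓ)
    (hlow : ∀ᵐ ω ∂P, HasLowestPoint ℓ (η ω)) {f : E → ℝ≥0∞} (hf : Measurable f) :
    AEMeasurable (fun ω => ∫⁻ p in {p | lowestLevel ℓ (η ω) < ℓ p}, f p ∂η ω) P := by
  refine hη.aemeasurable_of_tendsto_cellSel hℓ hlow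
    (φ := fun n k ω => ∫⁻ p in {p | dyadic n (k + 1) ≤ ℓ p}, f p ∂η ω)
    (fun n k => hη.measurable_setLIntegral hf (measurableSet_le measurable_const hℓ)) ?_
  filter_upwards [hlow] with ω hω using hω.tendsto_above f

lemma tsum_cellSel_lintegral_le {f : E → ℝ≥0∞} (hf1 : ∀ p, f p ≤ 1) (g : ℕ → ℝ≥0∞) (n : ℕ)
    (μ : Measure E) :
    ∑' k, cellSel ℓ n k μ * ((∫⁻ p in cell ℓ n k, f p ∂μ) * expNeg (g k)) ≤ 1 := by
  refine tsum_cellSel_mul_le _ fun k hk => mul_le_one' ?_ (expNeg_le_one _)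
  calc ∫⁻ p in cell ℓ n k, f p ∂μ ≤ ∫⁻ _ in cell ℓ n k, 1 ∂μ := lintegral_mono fun p => hf1 p
    _ = 1 := by rw [setLIntegral_one, hk]

lemma measure_lt_le_lintegral_voidBelow (hℓ : Measurable ℓ) (g : E → ℝ≥0∞) (b : ℝ) :
    Λ {p | ℓ p < b} ≤ ∫⁻ q, (1 - expNeg (voidBelow ℓ g b q)) ∂Λ := by
  rw [← lintegral_indicator_one (measurableSet_lt hℓ measurable_const)]
  refine lintegral_mono fun q => ?_
  by_cases hq : ℓ q < b
  · rw [indicator_of_mem (by exact hq), voidBelow, if_pos hq]; simp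
  · rw [indicator_of_notMem (by exact hq)]; exact zero_le

variable [IsProbabilityMeasure P] [SigmaFinite Λ]

/-- A local form of the Campbell–Mecke formula. When `f` is the indicator of `A`, a single point in
`C` that lies in `A` means one point in `A ∩ C` and none in `C \ A`, and the joint Laplace
functional applies. Linearity and monotone limits extend this to measurable `f`. -/
lemma lintegral_count_one_mul_lintegral_mul_expNeg (hη : IsPoissonPointProcess P Λ η)
    {C : Set E} (hC : MeasurableSet C) (hfin : Λ C ≠ ∞) {h : E → ℝ≥0∞} (hh : Measurable h)
    (hhC : ∀ x ∈ C, h x = 0) {f : E → ℝ≥0∞} (hf : Measurable f) :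
    ∫⁻ ω, ({1} : Set ℝ≥0∞).indicator 1 (η ω C) * (∫⁻ x in C, f x ∂η ω) *
        expNeg (∫⁻ x, h x ∂η ω) ∂P =
      (∫⁻ x in C, f x ∂Λ) * (expNeg (Λ C) * expNeg (∫⁻ x, (1 - expNeg (h x)) ∂Λ)) := by
  have hφ : Measurable (({1} : Set ℝ≥0∞).indicator (1 : ℝ≥0∞ → ℝ≥0∞)) :=
    measurable_one.indicator (measurableSet_singleton _)
  have hφC : Measurable fun ω => ({1} : Set ℝ≥0∞).indicator (1 : ℝ≥0∞ → ℝ≥0∞) (η ω C) :=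
    hφ.comp (hη.measurable_count hC)
  have hE : Measurable fun ω => expNeg (∫⁻ x, h x ∂η ω) :=
    measurable_expNeg.comp (hη.measurable_lintegral hh)
  have hset : ∀ A : Set E, MeasurableSet A →
      ∫⁻ ω, ({1} : Set ℝ≥0∞).indicator 1 (η ω C) * η ω (A ∩ C) * expNeg (∫⁻ x, h x ∂η ω) ∂P =
        Λ (A ∩ C) * (expNeg (Λ C) * expNeg (∫⁻ x, (1 - expNeg (h x)) ∂Λ)) := by
    intro A hA
    have hAC := hA.inter hC
    have hACfin : Λ (A ∩ C) ≠ ∞ := measure_ne_top_of_subset inter_subset_right hfin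
    have hD : MeasurableSet (C \ A) := hC.diff hA
    -- The infinite weight expresses that `C \ A` contains no point.
    let k : E → ℝ≥0∞ := fun x => (C \ A).indicator (fun _ => ∞) x + h x
    have hk : Measurable k := (measurable_const.indicator hD).add hh
    have hkA : ∀ x ∈ A ∩ C, k x = 0 := fun x hx => by
      simp only [k]
      rw [indicator_of_notMem (fun h' => h'.2 hx.1), hhC x hx.2, add_zero]
    have h1 := hη.lintegral_comp_count_mul_expNeg hAC hφ
      (fun x => by by_cases hx : x ∈ ({1} : Set ℝ≥0∞) <;> simp [hx]) hk hkA
    rw [hη.lintegral_count_eq_one hAC hACfin] at h1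
    have h2 : ∫⁻ x, (1 - expNeg (k x)) ∂Λ = Λ (C \ A) + ∫⁻ x, (1 - expNeg (h x)) ∂Λ := by
      rw [← lintegral_indicator_one hD, ← lintegral_add_left (measurable_one.indicator hD)]
      refine lintegral_congr fun x => ?_
      by_cases hx : x ∈ C \ A
      · simp only [k, indicator_of_mem hx, hhC x hx.1]; simp
      · simp only [k, indicator_of_notMem hx]; simp
    have h3 : ∀ᵐ ω ∂P, ({1} : Set ℝ≥0∞).indicator 1 (η ω (A ∩ C)) * expNeg (∫⁻ x, k x ∂η ω) =
        ({1} : Set ℝ≥0∞).indicator 1 (η ω C) * η ω (A ∩ C) * expNeg (∫⁻ x, h x ∂η ω) := by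
      filter_upwards [hη.ae_isConfiguration] with ω hω
      have hadd : η ω (A ∩ C) + η ω (C \ A) = η ω C := by
        rw [inter_comm, measure_inter_add_sdiff C hA]
      have hint : ∫⁻ x, k x ∂η ω = ∞ * η ω (C \ A) + ∫⁻ x, h x ∂η ω := by
        rw [lintegral_add_left (measurable_const.indicator hD), lintegral_indicator_const hD]
      rw [hint, expNeg_add]
      by_cases hd : η ω (C \ A) = 0
      · rw [hd, add_zero] at hadd
        rw [hd, ← hadd]
        by_cases h1 : η ω (A ∩ C) = 1
        · simp [h1]
        · simp [h1]
      -- A point in `C \ A` annihilates the left side. On the right, if it is the only point of `C`,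
      -- then `A ∩ C` is empty of points.
      · have hd1 := hω.one_le hD hd
        rw [ENNReal.top_mul hd, expNeg_top, zero_mul, mul_zero]
        by_cases hc : η ω C = 1
        · have : η ω (A ∩ C) = 0 := by
            have h' : η ω (A ∩ C) + 1 ≤ 0 + 1 := by
              rw [zero_add]
              exact (add_le_add le_rfl hd1).trans (hadd.trans hc).le
            exact le_antisymm ((ENNReal.add_le_add_iff_right ENNReal.one_ne_top).1 h') zero_le
          simp [this]
        · simp [hc]
    rw [← lintegral_congr_ae h3, h1, h2, expNeg_add, mul_assoc, ← mul_assoc (expNeg _) (expNeg _),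
      ← expNeg_add]
    congr 3
    rw [inter_comm, measure_inter_add_sdiff C hA]
  have hmul : ∀ k : Ω → ℝ≥0∞, Measurable k → Measurable fun ω =>
      ({1} : Set ℝ≥0∞).indicator (1 : ℝ≥0∞ → ℝ≥0∞) (η ω C) * k ω * expNeg (∫⁻ x, h x ∂η ω) :=
    fun k hk => (hφC.mul hk).mul hE
  refine Measurable.ennreal_induction (motive := fun f =>
    ∫⁻ ω, ({1} : Set ℝ≥0∞).indicator 1 (η ω C) * (∫⁻ x in C, f x ∂η ω) *
        expNeg (∫⁻ x, h x ∂η ω) ∂P =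
      (∫⁻ x in C, f x ∂Λ) * (expNeg (Λ C) * expNeg (∫⁻ x, (1 - expNeg (h x)) ∂Λ))) ?_ ?_ ?_ hf
  · intro c A hA
    have h1 : ∀ μ : Measure E, ∫⁻ x in C, A.indicator (fun _ => c) x ∂μ = c * μ (A ∩ C) := fun μ => by
      rw [lintegral_indicator_const hA, Measure.restrict_apply hA]
    simp_rw [h1]
    rw [mul_assoc, ← hset A hA, ← lintegral_const_mul _
      (hmul _ (hη.measurable_count (hA.inter hC)))]
    refine lintegral_congr fun ω => ?_
    ring
  · intro f g _ hf hg ihf ihg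
    have h1 : ∀ μ : Measure E, ∫⁻ x in C, (f + g) x ∂μ = ∫⁻ x in C, f x ∂μ + ∫⁻ x in C, g x ∂μ :=
      fun μ => lintegral_add_left hf _
    simp_rw [h1, mul_add, add_mul]
    rw [lintegral_add_left (hmul _ (hη.measurable_setLIntegral hf hC)), ihf, ihg]
  · intro f hf hmono ih
    have h1 : ∀ μ : Measure E, ∫⁻ x in C, (⨆ n, f n x) ∂μ = ⨆ n, ∫⁻ x in C, f n x ∂μ := fun μ =>
      lintegral_iSup hf hmono
    simp_rw [h1, ENNReal.mul_iSup, ENNReal.iSup_mul]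
    rw [lintegral_iSup (fun n => hmul _ (hη.measurable_setLIntegral (hf n) hC))]
    · simp_rw [ih]
    · intro i j hij ω
      dsimp only
      gcongr
      exact hmono hij _

/-- The regions below, in and above a cell are disjoint, so each term factorizes. The resulting
exponents merge into one, that of a void up to the upper end of the cell and the weight `g` beyond
it. -/
lemma lintegral_tsum_cellSel (hη : IsPoissonPointProcess P Λ η) (hℓ : Measurable ℓ)
    (hℓ0 : ∀ p, 0 ≤ ℓ p) (hfin : ∀ x, Λ {p | ℓ p ≤ x} ≠ ∞)
    {f : E → ℝ≥0∞} (hf : Measurable f) {g : ℝ → E → ℝ≥0∞} (hg : ∀ b, Measurable (g b)) (n : ℕ) :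
    ∫⁻ ω, ∑' k, cellSel ℓ n k (η ω) * ((∫⁻ p in cell ℓ n k, f p ∂η ω) *
        expNeg (∫⁻ p in {p | dyadic n (k + 1) ≤ ℓ p}, g (dyadic n (k + 1)) p ∂η ω)) ∂P =
      ∫⁻ p, expNeg (∫⁻ q, (1 - expNeg (voidBelow ℓ (g (dyadic n (dyadicIndex n (ℓ p) + 1)))
        (dyadic n (dyadicIndex n (ℓ p) + 1)) q)) ∂Λ) * f p ∂Λ := by
  rw [← tsum_mul_setLIntegral_cell hℓ hℓ0 Λ n (fun k => expNeg (∫⁻ q, (1 - expNeg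
    (voidBelow ℓ (g (dyadic n (k + 1))) (dyadic n (k + 1)) q)) ∂Λ)) hf, lintegral_tsum]
  · refine tsum_congr fun k => ?_
    have hlo : MeasurableSet {p | ℓ p < dyadic n k} := measurableSet_lt hℓ measurable_const
    have hhi : MeasurableSet {p | dyadic n (k + 1) ≤ ℓ p} := measurableSet_le measurable_const hℓ
    have hcfin : Λ (cell ℓ n k) ≠ ∞ :=
      measure_ne_top_of_subset (fun p hp => hp.2.le) (hfin (dyadic n (k + 1)))
    have hle : dyadic n k ≤ dyadic n (k + 1) := dyadic_mono n (Nat.le_succ k)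
    let h : E → ℝ≥0∞ := fun p => {p | ℓ p < dyadic n k}.indicator (fun _ => ∞) p +
      {p | dyadic n (k + 1) ≤ ℓ p}.indicator (g (dyadic n (k + 1))) p
    have hh : Measurable h := (measurable_const.indicator hlo).add ((hg _).indicator hhi)
    have hhC : ∀ p ∈ cell ℓ n k, h p = 0 := fun p hp => by
      simp only [h]
      have h1 : p ∉ {p | ℓ p < dyadic n k} := not_lt.2 hp.1
      have h2 : p ∉ {p | dyadic n (k + 1) ≤ ℓ p} := not_le.2 hp.2
      rw [indicator_of_notMem h1, indicator_of_notMem h2, add_zero]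
    have key := hη.lintegral_count_one_mul_lintegral_mul_expNeg (measurableSet_cell hℓ n k) hcfin
      hh hhC hf
    have e1 : ∀ ω, expNeg (∫⁻ x, h x ∂η ω) = expNeg (∞ * η ω {p | ℓ p < dyadic n k}) *
        expNeg (∫⁻ p in {p | dyadic n (k + 1) ≤ ℓ p}, g (dyadic n (k + 1)) p ∂η ω) := fun ω => by
      rw [← expNeg_add, lintegral_add_left (measurable_const.indicator hlo),
        lintegral_indicator_const hlo, lintegral_indicator hhi]
    -- The factor exp(-Λ(cell)) of the one-point formula extends the void from the lower to the
    -- upper end of the cell.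
    have e2 : Λ (cell ℓ n k) + ∫⁻ x, (1 - expNeg (h x)) ∂Λ = ∫⁻ q, (1 - expNeg
        (voidBelow ℓ (g (dyadic n (k + 1))) (dyadic n (k + 1)) q)) ∂Λ := by
      rw [← lintegral_indicator_one (measurableSet_cell hℓ n k),
        ← lintegral_add_left (measurable_one.indicator (measurableSet_cell hℓ n k))]
      refine lintegral_congr fun q => ?_
      by_cases hq : q ∈ cell ℓ n k
      · rw [indicator_of_mem hq, hhC q hq, voidBelow, if_pos hq.2]
        simp
      · rw [indicator_of_notMem hq, zero_add]
        congr 2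
        by_cases hq1 : ℓ q < dyadic n k
        · simp only [h, voidBelow]
          rw [indicator_of_mem (by exact hq1), if_pos (hq1.trans_le hle), top_add]
        · have hq2 : ¬ ℓ q < dyadic n (k + 1) := fun h' => hq ⟨not_lt.1 hq1, h'⟩
          simp only [h, voidBelow]
          rw [indicator_of_notMem (by exact hq1), if_neg hq2,
            indicator_of_mem (by exact not_lt.1 hq2), zero_add]
    rw [← e2, expNeg_add, mul_comm, ← key]
    refine lintegral_congr fun ω => ?_
    rw [e1, cellSel]
    ring
  · intro k
    refine ((hη.measurable_cellSel hℓ n k).mul ?_).aemeasurable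
    exact (hη.measurable_setLIntegral hf (measurableSet_cell hℓ n k)).mul
      (measurable_expNeg.comp
        (hη.measurable_setLIntegral (hg _) (measurableSet_le measurable_const hℓ)))

/-- The integrand should be the density of the lowest point, hence of mass at most 1. On each grid
the cell identity with `f = 1` and no weight gives the bound, and Fatou's lemma passes to the limit.
This density dominates all approximations in `lintegral_lowest`. -/
lemma lintegral_expNeg_measure_le_le (hη : IsPoissonPointProcess P Λ η) (hℓ : Measurable ℓ)
    (hℓ0 : ∀ p, 0 ≤ ℓ p) (hfin : ∀ x, Λ {p | ℓ p ≤ x} ≠ ∞) :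
    ∫⁻ p, expNeg (Λ {q | ℓ q ≤ ℓ p}) ∂Λ ≤ 1 := by
  have hm : ∀ n : ℕ, Measurable fun p : E =>
      expNeg (Λ {q | ℓ q < dyadic n (dyadicIndex n (ℓ p) + 1)}) := fun n =>
    (measurable_from_nat (f := fun k => expNeg (Λ {q | ℓ q < dyadic n (k + 1)}))).comp
      (Nat.measurable_floor.comp (hℓ.mul_const _))
  have hbound : ∀ n : ℕ,
      ∫⁻ p, expNeg (Λ {q | ℓ q < dyadic n (dyadicIndex n (ℓ p) + 1)}) ∂Λ ≤ 1 := fun n => by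
    have h := hη.lintegral_tsum_cellSel hℓ hℓ0 hfin (f := fun _ => 1) measurable_const
      (g := fun _ _ => 0) (fun _ => measurable_const) n
    have h2 : ∫⁻ ω, ∑' k, cellSel ℓ n k (η ω) * ((∫⁻ p in cell ℓ n k, 1 ∂η ω) *
        expNeg (∫⁻ p in {p | dyadic n (k + 1) ≤ ℓ p}, 0 ∂η ω)) ∂P ≤ 1 :=
      (lintegral_mono fun ω => tsum_cellSel_lintegral_le (fun _ => le_rfl) _ n (η ω)).trans
        (by simp)
    rw [h] at h2
    refine le_trans (lintegral_mono fun p => ?_) h2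
    rw [mul_one]
    have : ∀ b : ℝ, ∫⁻ q, (1 - expNeg (voidBelow ℓ (fun _ => 0) b q)) ∂Λ = Λ {q | ℓ q < b} := by
      intro b
      rw [← lintegral_indicator_one (measurableSet_lt hℓ measurable_const)]
      refine lintegral_congr fun q => ?_
      by_cases hq : ℓ q < b
      · rw [indicator_of_mem (by exact hq), voidBelow, if_pos hq]; simp
      · rw [indicator_of_notMem (by exact hq), voidBelow, if_neg hq]; simp
    rw [this]
  have hlim : ∀ p : E, Tendsto (fun n =>
      expNeg (Λ {q | ℓ q < dyadic n (dyadicIndex n (ℓ p) + 1)})) atTop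
      (𝓝 (expNeg (Λ {q | ℓ q ≤ ℓ p}))) := fun p => by
    refine (continuous_expNeg.tendsto _).comp ?_
    have hI : ⋂ n : ℕ, {q | ℓ q ≤ ℓ p + 1 / 2 ^ n} = {q | ℓ q ≤ ℓ p} := by
      ext q
      simp only [mem_ofPred_eq, mem_iInter]
      constructor
      · intro h
        have h0 : Tendsto (fun n : ℕ => (1 : ℝ) / 2 ^ n) atTop (𝓝 0) := by
          simpa using
            tendsto_pow_atTop_nhds_zero_of_lt_one (r := (1 / 2 : ℝ)) (by norm_num) (by norm_num)
        exact ge_of_tendsto' (by simpa using h0.const_add (ℓ p)) h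
      · intro h n
        have : (0 : ℝ) < 1 / 2 ^ n := by positivity
        linarith
    have hlim := tendsto_measure_iInter_atTop (μ := Λ)
      (s := fun n : ℕ => {q | ℓ q ≤ ℓ p + 1 / 2 ^ n})
      (fun n => (measurableSet_le hℓ measurable_const).nullMeasurableSet)
      (fun i j hij q (hq : ℓ q ≤ ℓ p + 1 / 2 ^ j) => hq.trans (by gcongr; norm_num))
      ⟨0, hfin _⟩
    rw [hI] at hlim
    refine tendsto_of_tendsto_of_tendsto_of_le_of_le tendsto_const_nhds hlim
      (fun n => measure_mono fun q (hq : ℓ q ≤ ℓ p) =>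
        lt_of_le_of_lt hq (dyadicIndex_bounds (hℓ0 p) n).2.1)
      fun n => measure_mono fun q hq =>
        (le_of_lt hq).trans (dyadicIndex_bounds (hℓ0 p) n).2.2
  calc ∫⁻ p, expNeg (Λ {q | ℓ q ≤ ℓ p}) ∂Λ
      = ∫⁻ p, liminf (fun n =>
          expNeg (Λ {q | ℓ q < dyadic n (dyadicIndex n (ℓ p) + 1)})) atTop ∂Λ :=
        lintegral_congr fun p => (hlim p).liminf_eq.symm
    _ ≤ liminf (fun n =>
          ∫⁻ p, expNeg (Λ {q | ℓ q < dyadic n (dyadicIndex n (ℓ p) + 1)}) ∂Λ) atTop :=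
        lintegral_liminf_le hm
    _ ≤ 1 := liminf_le_of_le (by isBoundedDefault) fun b hb => by
        obtain ⟨n, hn⟩ := hb.exists
        exact hn.trans (hbound n)

/-- The joint law of the lowest point and of the shot noise of the points above it. -/
theorem lintegral_lowest (hη : IsPoissonPointProcess P Λ η) (hℓ : Measurable ℓ)
    (hℓ0 : ∀ p, 0 ≤ ℓ p) (hfin : ∀ x, Λ {p | ℓ p ≤ x} ≠ ∞)
    (hlow : ∀ᵐ ω ∂P, HasLowestPoint ℓ (η ω))
    {f : E → ℝ≥0∞} (hf : Measurable f) (hf1 : ∀ p, f p ≤ 1) {h : E → ℝ≥0∞} (hh : Measurable h)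
    (hht : ∀ p, h p ≠ ∞)
    (hhfin : ∀ x, 0 < x → ∫⁻ p in {p | x < ℓ p}, h p ∂Λ ≠ ∞) {c : ℝ≥0∞} (hc : c ≠ ∞) :
    ∫⁻ ω, (∫⁻ p in {p | ℓ p = lowestLevel ℓ (η ω)}, f p ∂η ω) *
        expNeg (c * (ENNReal.ofReal (lowestLevel ℓ (η ω)) *
          ∫⁻ p in {p | lowestLevel ℓ (η ω) < ℓ p}, h p ∂η ω)) ∂P =
      ∫⁻ p, expNeg (∫⁻ q, (if ℓ q ≤ ℓ p then 1 else
        1 - expNeg (c * (ENNReal.ofReal (ℓ p) * h q))) ∂Λ) * f p ∂Λ := by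
  -- The weight carries the lowest level as a factor. On the grid this factor is replaced by the
  -- upper end of the selected cell, which is deterministic given the cell.
  let g : ℝ → E → ℝ≥0∞ := fun b p => c * (ENNReal.ofReal b * h p)
  have hg : ∀ b, Measurable (g b) := fun b => (hh.const_mul _).const_mul _
  have hL : Tendsto (fun n => ∫⁻ ω, ∑' k, cellSel ℓ n k (η ω) * ((∫⁻ p in cell ℓ n k, f p ∂η ω) *
        expNeg (∫⁻ p in {p | dyadic n (k + 1) ≤ ℓ p}, g (dyadic n (k + 1)) p ∂η ω)) ∂P) atTop
      (𝓝 (∫⁻ ω, (∫⁻ p in {p | ℓ p = lowestLevel ℓ (η ω)}, f p ∂η ω) *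
        expNeg (c * (ENNReal.ofReal (lowestLevel ℓ (η ω)) *
          ∫⁻ p in {p | lowestLevel ℓ (η ω) < ℓ p}, h p ∂η ω)) ∂P)) := by
    refine tendsto_lintegral_of_dominated_convergence (fun _ => 1) (fun n => ?_)
      (fun n => .of_forall fun ω => tsum_cellSel_lintegral_le hf1 _ n (η ω)) (by simp) ?_
    · refine Measurable.tsum fun k => (hη.measurable_cellSel hℓ n k).mul ?_
      exact (hη.measurable_setLIntegral hf (measurableSet_cell hℓ n k)).mul
        (measurable_expNeg.comp
          (hη.measurable_setLIntegral (hg _) (measurableSet_le measurable_const hℓ)))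
    · filter_upwards [hlow] with ω hω
      refine hω.tendsto_tsum_cellSel (fun n k => (∫⁻ p in cell ℓ n k, f p ∂η ω) *
        expNeg (∫⁻ p in {p | dyadic n (k + 1) ≤ ℓ p}, g (dyadic n (k + 1)) p ∂η ω)) ?_
      have hfin1 : ∫⁻ p in {p | ℓ p = lowestLevel ℓ (η ω)}, f p ∂η ω ≠ ∞ := by
        refine ne_top_of_le_ne_top ENNReal.one_ne_top ((lintegral_mono hf1).trans ?_)
        rw [lintegral_one, Measure.restrict_apply_univ, hω.eq_one]
      refine ENNReal.Tendsto.mul (hω.tendsto_cell f) (Or.inr (expNeg_ne_top _))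
        ((continuous_expNeg.tendsto _).comp ?_) (Or.inr hfin1)
      have e : ∀ (b : ℝ) (s : Set E), ∫⁻ p in s, g b p ∂η ω =
          c * (ENNReal.ofReal b * ∫⁻ p in s, h p ∂η ω) := fun b s => by
        rw [lintegral_const_mul _ (hh.const_mul _), lintegral_const_mul _ hh]
      simp_rw [e]
      refine ENNReal.Tendsto.const_mul ?_ (Or.inr hc)
      refine ENNReal.Tendsto.mul ((ENNReal.continuous_ofReal.tendsto _).comp
        (tendsto_dyadic_dyadicIndex_succ hω.pos.le)) (Or.inl ?_) (hω.tendsto_above h)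
        (Or.inr ENNReal.ofReal_ne_top)
      simpa using hω.pos
  simp_rw [hη.lintegral_tsum_cellSel hℓ hℓ0 hfin hf hg] at hL
  refine tendsto_nhds_unique hL ?_
  -- The void extends past the level of `p`, since the upper end of its cell exceeds that level.
  -- This is what the dominating density needs.
  refine tendsto_lintegral_of_dominated_convergence (fun p => expNeg (Λ {q | ℓ q ≤ ℓ p}))
    (fun n => ?_) (fun n => .of_forall fun p => ?_)
    (ne_top_of_le_ne_top ENNReal.one_ne_top (hη.lintegral_expNeg_measure_le_le hℓ hℓ0 hfin))
    (.of_forall fun p => ?_)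
  · refine Measurable.mul ?_ hf
    exact (measurable_from_nat (f := fun k => expNeg (∫⁻ q, (1 - expNeg
      (voidBelow ℓ (g (dyadic n (k + 1))) (dyadic n (k + 1)) q)) ∂Λ))).comp
      (Nat.measurable_floor.comp (hℓ.mul_const _))
  · refine (mul_le_of_le_one_right zero_le (hf1 p)).trans (antitone_expNeg ?_)
    refine le_trans (measure_mono fun q (hq : ℓ q ≤ ℓ p) => ?_)
      (measure_lt_le_lintegral_voidBelow hℓ _ _)
    exact lt_of_le_of_lt hq (dyadicIndex_bounds (hℓ0 p) n).2.1
  · refine ENNReal.Tendsto.mul_const ((continuous_expNeg.tendsto _).comp ?_)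
      (Or.inr (ne_top_of_le_ne_top ENNReal.one_ne_top (hf1 p)))
    set b : ℕ → ℝ := fun n => dyadic n (dyadicIndex n (ℓ p) + 1) with hb
    have hbl : ∀ n, ℓ p < b n := fun n => (dyadicIndex_bounds (hℓ0 p) n).2.1
    have hbu : ∀ n, b n ≤ ℓ p + 1 := fun n => (dyadicIndex_bounds (hℓ0 p) n).2.2.trans (by
      gcongr
      rw [div_le_one (by positivity)]
      exact one_le_pow₀ (by norm_num))
    have hbt : Tendsto b atTop (𝓝 (ℓ p)) := tendsto_dyadic_dyadicIndex_succ (hℓ0 p)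
    have hmle : MeasurableSet {q | ℓ q ≤ ℓ p + 1} := measurableSet_le hℓ measurable_const
    have hmlt : MeasurableSet {q | ℓ p + 1 < ℓ q} := measurableSet_lt measurable_const hℓ
    -- The upper ends stay below `ℓ p + 1`. Up to this level the integrand is at most 1 on a set of
    -- finite intensity; beyond it, 1 - e^{-t} ≤ t leaves the integrable weight. Adding 1 also keeps
    -- the threshold positive if `ℓ p = 0`, as `hhfin` requires.
    refine tendsto_lintegral_of_dominated_convergence (fun q =>
      {q | ℓ q ≤ ℓ p + 1}.indicator 1 q + {q | ℓ p + 1 < ℓ q}.indicator (g (ℓ p + 1)) q)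
      (fun n => measurable_one_sub_expNeg.comp (measurable_voidBelow hℓ (hg _) _))
      (fun n => .of_forall fun q => ?_) ?_ (.of_forall fun q => ?_)
    · dsimp only
      by_cases hq : ℓ q ≤ ℓ p + 1
      · rw [indicator_of_mem (by exact hq)]
        exact tsub_le_self.trans le_self_add
      · rw [indicator_of_mem (show q ∈ {q | ℓ p + 1 < ℓ q} from not_le.1 hq)]
        have hq' : ¬ ℓ q < b n := fun h' => hq (h'.le.trans (hbu n))
        rw [voidBelow, if_neg hq']
        refine (one_sub_expNeg_le _).trans (le_trans ?_ le_add_self)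
        simp only [g]
        gcongr
        exact hbu n
    · rw [lintegral_add_left (measurable_one.indicator hmle), lintegral_indicator_one hmle,
        lintegral_indicator hmlt, lintegral_const_mul _ (hh.const_mul _),
        lintegral_const_mul _ hh]
      refine ENNReal.add_ne_top.2 ⟨hfin _, ENNReal.mul_ne_top hc
        (ENNReal.mul_ne_top ENNReal.ofReal_ne_top (hhfin _ ?_))⟩
      linarith [hℓ0 p]
    · by_cases hq : ℓ q ≤ ℓ p
      · have : ∀ n, ℓ q < b n := fun n => lt_of_le_of_lt hq (hbl n)
        refine tendsto_const_nhds.congr fun n => ?_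
        rw [if_pos hq, voidBelow, if_pos (this n), expNeg_top, tsub_zero]
      · rw [if_neg hq]
        have hev : ∀ᶠ n in atTop, 1 - expNeg (g (b n) q) =
            1 - expNeg (voidBelow ℓ (g (b n)) (b n) q) := by
          filter_upwards [hbt.eventually (gt_mem_nhds (not_le.1 hq))] with n hn
          rw [voidBelow, if_neg (not_lt.2 hn.le)]
        refine Tendsto.congr' hev ?_
        refine (continuous_one_sub_expNeg.tendsto _).comp ?_
        refine ENNReal.Tendsto.const_mul (ENNReal.Tendsto.mul_const
          ((ENNReal.continuous_ofReal.tendsto _).comp hbt) (Or.inr (hht q))) (Or.inr hc)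

end IsPoissonPointProcess

/-! ### Power series whose coefficients have ratio tending to `1` -/

section PowerSeries

variable {a : ℕ → ℝ}

/-- The ratio test on the differentiated series. Its sum at a radius ρ < 1 is the majorant for
termwise differentiation on (-ρ, ρ). -/
lemma summable_succ_mul_pow (h0 : ∀ k, a k ≠ 0)
    (hr : Tendsto (fun k => a (k + 1) / a k) atTop (𝓝 1)) {ρ : ℝ} (hρ0 : 0 < ρ) (hρ1 : ρ < 1) :
    Summable fun k : ℕ => ((k : ℝ) + 1) * |a (k + 1)| * ρ ^ k := by
  have h1 : ∀ k : ℕ, (0 : ℝ) < k + 1 := fun k => by positivity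
  refine summable_of_ratio_test_tendsto_lt_one hρ1 (.of_forall fun k => ?_) ?_
  · have := h0 (k + 1)
    have := h1 k
    positivity
  · have h2 : Tendsto (fun k : ℕ => ((k : ℝ) + 2) / (k + 1)) atTop (𝓝 1) := by
      have := tendsto_add_mul_div_add_mul_atTop_nhds (2 : ℝ) 1 1 one_ne_zero
      simpa [add_comm] using this
    have h3 := (hr.comp (tendsto_add_atTop_nat 1)).norm
    rw [norm_one] at h3
    have h4 := (h2.mul h3).mul_const ρ
    rw [one_mul, one_mul] at h4
    refine h4.congr fun k => ?_
    have e1 := h1 k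
    have e2 := abs_pos.2 (h0 (k + 1))
    simp only [Function.comp, Real.norm_eq_abs, abs_mul, abs_div, abs_pow, abs_abs,
      abs_of_pos e1, abs_of_pos (h1 (k + 1)), abs_of_pos hρ0]
    push_cast
    field_simp
    ring

lemma summable_mul_pow (h0 : ∀ k, a k ≠ 0)
    (hr : Tendsto (fun k => a (k + 1) / a k) atTop (𝓝 1)) {x : ℝ} (hx : |x| < 1) :
    Summable fun k : ℕ => a k * x ^ k := by
  obtain ⟨ρ, hρ, hρ1⟩ := exists_between hx
  have hρ0 : 0 < ρ := (abs_nonneg x).trans_lt hρ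
  rw [← summable_nat_add_iff 1]
  refine Summable.of_norm_bounded (summable_succ_mul_pow h0 hr hρ0 hρ1) fun k => ?_
  rw [norm_mul, norm_pow, Real.norm_eq_abs, Real.norm_eq_abs, pow_succ]
  have e1 : |x| ^ k * |x| ≤ ρ ^ k * 1 := by gcongr
  have e2 : (1 : ℝ) ≤ k + 1 := by simp
  calc |a (k + 1)| * (|x| ^ k * |x|) ≤ |a (k + 1)| * (ρ ^ k * 1) := by gcongr
    _ ≤ (k + 1) * |a (k + 1)| * ρ ^ k := by
      rw [mul_one]
      gcongr
      exact le_mul_of_one_le_left (abs_nonneg _) e2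

lemma hasDerivAt_tsum_mul_pow (h0 : ∀ k, a k ≠ 0)
    (hr : Tendsto (fun k => a (k + 1) / a k) atTop (𝓝 1)) {x : ℝ} (hx : |x| < 1) :
    HasDerivAt (fun y => ∑' k, a k * y ^ k) (∑' k : ℕ, (k + 1) * a (k + 1) * x ^ k) x := by
  obtain ⟨ρ, hρ, hρ1⟩ := exists_between hx
  have hρ0 : 0 < ρ := (abs_nonneg x).trans_lt hρ
  have hmem : ∀ y, y ∈ Ioo (-ρ) ρ ↔ |y| < ρ := fun y => abs_lt.symm
  have hS := summable_succ_mul_pow h0 hr hρ0 hρ1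
  have hd := hasDerivAt_tsum_of_isPreconnected (g := fun (k : ℕ) (y : ℝ) => a (k + 1) * y ^ (k + 1))
    (g' := fun k y => (k + 1) * a (k + 1) * y ^ k) (y₀ := 0) hS isOpen_Ioo
    isPreconnected_Ioo (fun k y _ => ?_) (fun k y hy => ?_) ((hmem _).2 (by simpa using hρ0))
    (by simp) ((hmem x).2 hρ)
  · refine (hd.const_add (a 0)).congr_of_eventuallyEq ?_
    filter_upwards [Ioo_mem_nhds ((hmem x).2 hρ).1 ((hmem x).2 hρ).2] with y hy
    rw [(summable_mul_pow h0 hr (((hmem y).1 hy).trans hρ1)).tsum_eq_zero_add]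
    simp
  · have := (hasDerivAt_pow (k + 1) y).const_mul (a (k + 1))
    refine this.congr_deriv ?_
    push_cast
    ring
  · rw [norm_mul, norm_mul, norm_pow, Real.norm_eq_abs, Real.norm_eq_abs, Real.norm_eq_abs,
      abs_of_pos (by positivity : (0 : ℝ) < (k : ℝ) + 1)]
    gcongr
    exact ((hmem y).1 hy).le

lemma hasSum_mul_deriv (h0 : ∀ k, a k ≠ 0)
    (hr : Tendsto (fun k => a (k + 1) / a k) atTop (𝓝 1)) {x : ℝ} (hx : |x| < 1) :
    HasSum (fun k : ℕ => k * a k * x ^ k) (x * ∑' k : ℕ, (k + 1) * a (k + 1) * x ^ k) := by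
  obtain ⟨ρ, hρ, hρ1⟩ := exists_between hx
  have hρ0 : 0 < ρ := (abs_nonneg x).trans_lt hρ
  have hS : Summable fun k : ℕ => ((k : ℝ) + 1) * a (k + 1) * x ^ k := by
    refine Summable.of_norm_bounded (summable_succ_mul_pow h0 hr hρ0 hρ1) fun k => ?_
    rw [norm_mul, norm_mul, norm_pow, Real.norm_eq_abs, Real.norm_eq_abs, Real.norm_eq_abs,
      abs_of_pos (by positivity : (0 : ℝ) < (k : ℝ) + 1)]
    gcongr
  rw [hasSum_nat_add_iff' (f := fun k : ℕ => k * a k * x ^ k) 1 |>.symm]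
  simp only [Finset.range_one, Finset.sum_singleton, Nat.cast_zero, zero_mul, sub_zero]
  refine (hS.hasSum.mul_left x).congr_fun ?_
  intro k
  push_cast
  ring

end PowerSeries

/-! ### The hypergeometric function on the negative half-line -/

section Hypergeometric

/-- The coefficients of the Gauss hypergeometric series. -/
abbrev hypCoeff (a b c : ℝ) (k : ℕ) : ℝ := ordinaryHypergeometricCoefficient a b c k

lemma hyp_eq_tsum (a b c x : ℝ) : ₂F₁ a b c x = ∑' k, hypCoeff a b c k * x ^ k := by
  rw [ordinaryHypergeometric_eq_tsum]
  rfl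

lemma hypCoeff_succ {a b c : ℝ} (hc : ∀ k : ℕ, c + k ≠ 0) (k : ℕ) :
    hypCoeff a b c (k + 1) * ((c + k) * (k + 1)) = hypCoeff a b c k * ((a + k) * (b + k)) := by
  have hcne : (ascPochhammer ℝ k).eval c ≠ 0 := fun h => by
    obtain ⟨j, -, hj⟩ := (ascPochhammer_eval_eq_zero_iff k c).1 h
    exact hc j (by rw [hj]; ring)
  have := hc k
  have hk : ((k.factorial : ℝ)) ≠ 0 := by positivity
  have hk1 : ((k : ℝ) + 1) ≠ 0 := by positivity
  simp only [hypCoeff, ordinaryHypergeometricCoefficient, ascPochhammer_succ_eval,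
    Nat.factorial_succ]
  push_cast
  field_simp

lemma hypCoeff_zero (a b c : ℝ) : hypCoeff a b c 0 = 1 := by
  simp [hypCoeff, ordinaryHypergeometricCoefficient]

lemma hypCoeff_ne_zero {a b c : ℝ} (ha : ∀ k : ℕ, a + k ≠ 0) (hb : ∀ k : ℕ, b + k ≠ 0)
    (hc : ∀ k : ℕ, c + k ≠ 0) (k : ℕ) : hypCoeff a b c k ≠ 0 := by
  induction k with
  | zero => rw [hypCoeff_zero]; exact one_ne_zero
  | succ k ih =>
    intro h
    have := hypCoeff_succ (a := a) (b := b) hc k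
    rw [h, zero_mul] at this
    exact mul_ne_zero ih (mul_ne_zero (ha k) (hb k)) this.symm

lemma tendsto_hypCoeff_ratio {a b c : ℝ} (ha : ∀ k : ℕ, a + k ≠ 0) (hb : ∀ k : ℕ, b + k ≠ 0)
    (hc : ∀ k : ℕ, c + k ≠ 0) :
    Tendsto (fun k => hypCoeff a b c (k + 1) / hypCoeff a b c k) atTop (𝓝 1) := by
  have h1 := tendsto_add_mul_div_add_mul_atTop_nhds a c (1 : ℝ) one_ne_zero
  have h2 := tendsto_add_mul_div_add_mul_atTop_nhds b 1 (1 : ℝ) one_ne_zero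
  have h3 := h1.mul h2
  rw [div_one, one_mul] at h3
  refine h3.congr fun k => ?_
  have e1 := hypCoeff_succ (a := a) (b := b) hc k
  have e2 := hypCoeff_ne_zero ha hb hc k
  have e3 := hc k
  have e4 : ((k : ℝ) + 1) ≠ 0 := by positivity
  rw [one_mul, div_mul_div_comm, div_eq_div_iff (by rw [add_comm 1]; positivity) e2, add_comm 1,
    e1]
  ring

variable {m δ : ℝ}

/-- The binomial series, written with the coefficients of ₂F₁(m, 1; 1) for comparison with the other
hypergeometric series. -/
lemma hasSum_one_sub_rpow {x : ℝ} (hx : |x| < 1) :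
    HasSum (fun k => hypCoeff m 1 1 k * x ^ k) ((1 - x) ^ (-m)) := by
  have h := (Real.one_add_rpow_hasFPowerSeriesOnBall_zero (a := -m)).hasSum (y := -x)
    (by simpa [edist_dist] using hx)
  rw [binomialSeries_eq_ordinaryHypergeometricSeries (b := (1 : ℝ)) (fun k => by
    have : (0 : ℝ) ≤ k := Nat.cast_nonneg k
    linarith)] at h
  rw [zero_add, ← sub_eq_add_neg] at h
  refine h.congr_fun fun k => ?_
  rw [neg_neg, mul_comm]
  simp [FormalMultilinearSeries.compContinuousLinearMap, ordinaryHypergeometricSeries]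

/-- `Φ` is differentiable at `w`, where it solves the differential equation that characterizes
`₂F₁(m, -δ; 1 - δ; -w)`. -/
def SolvesHyp (m δ : ℝ) (Φ : ℝ → ℝ) (w : ℝ) : Prop :=
  ∃ D, HasDerivAt Φ D w ∧ δ * Φ w - w * D = δ * (1 + w) ^ (-m)

/-- The quotient (-δ)_k / (1 - δ)_k equals δ / (δ - k). The operator δ - w d/dw multiplies the k-th
coefficient by δ - k, and so leaves δ times the binomial series. -/
lemma solvesHyp_series (hm : 0 < m) (hδ0 : 0 < δ) (hδ1 : δ < 1) {w : ℝ} (hw : |w| < 1) :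
    SolvesHyp m δ (fun w => ₂F₁ m (-δ) (1 - δ) (-w)) w := by
  have ha : ∀ k : ℕ, m + k ≠ 0 := fun k => by positivity
  have hb : ∀ k : ℕ, -δ + k ≠ 0 := fun k => by
    rcases k with _ | k
    · simp [hδ0.ne']
    · have : (0 : ℝ) ≤ k := Nat.cast_nonneg k
      push_cast
      linarith
  have hc : ∀ k : ℕ, 1 - δ + k ≠ 0 := fun k => by
    have : (0 : ℝ) ≤ k := Nat.cast_nonneg k
    linarith
  have h0 := hypCoeff_ne_zero ha hb hc
  have hr := tendsto_hypCoeff_ratio ha hb hc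
  have hx : |(-w)| < 1 := by rwa [abs_neg]
  have hd := hasDerivAt_tsum_mul_pow h0 hr hx
  have hs := hasSum_mul_deriv h0 hr hx
  set D := ∑' k : ℕ, ((k : ℝ) + 1) * hypCoeff m (-δ) (1 - δ) (k + 1) * (-w) ^ k
  refine ⟨-D, ?_, ?_⟩
  · simp_rw [hyp_eq_tsum]
    have := hd.comp w (hasDerivAt_neg w)
    rw [mul_neg_one] at this
    exact this
  · simp only [hyp_eq_tsum]
    have hcoef : ∀ k : ℕ, (δ - k) * hypCoeff m (-δ) (1 - δ) k = δ * hypCoeff m 1 1 k := by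
      intro k
      induction k with
      | zero => simp [hypCoeff_zero]
      | succ k ih =>
        have e1 := hypCoeff_succ (a := m) (b := -δ) hc k
        have e2 := hypCoeff_succ (a := m) (b := 1) (c := 1) (fun k => by positivity) k
        have e3 : ((k : ℝ) + 1) ≠ 0 := by positivity
        have e4 : (1 : ℝ) + k ≠ 0 := by positivity
        have e5 : hypCoeff m 1 1 (k + 1) * (k + 1) = hypCoeff m 1 1 k * (m + k) := by
          apply mul_right_cancel₀ e4
          linear_combination e2
        apply mul_right_cancel₀ e3
        push_cast
        linear_combination (-1) * e1 + (m + k) * ih - δ * e5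
    have h1 := (summable_mul_pow h0 hr hx).hasSum.mul_left δ
    have h2 := h1.sub hs
    have h3 := (hasSum_one_sub_rpow (m := m) hx).mul_left δ
    have h4 := h2.unique (h3.congr_fun fun k => by linear_combination (-w) ^ k * hcoef k)
    rw [sub_neg_eq_add] at h4
    rw [← h4]
    ring

/-- In the variable y = w / (1 + w), which stays in [0, 1) for all w ≥ 0, the coefficient recurrence
gives a first-order equation for H = ₂F₁(m, 1; 1 - δ; y). The chain rule turns it into the required
equation for (1 + w)^{-m} H. -/
lemma solvesHyp_pfaff (hm : 0 < m) (hδ1 : δ < 1) {w : ℝ} (hw : 0 ≤ w) :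
    SolvesHyp m δ (fun w => (1 - -w) ^ (-m) * ₂F₁ m (1 - δ - -δ) (1 - δ) (-w / (-w - 1))) w := by
  have hb1 : 1 - δ - -δ = 1 := by ring
  have ha : ∀ k : ℕ, m + k ≠ 0 := fun k => by positivity
  have hb : ∀ k : ℕ, (1 : ℝ) + k ≠ 0 := fun k => by positivity
  have hc : ∀ k : ℕ, 1 - δ + k ≠ 0 := fun k => by
    have : (0 : ℝ) ≤ k := Nat.cast_nonneg k
    linarith
  have h0 := hypCoeff_ne_zero ha hb hc
  have hr := tendsto_hypCoeff_ratio ha hb hc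
  have hw1 : 0 < 1 + w := by linarith
  set y := w / (1 + w) with hy
  have hy0 : 0 ≤ y := by positivity
  have hyy : |y| < 1 := by
    rw [abs_of_nonneg hy0, hy, div_lt_one hw1]
    linarith
  have hd := hasDerivAt_tsum_mul_pow h0 hr hyy
  have hs := hasSum_mul_deriv h0 hr hyy
  set D := ∑' k : ℕ, ((k : ℝ) + 1) * hypCoeff m 1 (1 - δ) (k + 1) * y ^ k with hD
  set H := ∑' k : ℕ, hypCoeff m 1 (1 - δ) k * y ^ k with hH
  have hF : HasSum (fun k : ℕ => hypCoeff m 1 (1 - δ) k * y ^ k) H :=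
    (summable_mul_pow h0 hr hyy).hasSum
  -- Comes from (k + 1 - δ) a_{k+1} = (k + m) a_k multiplied by y^{k+1} and summed. The isolated δ
  -- is the contribution of the constant coefficient.
  have hode : y * (1 - y) * D = δ * H - δ + m * y * H := by
    have h1 := hs.sub (hF.mul_left δ)
    rw [← hasSum_nat_add_iff' 1] at h1
    have h2 := ((hF.mul_left m).add hs).mul_left y
    have h3 := h1.unique (h2.congr_fun fun k => by
      have e1 := hypCoeff_succ (a := m) (b := 1) hc k
      have e3 : ((k : ℝ) + 1) ≠ 0 := by positivity
      have e4 : hypCoeff m 1 (1 - δ) (k + 1) * (1 - δ + k) = hypCoeff m 1 (1 - δ) k * (m + k) := by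
        apply mul_right_cancel₀ e3
        linear_combination e1
      push_cast
      linear_combination y ^ (k + 1) * e4)
    simp only [Finset.range_one, Finset.sum_singleton, hypCoeff_zero] at h3
    norm_num at h3
    linear_combination h3
  have hdy : HasDerivAt (fun w : ℝ => w / (1 + w)) (1 / (1 + w) ^ 2) w := by
    have := (hasDerivAt_id w).div ((hasDerivAt_id w).const_add 1) hw1.ne'
    refine this.congr_deriv ?_
    simp
  have hcomp0 := hd.comp w hdy
  have hcomp : HasDerivAt (fun w : ℝ => ∑' k, hypCoeff m 1 (1 - δ) k * (w / (1 + w)) ^ k)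
      (D * (1 / (1 + w) ^ 2)) w := hcomp0
  have hpow : HasDerivAt (fun w : ℝ => (1 + w) ^ (-m)) (-m * (1 + w) ^ (-m - 1)) w := by
    have := ((hasDerivAt_id w).const_add 1).rpow_const (p := -m) (Or.inl hw1.ne')
    simpa using this
  have hfun : (fun w : ℝ => (1 - -w) ^ (-m) * ₂F₁ m (1 - δ - -δ) (1 - δ) (-w / (-w - 1))) =
      fun w => (1 + w) ^ (-m) * ∑' k, hypCoeff m 1 (1 - δ) k * (w / (1 + w)) ^ k := by
    ext w
    rw [hb1, hyp_eq_tsum, sub_neg_eq_add, show -w - 1 = -(1 + w) by ring, neg_div_neg_eq]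
  rw [hfun]
  refine ⟨_, hpow.mul hcomp, ?_⟩
  dsimp only
  rw [← hy, ← hH, Real.rpow_sub_one hw1.ne']
  have e1 : y * (1 + w) = w := by rw [hy]; field_simp
  have e2 : (1 - y) * (1 + w) = 1 := by rw [hy]; field_simp; ring
  have e3 : w * (1 / (1 + w) ^ 2) = y * (1 - y) := by
    rw [hy]; field_simp; ring
  have e4 : w * ((1 + w) ^ (-m) / (1 + w)) = y * (1 + w) ^ (-m) := by
    rw [hy]; field_simp
  linear_combination m * H * e4 - (1 + w) ^ (-m) * D * e3 - (1 + w) ^ (-m) * hode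

/-- By the differential equation, -r²(Φ(c r^{-α}) - 1) is a primitive of the integrand, and it
vanishes at infinity. As r runs over [R, ∞), the argument stays between 0 and its value at R, so the
equation is required only there. -/
lemma lintegral_tail_of_solvesHyp {α R c : ℝ} (hα : 2 < α) (hm : 0 < m) (hR : 0 < R) (hc : 0 ≤ c)
    {Φ : ℝ → ℝ} (hΦ0 : Φ 0 = 1)
    (hΦ : ∀ w, 0 ≤ w → w ≤ c * R ^ (-α) → SolvesHyp m (2 / α) Φ w) :
    0 ≤ Φ (c * R ^ (-α)) - 1 ∧
    ∫⁻ r in Ioi R, ENNReal.ofReal (2 * r * (1 - (1 + c * r ^ (-α)) ^ (-m))) =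
      ENNReal.ofReal (R ^ 2 * (Φ (c * R ^ (-α)) - 1)) := by
  have hα0 : 0 < α := by linarith
  have hwle : ∀ r, R ≤ r → 0 ≤ c * r ^ (-α) ∧ c * r ^ (-α) ≤ c * R ^ (-α) := fun r hr => by
    have hr0 : 0 < r := hR.trans_le hr
    refine ⟨by positivity, mul_le_mul_of_nonneg_left ?_ hc⟩
    exact Real.rpow_le_rpow_of_nonpos hR hr (by linarith)
  have hder : ∀ r ∈ Ici R, HasDerivAt (fun r => -(r ^ 2 * (Φ (c * r ^ (-α)) - 1)))
      (2 * r * (1 - (1 + c * r ^ (-α)) ^ (-m))) r := fun r hr => by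
    have hr0 : 0 < r := hR.trans_le hr
    obtain ⟨D, hD, hode⟩ := hΦ _ (hwle r hr).1 (hwle r hr).2
    have h1 : HasDerivAt (fun r : ℝ => c * r ^ (-α)) (c * (-α * r ^ (-α - 1))) r :=
      (Real.hasDerivAt_rpow_const (Or.inl hr0.ne')).const_mul c
    have h2 : HasDerivAt (fun r : ℝ => Φ (c * r ^ (-α))) (D * (c * (-α * r ^ (-α - 1)))) r :=
      HasDerivAt.comp r hD h1
    have h3 := ((hasDerivAt_pow 2 r).mul (h2.sub_const 1)).neg
    refine h3.congr_deriv ?_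
    rw [Real.rpow_sub_one hr0.ne']
    have e : (1 + c * r ^ (-α)) ^ (-m) = Φ (c * r ^ (-α)) - c * r ^ (-α) * D * (α / 2) := by
      have : (2 / α) * (α / 2) = 1 := by field_simp
      linear_combination (-(α / 2)) * hode - ((1 + c * r ^ (-α)) ^ (-m) - Φ (c * r ^ (-α))) * this
    rw [e]
    field_simp
    push_cast
    ring
  have hpos : ∀ r ∈ Ioi R, 0 ≤ 2 * r * (1 - (1 + c * r ^ (-α)) ^ (-m)) := fun r hr => by
    have hr0 : 0 < r := hR.trans hr
    have h1 := (hwle r (le_of_lt hr)).1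
    have : (1 + c * r ^ (-α)) ^ (-m) ≤ 1 :=
      Real.rpow_le_one_of_one_le_of_nonpos (by linarith) (by linarith)
    have : 0 ≤ 1 - (1 + c * r ^ (-α)) ^ (-m) := by linarith
    positivity
  -- Differentiability at 0 gives Φ(w) - 1 = O(w), so the boundary term is O(r^{2-α}).
  have hlim : Tendsto (fun r => -(r ^ 2 * (Φ (c * r ^ (-α)) - 1))) atTop (𝓝 0) := by
    obtain ⟨D, hD, -⟩ := hΦ 0 le_rfl (hwle R le_rfl).1
    have hw0 : Tendsto (fun r : ℝ => c * r ^ (-α)) atTop (𝓝 0) := by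
      simpa using (tendsto_rpow_neg_atTop hα0).const_mul c
    have hO := hD.differentiableAt.isBigO_sub
    rw [hΦ0] at hO
    have hO2 := ((Asymptotics.isBigO_refl (fun r : ℝ => r ^ 2) atTop).mul
      (hO.comp_tendsto hw0)).neg_left
    refine hO2.trans_tendsto ?_
    have h1 : Tendsto (fun r : ℝ => c * r ^ (-(α - 2))) atTop (𝓝 0) := by
      simpa using (tendsto_rpow_neg_atTop (by linarith : 0 < α - 2)).const_mul c
    refine h1.congr' ?_
    filter_upwards [eventually_gt_atTop 0] with r hr
    simp only [Function.comp, sub_zero]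
    rw [show -(α - 2) = -α + 2 by ring, Real.rpow_add hr, Real.rpow_two]
    ring
  have hint := integral_Ioi_of_hasDerivAt_of_nonneg' hder hpos hlim
  have hnonneg := setIntegral_nonneg (μ := volume) measurableSet_Ioi hpos
  rw [hint, zero_sub, neg_neg] at hnonneg
  refine ⟨nonneg_of_mul_nonneg_right hnonneg (by positivity), ?_⟩
  rw [← ofReal_integral_eq_lintegral_ofReal (integrableOn_Ioi_deriv_of_nonneg' hder hpos hlim)
    ((ae_restrict_iff' measurableSet_Ioi).2 (.of_forall hpos)), hint]
  congr 1
  ring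

/-- The radial integral that the hypergeometric function evaluates. -/
theorem lintegral_tail_gaussHyp {α R c : ℝ} (hα : 2 < α) (hm : 0 < m) (hR : 0 < R) (hc : 0 ≤ c) :
    0 ≤ gaussHyp m (-(2 / α)) (1 - 2 / α) (-(c * R ^ (-α))) - 1 ∧
    ∫⁻ r in Ioi R, ENNReal.ofReal (2 * r * (1 - (1 + c * r ^ (-α)) ^ (-m))) =
      ENNReal.ofReal (R ^ 2 *
        (gaussHyp m (-(2 / α)) (1 - 2 / α) (-(c * R ^ (-α))) - 1)) := by
  have hα0 : 0 < α := by linarith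
  have hδ0 : 0 < 2 / α := by positivity
  have hδ1 : 2 / α < 1 := by rw [div_lt_one hα0]; exact hα
  have hw : 0 ≤ c * R ^ (-α) := by positivity
  rw [gaussHyp]
  -- The branch is decided at the endpoint R, and the formula of that branch solves the equation on
  -- the whole range of arguments swept by r ≥ R. Hence the two branches never have to be matched.
  split_ifs with h
  · refine lintegral_tail_of_solvesHyp hα hm hR hc (Φ := fun w =>
      ₂F₁ m (-(2 / α)) (1 - 2 / α) (-w)) (by simp) fun w h0 hle => ?_
    refine solvesHyp_series hm hδ0 hδ1 (lt_of_le_of_lt ?_ h)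
    rwa [abs_neg, abs_of_nonneg h0, abs_of_nonneg hw]
  · exact lintegral_tail_of_solvesHyp hα hm hR hc (Φ := fun w => (1 - -w) ^ (-m) *
      ₂F₁ m (1 - 2 / α - -(2 / α)) (1 - 2 / α) (-w / (-w - 1))) (by simp)
      fun w h0 _ => solvesHyp_pfaff hm hδ1 h0

end Hypergeometric

/-! ### Radial integrals in the plane -/

/-- Polar decomposition of Lebesgue measure. The sphere measure has mass dimension times area of the
unit disc, that is 2π. -/
lemma lintegral_norm_plane {g : ℝ → ℝ≥0∞} (hg : Measurable g) :
    ∫⁻ y : EuclideanSpace ℝ (Fin 2), g ‖y‖ =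
      ∫⁻ r in Ioi (0 : ℝ), ENNReal.ofReal (2 * Real.pi * r) * g r := by
  have hf2 : Module.finrank ℝ (EuclideanSpace ℝ (Fin 2)) = 2 := by simp
  have hmp := (volume : Measure (EuclideanSpace ℝ (Fin 2))).measurePreserving_homeomorphUnitSphereProd
  have h1 : ∫⁻ y : EuclideanSpace ℝ (Fin 2), g ‖y‖ =
      ∫⁻ y : ({0}ᶜ : Set (EuclideanSpace ℝ (Fin 2))), g ‖(y : EuclideanSpace ℝ (Fin 2))‖
        ∂((volume : Measure (EuclideanSpace ℝ (Fin 2))).comap (↑)) := by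
    rw [lintegral_subtype_comap (measurableSet_singleton _).compl (fun y => g ‖y‖),
      restrict_compl_singleton]
  have h2 := hmp.lintegral_comp_emb
    (Homeomorph.measurableEmbedding _) (fun p => g (p.2 : ℝ))
  simp only [homeomorphUnitSphereProd_apply_snd_coe] at h2
  have h3 : Measurable fun x : Ioi (0 : ℝ) => g x := hg.comp measurable_subtype_coe
  have h4 : Measurable fun x : Ioi (0 : ℝ) => ENNReal.ofReal ((x : ℝ) ^ 1) :=
    (measurable_subtype_coe.pow_const 1).ennreal_ofReal
  rw [h1, h2, lintegral_prod (fun p : Metric.sphere (0 : EuclideanSpace ℝ (Fin 2)) 1 × Ioi (0 : ℝ) =>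
    g p.2) (h3.comp measurable_snd).aemeasurable]
  simp only [hf2, Nat.add_one_sub_one, lintegral_const, Measure.volumeIoiPow]
  rw [lintegral_withDensity_eq_lintegral_mul _ h4 h3]
  simp only [Pi.mul_apply, pow_one]
  rw [Measure.toSphere_apply_univ, hf2, EuclideanSpace.volume_ball_fin_two]
  have h5 := lintegral_subtype_comap (μ := (volume : Measure ℝ)) (s := Ioi (0 : ℝ))
    measurableSet_Ioi (fun x => ENNReal.ofReal x * g x)
  have h6 : Measurable fun x : ℝ => ENNReal.ofReal x * g x :=
    measurable_id.ennreal_ofReal.mul hg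
  rw [h5, mul_comm, ← lintegral_const_mul _ h6]
  refine setLIntegral_congr_fun measurableSet_Ioi fun r (hr : 0 < r) => ?_
  rw [← mul_assoc]
  congr 1
  rw [ENNReal.ofReal_mul (by positivity), ENNReal.ofReal_mul (by norm_num)]
  simp

/-! ### Gamma distributions -/

lemma measurable_gammaPDF (a r : ℝ) : Measurable (gammaPDF a r) :=
  (measurable_gammaPDFReal a r).ennreal_ofReal

lemma ae_nonneg_gammaMeasure (a r : ℝ) : ∀ᵐ x ∂gammaMeasure a r, 0 ≤ x := by
  rw [gammaMeasure, ae_withDensity_iff (measurable_gammaPDF a r)]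
  refine .of_forall fun x hx => ?_
  by_contra h
  exact hx (gammaPDF_of_neg (not_le.1 h))

/-- Exponential tilting changes a gamma density of rate r into a multiple of the one of rate r + u,
which integrates to 1. -/
lemma lintegral_exp_gammaMeasure {a r u : ℝ} (ha : 0 < a) (hr : 0 < r) (hu : 0 ≤ u) :
    ∫⁻ x, ENNReal.ofReal (Real.exp (-(u * x))) ∂gammaMeasure a r =
      ENNReal.ofReal ((1 + u / r) ^ (-a)) := by
  have hm := measurable_gammaPDF a r
  rw [gammaMeasure, lintegral_withDensity_eq_lintegral_mul _ hm (by fun_prop)]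
  have hru : 0 < r + u := by linarith
  have hconst : (1 + u / r) ^ (-a) = r ^ a / (r + u) ^ a := by
    rw [show 1 + u / r = (r + u) / r by field_simp, Real.rpow_neg (by positivity),
      Real.div_rpow hru.le hr.le, inv_div]
  have : ∀ x, (gammaPDF a r * fun x => ENNReal.ofReal (Real.exp (-(u * x)))) x =
      ENNReal.ofReal ((1 + u / r) ^ (-a)) * gammaPDF a (r + u) x := fun x => by
    simp only [Pi.mul_apply, gammaPDF_eq]
    rw [← ENNReal.ofReal_mul' (Real.exp_pos _).le, ← ENNReal.ofReal_mul (by positivity)]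
    congr 1
    split_ifs with hx
    · rw [hconst]
      have h1 : Real.exp (-((r + u) * x)) = Real.exp (-(r * x)) * Real.exp (-(u * x)) := by
        rw [← Real.exp_add]; congr 1; ring
      rw [h1]
      have := (Real.rpow_pos_of_pos hru a).ne'
      field_simp
    · ring
  rw [lintegral_congr this, lintegral_const_mul _ (measurable_gammaPDF _ _),
    lintegral_gammaPDF_eq_one ha hru, mul_one]

/-- Size-biasing raises the shape of the gamma density by one. -/
lemma lintegral_ofReal_gammaMeasure {a r : ℝ} (ha : 0 < a) (hr : 0 < r) :
    ∫⁻ x, ENNReal.ofReal x ∂gammaMeasure a r = ENNReal.ofReal (a / r) := by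
  have hm := measurable_gammaPDF a r
  rw [gammaMeasure, lintegral_withDensity_eq_lintegral_mul _ hm (by fun_prop)]
  have : ∀ x, (gammaPDF a r * fun x => ENNReal.ofReal x) x =
      ENNReal.ofReal (a / r) * gammaPDF (a + 1) r x := fun x => by
    simp only [Pi.mul_apply, gammaPDF_eq]
    rcases lt_or_ge x 0 with hx | hx
    · simp [hx.not_ge]
    rw [← ENNReal.ofReal_mul' hx, ← ENNReal.ofReal_mul (by positivity)]
    congr 1
    rw [if_pos hx, if_pos hx, Real.Gamma_add_one ha.ne', add_sub_cancel_right,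
      Real.rpow_add_one hr.ne']
    have hG := (Real.Gamma_pos_of_pos ha).ne'
    rcases hx.eq_or_lt with rfl | hx
    · simp [Real.zero_rpow ha.ne']
    · rw [Real.rpow_sub_one hx.ne']
      field_simp
  rw [lintegral_congr this, lintegral_const_mul _ (measurable_gammaPDF _ _),
    lintegral_gammaPDF_eq_one (by linarith) hr, mul_one]

/-! ### Averages over the angles -/

instance isProbabilityMeasure_angleLaw : IsProbabilityMeasure Network.angleLaw := by
  unfold Network.angleLaw
  refine cond_isProbabilityMeasure_of_finite ?_ ?_
  · simp [Real.pi_pos]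
  · simp

namespace LobePattern

variable (A : LobePattern)

lemma phase_nonneg (i : Fin (A.K + 1)) : 0 ≤ A.phase i := by
  rw [← A.phase_zero]
  exact A.phase_strictMono.monotone (Fin.zero_le i)

lemma phase_le_pi (i : Fin (A.K + 1)) : A.phase i ≤ Real.pi := by
  rw [← A.phase_last]
  exact A.phase_strictMono.monotone (Fin.le_last i)

lemma width_nonneg (l : Fin A.K) : 0 ≤ A.width l := by
  have := A.phase_strictMono (Fin.castSucc_lt_succ (i := l))
  unfold width
  linarith

lemma sum_width : ∑ l, A.width l / (2 * Real.pi) = 1 := by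
  have h : ∀ (n : ℕ) (f : Fin (n + 1) → ℝ),
      ∑ l : Fin n, (f l.succ - f l.castSucc) = f (Fin.last n) - f 0 := by
    intro n f
    induction n with
    | zero => simp
    | succ n ih =>
      rw [Fin.sum_univ_castSucc]
      have := ih fun i => f i.castSucc
      simp only [Fin.succ_castSucc] at this ⊢
      rw [this]
      simp
  rw [← Finset.sum_div]
  simp only [width, ← Finset.mul_sum]
  rw [h, A.phase_last, A.phase_zero, sub_zero, div_self (by positivity)]

lemma exists_lobe {t : ℝ} (h0 : 0 ≤ t) (ht : t < Real.pi) :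
    ∃ l : Fin A.K, ∀ j : Fin A.K, (A.phase j.castSucc ≤ t ∧ t < A.phase j.succ) ↔ j = l := by
  have hex : ∃ l : Fin A.K, A.phase l.castSucc ≤ t ∧ t < A.phase l.succ := by
    by_contra! hne
    have hall : ∀ i : Fin (A.K + 1), A.phase i ≤ t := fun i => by
      induction i using Fin.induction with
      | zero => rw [A.phase_zero]; exact h0
      | succ l ih => exact hne l ih
    have := hall (Fin.last _)
    rw [A.phase_last] at this
    linarith
  obtain ⟨l, hl⟩ := hex
  refine ⟨l, fun j => ⟨fun hj => ?_, fun h => h ▸ hl⟩⟩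
  rcases lt_trichotomy j l with h | h | h
  · have : A.phase j.succ ≤ A.phase l.castSucc := A.phase_strictMono.monotone (by
      rw [Fin.le_def, Fin.val_succ]; exact h)
    linarith [hj.2, hl.1]
  · exact h
  · have : A.phase l.succ ≤ A.phase j.castSucc := A.phase_strictMono.monotone (by
      rw [Fin.le_def, Fin.val_succ]; exact h)
    linarith [hj.1, hl.2]

lemma value_nonneg (θ : ℝ) : 0 ≤ A.value θ :=
  Finset.sum_nonneg fun l _ => by split_ifs; exacts [A.gain_nonneg l, le_rfl]

lemma value_le (θ : ℝ) : A.value θ ≤ ∑ l, A.gain l :=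
  Finset.sum_le_sum fun l _ => by split_ifs; exacts [le_rfl, A.gain_nonneg l]

lemma measurableSet_lobe (l : Fin A.K) :
    MeasurableSet {θ : ℝ | A.phase l.castSucc ≤ |θ| ∧ |θ| < A.phase l.succ} :=
  (measurableSet_le measurable_const measurable_id.abs).inter
    (measurableSet_lt measurable_id.abs measurable_const)

lemma measurable_value : Measurable A.value :=
  Finset.measurable_sum _ fun l _ =>
    Measurable.ite (A.measurableSet_lobe l) measurable_const measurable_const

lemma angleLaw_lobe (l : Fin A.K) :
    Network.angleLaw {θ : ℝ | A.phase l.castSucc ≤ |θ| ∧ |θ| < A.phase l.succ} =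
      ENNReal.ofReal (A.width l / (2 * Real.pi)) := by
  have ha := A.phase_nonneg l.castSucc
  have hab := (A.phase_strictMono (Fin.castSucc_lt_succ (i := l))).le
  have hb := A.phase_le_pi l.succ
  unfold Network.angleLaw width
  set a := A.phase l.castSucc
  set b := A.phase l.succ
  rw [cond_apply measurableSet_Ico]
  have hset : Ico (-Real.pi) Real.pi ∩ {θ : ℝ | a ≤ |θ| ∧ |θ| < b} = Ioo (-b) b \ Ioo (-a) a := by
    ext θ
    simp only [mem_inter_iff, mem_Ico, mem_ofPred_eq, Set.mem_sdiff, mem_Ioo, ← abs_lt, not_lt]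
    constructor
    · rintro ⟨-, h1, h2⟩; exact ⟨h2, h1⟩
    · rintro ⟨h1, h2⟩
      have := abs_lt.1 h1
      exact ⟨⟨by linarith [this.1], by linarith [this.2]⟩, h2, h1⟩
  rw [hset, measure_sdiff (Ioo_subset_Ioo (by linarith) hab) measurableSet_Ioo.nullMeasurableSet
    (by simp), Real.volume_Ioo, Real.volume_Ioo, Real.volume_Ico,
    ← ENNReal.ofReal_sub _ (by linarith), ← ENNReal.ofReal_inv_of_pos (by linarith [Real.pi_pos]),
    ← ENNReal.ofReal_mul (inv_nonneg.2 (by linarith [Real.pi_pos]))]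
  congr 1
  have := Real.pi_pos.ne'
  field_simp

lemma lintegral_value {φ : ℝ → ℝ≥0∞} :
    ∫⁻ θ, φ (A.value θ) ∂Network.angleLaw =
      ∑ l, ENNReal.ofReal (A.width l / (2 * Real.pi)) * φ (A.gain l) := by
  -- The angle -π belongs to the support interval but to no lobe, as lobes end strictly below π. It
  -- is a null point.
  have hae : ∀ᵐ θ ∂Network.angleLaw, |θ| < Real.pi := by
    have h1 : ∀ᵐ θ ∂Network.angleLaw, θ ∈ Ico (-Real.pi) Real.pi :=
      ae_cond_mem measurableSet_Ico
    have h2 : ∀ᵐ θ ∂Network.angleLaw, θ ≠ -Real.pi := by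
      have : ∀ᵐ θ : ℝ, θ ≠ -Real.pi := by simp [ae_iff]
      exact cond_absolutelyContinuous.ae_le this
    filter_upwards [h1, h2] with θ h1 h2
    exact abs_lt.2 ⟨lt_of_le_of_ne h1.1 (Ne.symm h2), h1.2⟩
  have heq : ∀ᵐ θ ∂Network.angleLaw, φ (A.value θ) =
      ∑ l, {θ : ℝ | A.phase l.castSucc ≤ |θ| ∧ |θ| < A.phase l.succ}.indicator
        (fun _ => φ (A.gain l)) θ := by
    filter_upwards [hae] with θ hθ
    obtain ⟨l, hl⟩ := A.exists_lobe (abs_nonneg θ) hθ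
    have hv : A.value θ = A.gain l := by
      simp only [value, hl]
      simp
    rw [hv, Finset.sum_eq_single l]
    · rw [indicator_of_mem]
      exact (hl l).2 rfl
    · intro j _ hj
      rw [indicator_of_notMem]
      exact fun h => hj ((hl j).1 h)
    · simp
  rw [lintegral_congr_ae heq, lintegral_finsetSum _
    (fun l _ => measurable_const.indicator (A.measurableSet_lobe l))]
  refine Finset.sum_congr rfl fun l _ => ?_
  rw [lintegral_indicator_const (A.measurableSet_lobe l), angleLaw_lobe, mul_comm]

end LobePattern

/-! ### Shadowing and load -/

namespace Network

variable {S : Type*} [Fintype S] (M : Network S)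

lemma alp_pos (s : S) : 0 < M.alp s := by linarith [M.alp_gt_two s]

lemma theta_pos (s : S) : 0 < M.theta s := Real.exp_pos _

lemma powRB_pos : 0 < M.powRB := div_pos M.powBS_pos (Nat.cast_pos.2 M.nRB_pos)

lemma gain0_pos : 0 < M.gain0 := mul_pos M.patBS_pos M.patMT_pos

/-- The moment is the Gaussian generating function at 2 ln 10 / (10 α). -/
lemma shadowMoment_eq (s : S) : M.shadowMoment s = M.theta s := by
  have h : ∀ y : ℝ, ((10 : ℝ) ^ (y / 10)) ^ (2 / M.alp s) =
      Real.exp (2 * Real.log 10 / (10 * M.alp s) * y) := fun y => by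
    rw [← Real.rpow_mul (by norm_num), Real.rpow_def_of_pos (by norm_num)]
    congr 1
    have := (M.alp_pos s).ne'
    field_simp
  have hmgf := congrFun (mgf_id_gaussianReal (μ := M.mu s) (v := (M.sig s ^ 2).toNNReal))
    (2 * Real.log 10 / (10 * M.alp s))
  rw [mgf] at hmgf
  simp only [id] at hmgf
  simp_rw [shadowMoment, h]
  rw [hmgf, theta, Real.coe_toNNReal _ (sq_nonneg _)]
  congr 1
  have := (M.alp_pos s).ne'
  field_simp

lemma probLoad_nonneg (n : ℕ) : 0 ≤ M.probLoad n :=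
  integral_nonneg fun _ => measureReal_nonneg

/-- Partial sums of Poisson weights are at most 1, pointwise in the area. This keeps `pOff` below 1,
so that the activity marks have a probability law. -/
lemma sum_probLoad_le (k : ℕ) : ∑ n ∈ Finset.range k, M.probLoad n ≤ 1 := by
  have : IsProbabilityMeasure M.cellArea :=
    isProbabilityMeasure_gammaMeasure (by norm_num) (mul_pos (by norm_num) M.lamBS_pos)
  have hint : ∀ n : ℕ, Integrable
      (fun a => (poissonMeasure (M.lamMT * a).toNNReal).real {n}) M.cellArea := fun n => by
    refine Integrable.of_bound (C := 1) ?_ (.of_forall fun a => ?_)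
    · simp_rw [poissonMeasure_real_singleton]
      exact Measurable.aestronglyMeasurable (by fun_prop)
    · rw [Real.norm_eq_abs, abs_of_nonneg measureReal_nonneg]
      exact measureReal_le_one
  simp only [probLoad]
  rw [← integral_finsetSum _ fun n _ => hint n]
  calc ∫ a, ∑ n ∈ Finset.range k, (poissonMeasure (M.lamMT * a).toNNReal).real {n} ∂M.cellArea
      ≤ ∫ _, (1 : ℝ) ∂M.cellArea := by
        refine integral_mono (integrable_finsetSum _ fun n _ => hint n) (integrable_const _)
          fun a => ?_
        simp only [poissonMeasure_real_singleton]
        exact sum_le_hasSum _ (fun n _ => by positivity)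
          (hasSum_one_poissonMeasure (M.lamMT * a).toNNReal)
    _ = 1 := by simp

lemma pOff_nonneg : 0 ≤ M.pOff := by
  refine Finset.sum_nonneg fun n hn => mul_nonneg ?_ (M.probLoad_nonneg n)
  have h1 : (n : ℝ) ≤ M.nRB := by
    exact_mod_cast Nat.lt_succ_iff.1 (Finset.mem_range.1 hn)
  have h2 : (0 : ℝ) < M.nRB := Nat.cast_pos.2 M.nRB_pos
  rw [sub_nonneg, div_le_one h2]
  exact h1

lemma pOff_le_one : M.pOff ≤ 1 := by
  refine le_trans (Finset.sum_le_sum fun n _ => ?_) (M.sum_probLoad_le (M.nRB + 1))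
  refine mul_le_of_le_one_left (M.probLoad_nonneg n) ?_
  have : (0 : ℝ) ≤ n / M.nRB := by positivity
  linarith

instance isProbabilityMeasure_activeLaw : IsProbabilityMeasure M.activeLaw := ⟨by
  simp only [activeLaw, Measure.coe_add, Measure.coe_smul, Pi.add_apply, Pi.smul_apply,
    measure_univ, smul_eq_mul, mul_one]
  rw [← ENNReal.ofReal_add (by linarith [M.pOff_le_one]) M.pOff_nonneg]
  simp⟩

instance isProbabilityMeasure_fadingLaw (s : S) : IsProbabilityMeasure (M.fadingLaw s) :=
  isProbabilityMeasure_gammaMeasure (M.m_pos s) (div_pos (M.m_pos s) (M.Om_pos s))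

lemma lintegral_activeLaw (f : Bool → ℝ≥0∞) : ∫⁻ a, f a ∂M.activeLaw =
    ENNReal.ofReal (1 - M.pOff) * f true + ENNReal.ofReal M.pOff * f false := by
  rw [activeLaw, lintegral_add_measure, lintegral_smul_measure, lintegral_smul_measure,
    lintegral_dirac, lintegral_dirac]
  simp

lemma lintegral_exp_fadingLaw (s : S) {u : ℝ} (hu : 0 ≤ u) :
    ∫⁻ x, ENNReal.ofReal (Real.exp (-(u * x))) ∂M.fadingLaw s =
      ENNReal.ofReal (M.mgfFading s u) := by
  rw [fadingLaw, lintegral_exp_gammaMeasure (M.m_pos s) (div_pos (M.m_pos s) (M.Om_pos s)) hu,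
    mgfFading]
  congr 3
  have := (M.m_pos s).ne'
  have := (M.Om_pos s).ne'
  field_simp

lemma lintegral_ofReal_fadingLaw (s : S) :
    ∫⁻ x, ENNReal.ofReal x ∂M.fadingLaw s = ENNReal.ofReal (M.Om s) := by
  rw [fadingLaw, lintegral_ofReal_gammaMeasure (M.m_pos s) (div_pos (M.m_pos s) (M.Om_pos s))]
  congr 1
  have := (M.m_pos s).ne'
  field_simp

/-! ### The intensity measure in polar coordinates -/

/-- Law of the marks of a link in state `s`. -/
def markLaw (s : S) : Measure (Bool × ℝ × ℝ × ℝ) :=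
  M.activeLaw.prod (angleLaw.prod (angleLaw.prod (M.fadingLaw s)))

instance isProbabilityMeasure_markLaw (s : S) : IsProbabilityMeasure (M.markLaw s) := by
  unfold markLaw
  infer_instance

/-- Density of the distances of the base stations in state `s`. -/
def radialDensity (s : S) (r : ℝ) : ℝ :=
  Real.pi * M.lamBS * M.theta s * (M.stateProb s r * (2 * r))

lemma measurable_stateProb (s : S) : Measurable (M.stateProb s) :=
  (Finset.measurable_sum _ fun _ _ => Measurable.ite
    ((measurableSet_le measurable_const measurable_id).inter
      (measurableSet_lt measurable_id measurable_const)) measurable_const measurable_const).add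
    (Measurable.ite (measurableSet_le measurable_const measurable_id)
      measurable_const measurable_const)

lemma stateProb_nonneg (s : S) (r : ℝ) : 0 ≤ M.stateProb s r := by
  refine add_nonneg (Finset.sum_nonneg fun b _ => ?_) ?_ <;> split_ifs <;>
    first | exact M.q_nonneg s _ | exact le_rfl

lemma measurable_radialDensity (s : S) : Measurable (M.radialDensity s) :=
  ((M.measurable_stateProb s).mul (measurable_id.const_mul 2)).const_mul _

lemma planeCoeff_pos (s : S) : 0 < Real.pi * M.lamBS * M.theta s :=
  mul_pos (mul_pos Real.pi_pos M.lamBS_pos) (M.theta_pos s)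

section Intensity

variable [MeasurableSpace S] [MeasurableSingletonClass S]

instance sigmaFinite_planeIntensity (s : S) : SigmaFinite (M.planeIntensity s) := by
  unfold planeIntensity
  exact SigmaFinite.withDensity_ofReal _

lemma lintegral_intensity {g : S → ℝ → Bool × ℝ × ℝ × ℝ → ℝ≥0∞}
    (hg : ∀ s, Measurable (Function.uncurry (g s))) :
    ∫⁻ p : Link S, g p.1 ‖p.2.1‖ p.2.2 ∂M.intensity =
      ∑ s, ∫⁻ r in Ioi 0, ENNReal.ofReal (M.radialDensity s r) * ∫⁻ w, g s r w ∂M.markLaw s := by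
  rw [intensity, lintegral_finsetSum_measure]
  refine Finset.sum_congr rfl fun s _ => ?_
  have hgs := hg s
  have hd : Measurable fun x : EuclideanSpace ℝ (Fin 2) =>
      ENNReal.ofReal (M.lamBS * M.shadowMoment s * M.stateProb s ‖x‖) :=
    (((M.measurable_stateProb s).comp measurable_norm).const_mul _).ennreal_ofReal
  have hi : Measurable fun r => ∫⁻ w, g s r w ∂M.markLaw s :=
    hgs.lintegral_prod_right'
  change ∫⁻ p : Link S, g p.1 ‖p.2.1‖ p.2.2 ∂((Measure.dirac s).prod
    ((M.planeIntensity s).prod (M.markLaw s))) = _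
  rw [Measure.dirac_prod, (measurableEmbedding_prodMk_left s).lintegral_map,
    planeIntensity, lintegral_prod, lintegral_withDensity_eq_lintegral_mul _ hd]
  · have := lintegral_norm_plane (g := fun r =>
      ENNReal.ofReal (M.lamBS * M.shadowMoment s * M.stateProb s r) *
        ∫⁻ w, g s r w ∂M.markLaw s)
      ((((M.measurable_stateProb s)).const_mul _).ennreal_ofReal.mul hi)
    refine this.trans (setLIntegral_congr_fun measurableSet_Ioi fun r (hr : 0 < r) => ?_)
    rw [← mul_assoc, ← ENNReal.ofReal_mul (by positivity)]
    congr 2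
    rw [M.shadowMoment_eq, radialDensity]
    ring
  · exact hi.comp measurable_norm
  · exact (hgs.comp ((measurable_norm.comp measurable_fst).prodMk measurable_snd)).aemeasurable

instance sigmaFinite_intensity : SigmaFinite M.intensity := by
  unfold intensity
  rw [← Measure.sum_fintype]
  infer_instance

end Intensity

/-! ### Integrals of the link state probabilities -/

lemma D_nonneg (b : Fin (M.B + 1)) : 0 ≤ M.D b := by
  rw [← M.D_zero]
  exact M.D_mono (Fin.zero_le b)

lemma D_castSucc_le (b : Fin M.B) : M.D b.castSucc ≤ M.D b.succ :=
  M.D_mono (Fin.castSucc_lt_succ).le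

lemma ofReal_stateProb_mul (s : S) (r : ℝ) (a : ℝ≥0∞) :
    ENNReal.ofReal (M.stateProb s r) * a =
      (∑ b : Fin M.B, ENNReal.ofReal (M.q s b.castSucc) *
        (Ico (M.D b.castSucc) (M.D b.succ)).indicator (fun _ => a) r)
      + ENNReal.ofReal (M.q s (Fin.last M.B)) *
        (Ici (M.D (Fin.last M.B))).indicator (fun _ => a) r := by
  have h0 : ∀ b : Fin M.B, 0 ≤ (if M.D b.castSucc ≤ r ∧ r < M.D b.succ
      then M.q s b.castSucc else 0) := fun b => by
    split_ifs; exacts [M.q_nonneg s _, le_rfl]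
  have h1 : 0 ≤ (if M.D (Fin.last M.B) ≤ r then M.q s (Fin.last M.B) else 0) := by
    split_ifs; exacts [M.q_nonneg s _, le_rfl]
  rw [stateProb, ENNReal.ofReal_add (Finset.sum_nonneg fun b _ => h0 b) h1,
    ENNReal.ofReal_sum_of_nonneg fun b _ => h0 b, add_mul, Finset.sum_mul]
  simp only [indicator, mem_Ico, mem_Ici]
  congr 1
  · refine Finset.sum_congr rfl fun b _ => ?_
    split_ifs <;> simp
  · split_ifs <;> simp

/-- `K` is the tail function of `ψ` beyond `R`. Cutting a ring at `R` amounts to replacing its radii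
by their maxima with `R`; boundary points are null. -/
lemma setLIntegral_Ico_inter_Ioi {ψ : ℝ → ℝ≥0∞} {K : ℝ → ℝ} {R : ℝ}
    (hK : ∀ t, R ≤ t → ∫⁻ r in Ioi t, ψ r = ENNReal.ofReal (K t))
    (hK0 : ∀ t, R ≤ t → 0 ≤ K t) {a b : ℝ} (hab : a ≤ b) :
    K (max R b) ≤ K (max R a) ∧
    ∫⁻ r in Ico a b ∩ Ioi R, ψ r = ENNReal.ofReal (K (max R a) - K (max R b)) := by
  have hle : max R a ≤ max R b := max_le_max le_rfl hab
  have hae : (Ico a b ∩ Ioi R : Set ℝ) =ᵐ[volume] Ioc (max R a) (max R b) := by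
    have h1 : ∀ᵐ r : ℝ, r ≠ a := by simp [ae_iff]
    have h2 : ∀ᵐ r : ℝ, r ≠ b := by simp [ae_iff]
    filter_upwards [h1, h2] with r h1 h2
    refine propext (?_ : r ∈ Ico a b ∩ Ioi R ↔ r ∈ Ioc (max R a) (max R b))
    simp only [mem_inter_iff, mem_Ico, mem_Ioi, mem_Ioc, max_lt_iff, le_max_iff]
    constructor
    · rintro ⟨⟨h3, h4⟩, h5⟩
      exact ⟨⟨h5, lt_of_le_of_ne h3 (Ne.symm h1)⟩, Or.inr h4.le⟩
    · rintro ⟨⟨h3, h4⟩, h5⟩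
      refine ⟨⟨h4.le, ?_⟩, h3⟩
      rcases h5 with h5 | h5
      · linarith
      · exact lt_of_le_of_ne h5 h2
  have hadd : ∫⁻ r in Ioi (max R a), ψ r =
      (∫⁻ r in Ioc (max R a) (max R b), ψ r) + ∫⁻ r in Ioi (max R b), ψ r := by
    rw [← Ioc_union_Ioi_eq_Ioi hle, lintegral_union measurableSet_Ioi]
    exact Set.disjoint_left.2 fun x hx hx' => not_lt.2 hx.2 hx'
  rw [hK _ (le_max_left _ _), hK _ (le_max_left _ _)] at hadd
  refine ⟨?_, ?_⟩
  · rw [← ENNReal.ofReal_le_ofReal_iff (hK0 _ (le_max_left _ _)), hadd]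
    exact le_add_self
  · rw [setLIntegral_congr hae, ENNReal.ofReal_sub _ (hK0 _ (le_max_left _ _)), hadd,
      ENNReal.add_sub_cancel_right ENNReal.ofReal_ne_top]

/-- Reduces integrals against the multi-ball model to one tail function. It is used for the mean
number of stations, with an area as tail, and for the interference, with a hypergeometric tail. -/
lemma lintegral_stateProb_mul (s : S) {ψ : ℝ → ℝ≥0∞} (hψ : Measurable ψ) {K : ℝ → ℝ} {R : ℝ}
    (hK : ∀ t, R ≤ t → ∫⁻ r in Ioi t, ψ r = ENNReal.ofReal (K t))
    (hK0 : ∀ t, R ≤ t → 0 ≤ K t) :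
    0 ≤ (∑ b : Fin M.B, M.q s b.castSucc *
          (K (max R (M.D b.castSucc)) - K (max R (M.D b.succ))))
        + M.q s (Fin.last M.B) * K (max R (M.D (Fin.last M.B))) ∧
    ∫⁻ r in Ioi R, ENNReal.ofReal (M.stateProb s r) * ψ r =
      ENNReal.ofReal ((∑ b : Fin M.B, M.q s b.castSucc *
          (K (max R (M.D b.castSucc)) - K (max R (M.D b.succ))))
        + M.q s (Fin.last M.B) * K (max R (M.D (Fin.last M.B)))) := by
  have hb := fun b : Fin M.B => setLIntegral_Ico_inter_Ioi hK hK0 (M.D_castSucc_le b)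
  have hn : ∀ b : Fin M.B, 0 ≤ M.q s b.castSucc *
      (K (max R (M.D b.castSucc)) - K (max R (M.D b.succ))) := fun b =>
    mul_nonneg (M.q_nonneg s _) (sub_nonneg.2 (hb b).1)
  have hl : 0 ≤ M.q s (Fin.last M.B) * K (max R (M.D (Fin.last M.B))) :=
    mul_nonneg (M.q_nonneg s _) (hK0 _ (le_max_left _ _))
  refine ⟨add_nonneg (Finset.sum_nonneg fun b _ => hn b) hl, ?_⟩
  have hmI : ∀ b : Fin M.B, Measurable fun r =>
      (Ico (M.D b.castSucc) (M.D b.succ)).indicator (fun _ => ψ r) r := fun b =>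
    hψ.indicator measurableSet_Ico
  have hmL : Measurable fun r => (Ici (M.D (Fin.last M.B))).indicator (fun _ => ψ r) r :=
    hψ.indicator measurableSet_Ici
  simp_rw [M.ofReal_stateProb_mul]
  rw [lintegral_add_left (Finset.measurable_sum _ fun b _ => (hmI b).const_mul _),
    lintegral_finsetSum _ fun b _ => (hmI b).const_mul _,
    ENNReal.ofReal_add (Finset.sum_nonneg fun b _ => hn b) hl,
    ENNReal.ofReal_sum_of_nonneg fun b _ => hn b, lintegral_const_mul _ hmL]
  congr 1
  · refine Finset.sum_congr rfl fun b _ => ?_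
    rw [lintegral_const_mul _ (hmI b), ENNReal.ofReal_mul (M.q_nonneg s _), ← (hb b).2]
    congr 1
    exact setLIntegral_indicator measurableSet_Ico ψ
  · rw [ENNReal.ofReal_mul (M.q_nonneg s _), ← hK _ (le_max_left _ _)]
    congr 1
    refine (setLIntegral_indicator measurableSet_Ici ψ).trans (setLIntegral_congr ?_)
    have h1 : ∀ᵐ r : ℝ, r ≠ M.D (Fin.last M.B) := by simp [ae_iff]
    filter_upwards [h1] with r h1
    refine propext (?_ : r ∈ Ici _ ∩ Ioi R ↔ r ∈ Ioi (max R _))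
    simp only [mem_inter_iff, mem_Ici, mem_Ioi, max_lt_iff]
    exact ⟨fun h => ⟨h.2, lt_of_le_of_ne h.1 (Ne.symm h1)⟩, fun h => ⟨h.2.le, h.1⟩⟩

/-! ### Distances and path-losses -/

/-- The distance at which the path-loss in state `s` is `x`. -/
def radius (s : S) (x : ℝ) : ℝ := (x / M.kap s) ^ (1 / M.alp s)

lemma radius_pos (s : S) {x : ℝ} (hx : 0 < x) : 0 < M.radius s x :=
  Real.rpow_pos_of_pos (div_pos hx (M.kap_pos s)) _

lemma radius_nonneg (s : S) {x : ℝ} (hx : 0 ≤ x) : 0 ≤ M.radius s x :=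
  Real.rpow_nonneg (div_nonneg hx (M.kap_pos s).le) _

lemma radius_sq (s : S) {x : ℝ} (hx : 0 ≤ x) :
    M.radius s x ^ 2 = (x / M.kap s) ^ (2 / M.alp s) := by
  rw [radius, ← Real.rpow_two, ← Real.rpow_mul (div_nonneg hx (M.kap_pos s).le)]
  congr 1
  ring

lemma kap_mul_radius_rpow (s : S) {x : ℝ} (hx : 0 ≤ x) :
    M.kap s * M.radius s x ^ M.alp s = x := by
  have h := (M.alp_pos s).ne'
  rw [radius, ← Real.rpow_mul (div_nonneg hx (M.kap_pos s).le), one_div_mul_cancel h,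
    Real.rpow_one, mul_div_cancel₀ _ (M.kap_pos s).ne']

lemma kap_mul_rpow_le_iff (s : S) {r x : ℝ} (hr : 0 ≤ r) (hx : 0 ≤ x) :
    M.kap s * r ^ M.alp s ≤ x ↔ r ≤ M.radius s x := by
  conv_lhs => rw [← M.kap_mul_radius_rpow s hx]
  rw [mul_le_mul_iff_right₀ (M.kap_pos s),
    Real.rpow_le_rpow_iff hr (M.radius_nonneg s hx) (M.alp_pos s)]

lemma kap_mul_rpow_lt_iff (s : S) {r x : ℝ} (hr : 0 ≤ r) (hx : 0 ≤ x) :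
    M.kap s * r ^ M.alp s < x ↔ r < M.radius s x := by
  conv_lhs => rw [← M.kap_mul_radius_rpow s hx]
  rw [mul_lt_mul_iff_right₀ (M.kap_pos s),
    Real.rpow_lt_rpow_iff hr (M.radius_nonneg s hx) (M.alp_pos s)]

lemma heaviside_sub_edge (s : S) {x : ℝ} (hx : 0 ≤ x) (b : Fin (M.B + 1)) :
    heaviside (x - M.edge s b) = if M.D b ≤ M.radius s x then 1 else 0 := by
  simp only [heaviside, sub_nonneg, edge, M.kap_mul_rpow_le_iff s (M.D_nonneg b) hx]

lemma coHeaviside_sub_edge (s : S) {x : ℝ} (hx : 0 ≤ x) (b : Fin (M.B + 1)) :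
    coHeaviside (x - M.edge s b) = if M.D b ≤ M.radius s x then 0 else 1 := by
  rw [coHeaviside, M.heaviside_sub_edge s hx]
  split_ifs <;> simp

/-- For each ring, the Heaviside factors distinguish whether the radius of path-loss `x` lies below,
in or above it. Minima with this radius express the three cases at once. -/
lemma Lam_eq (s : S) {x : ℝ} (hx : 0 ≤ x) :
    M.Lam s x = Real.pi * M.lamBS * M.theta s * ((∑ b : Fin M.B, M.q s b.castSucc *
        ((M.radius s x ^ 2 - min (M.D b.castSucc) (M.radius s x) ^ 2)
          - (M.radius s x ^ 2 - min (M.D b.succ) (M.radius s x) ^ 2)))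
      + M.q s (Fin.last M.B) *
        (M.radius s x ^ 2 - min (M.D (Fin.last M.B)) (M.radius s x) ^ 2)) := by
  rw [Lam, ← M.radius_sq s hx, mul_assoc _ (M.q s (Fin.last M.B)), ← mul_add, ← mul_add,
    ← Finset.sum_add_distrib]
  congr 2
  · refine Finset.sum_congr rfl fun b _ => ?_
    rw [← mul_add, M.heaviside_sub_edge s hx, M.heaviside_sub_edge s hx,
      M.coHeaviside_sub_edge s hx]
    have := M.D_castSucc_le b
    congr 1
    split_ifs with h1 h2 h2
    · rw [min_eq_left h1, min_eq_left h2]; ring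
    · exact absurd (this.trans h1) h2
    · rw [min_eq_right (le_of_not_ge h1), min_eq_left h2]; ring
    · rw [min_eq_right (le_of_not_ge h1), min_eq_right (le_of_not_ge h2)]; ring
  · rw [M.heaviside_sub_edge s hx]
    split_ifs with h1
    · rw [min_eq_left h1, one_mul]
    · rw [min_eq_right (le_of_not_ge h1)]; ring

lemma lintegral_Ioc_two_mul {a b : ℝ} (ha : 0 ≤ a) (hab : a ≤ b) :
    ∫⁻ r in Ioc a b, ENNReal.ofReal (2 * r) = ENNReal.ofReal (b ^ 2 - a ^ 2) := by
  have hi : IntegrableOn (fun r : ℝ => 2 * r) (Ioc a b) :=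
    ((continuous_const.mul continuous_id).integrableOn_Icc).mono_set Ioc_subset_Icc_self
  rw [← ofReal_integral_eq_lintegral_ofReal hi
    ((ae_restrict_iff' measurableSet_Ioc).2 (.of_forall fun r hr => by
      have := hr.1; simp; linarith)), ← intervalIntegral.integral_of_le hab,
    intervalIntegral.integral_const_mul, integral_id]
  congr 1
  ring

lemma lintegral_radialDensity_lt (s : S) {x : ℝ} (hx : 0 ≤ x) :
    0 ≤ M.Lam s x ∧
    ∫⁻ r in Ioi 0, ENNReal.ofReal (M.radialDensity s r) *
      (if M.kap s * r ^ M.alp s < x then 1 else 0) = ENNReal.ofReal (M.Lam s x) := by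
  set R := M.radius s x with hR
  have hR0 : 0 ≤ R := M.radius_nonneg s hx
  let ψ : ℝ → ℝ≥0∞ := (Iio R).indicator fun r => ENNReal.ofReal (2 * r)
  have hψ : Measurable ψ := Measurable.indicator (by fun_prop) measurableSet_Iio
  have hK0 : ∀ t : ℝ, 0 ≤ t → 0 ≤ R ^ 2 - min t R ^ 2 := fun t ht =>
    sub_nonneg.2 (pow_le_pow_left₀ (le_min ht hR0) (min_le_right _ _) 2)
  have hK : ∀ t : ℝ, 0 ≤ t → ∫⁻ r in Ioi t, ψ r = ENNReal.ofReal (R ^ 2 - min t R ^ 2) :=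
    fun t ht => by
      rw [← lintegral_Ioc_two_mul (le_min ht hR0) (min_le_right _ _),
        setLIntegral_indicator measurableSet_Iio]
      refine setLIntegral_congr ?_
      have h1 : ∀ᵐ r : ℝ, r ≠ R := by simp [ae_iff]
      filter_upwards [h1] with r h1
      refine propext (?_ : r ∈ Iio R ∩ Ioi t ↔ r ∈ Ioc (min t R) R)
      simp only [mem_inter_iff, mem_Iio, mem_Ioi, mem_Ioc, min_lt_iff]
      constructor
      · rintro ⟨h2, h3⟩; exact ⟨Or.inl h3, h2.le⟩
      · rintro ⟨h2, h3⟩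
        have h4 := lt_of_le_of_ne h3 h1
        exact ⟨h4, h2.resolve_right (not_lt.2 h3)⟩
  obtain ⟨hn, he⟩ := M.lintegral_stateProb_mul s hψ hK hK0
  simp only [max_eq_right (M.D_nonneg _)] at hn he
  rw [M.Lam_eq s hx, ← hR]
  refine ⟨mul_nonneg (M.planeCoeff_pos s).le hn, ?_⟩
  rw [ENNReal.ofReal_mul (M.planeCoeff_pos s).le, ← he,
    ← lintegral_const_mul (ENNReal.ofReal (Real.pi * M.lamBS * M.theta s))
      (f := fun r => ENNReal.ofReal (M.stateProb s r) * ψ r)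
      ((M.measurable_stateProb s).ennreal_ofReal.mul hψ)]
  refine setLIntegral_congr_fun measurableSet_Ioi fun r (hr : 0 < r) => ?_
  simp only [M.kap_mul_rpow_lt_iff s hr.le hx, ← hR, ψ, indicator, mem_Iio]
  rw [radialDensity, ENNReal.ofReal_mul (M.planeCoeff_pos s).le,
    ENNReal.ofReal_mul (M.stateProb_nonneg s r)]
  split_ifs <;> simp [mul_assoc]

lemma Lam_nonneg (s : S) {x : ℝ} (hx : 0 ≤ x) : 0 ≤ M.Lam s x :=
  (M.lintegral_radialDensity_lt s hx).1

end Network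

/-! ### Elementary properties of the Heaviside functions. -/

lemma measurable_heaviside : Measurable heaviside :=
  Measurable.ite measurableSet_Ici measurable_const measurable_const

lemma measurable_coHeaviside : Measurable coHeaviside :=
  measurable_heaviside.const_sub 1

lemma heaviside_nonneg (x : ℝ) : 0 ≤ heaviside x := by
  unfold heaviside
  split_ifs <;> norm_num

lemma coHeaviside_nonneg (x : ℝ) : 0 ≤ coHeaviside x := by
  unfold coHeaviside heaviside
  split_ifs <;> norm_num

lemma heaviside_eventuallyEq {x a : ℝ} (h : x ≠ a) :
    ∀ᶠ y in 𝓝 x, heaviside (y - a) = heaviside (x - a) := by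
  rcases h.lt_or_gt with h | h
  · filter_upwards [gt_mem_nhds h] with y hy
    simp [heaviside, not_le.2 h, not_le.2 (show y < a from hy)]
  · filter_upwards [lt_mem_nhds h] with y hy
    simp [heaviside, h.le, (show a < y from hy).le]

namespace Network

lemma measurableSet_state_eq {S : Type*} [MeasurableSpace S] [MeasurableSingletonClass S] (s : S) :
    MeasurableSet {p : Link S | p.state = s} :=
  measurable_fst (measurableSet_singleton s)

variable {S : Type*} [Fintype S] (M : Network S)

/-! ### The derivative of the intensity of the path-losses -/

lemma hasDerivAt_rpow_div_kap (s : S) {x : ℝ} (hx : 0 < x) :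
    HasDerivAt (fun y => (y / M.kap s) ^ (2 / M.alp s))
      (2 / M.alp s * M.kap s ^ (-(2 / M.alp s)) * x ^ (2 / M.alp s - 1)) x := by
  have hk := M.kap_pos s
  refine (((hasDerivAt_id x).div_const (M.kap s)).rpow_const
    (Or.inl (div_pos hx hk).ne')).congr_deriv ?_
  simp only [id]
  rw [Real.div_rpow hx.le hk.le, Real.rpow_sub_one hk.ne', Real.rpow_neg hk.le]
  have := (Real.rpow_pos_of_pos hk (2 / M.alp s)).ne'
  have := (M.alp_pos s).ne'
  field_simp

/-- Away from the edges the Heaviside factors are locally constant, so only the power of `x` is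
differentiated. -/
lemma hasDerivAt_Lam (s : S) {x : ℝ} (hx : 0 < x) (hne : ∀ b, x ≠ M.edge s b) :
    HasDerivAt (M.Lam s) (M.LamDeriv s x) x := by
  have hp := M.hasDerivAt_rpow_div_kap s hx
  set C := Real.pi * M.lamBS * M.theta s with hC
  have hev : M.Lam s =ᶠ[𝓝 x] fun y =>
      C * (∑ b : Fin M.B, M.q s b.castSucc *
        (coHeaviside (x - M.edge s b.succ) * heaviside (x - M.edge s b.castSucc) *
          ((y / M.kap s) ^ (2 / M.alp s) - M.D b.castSucc ^ 2)))
      + C * (∑ b : Fin M.B, M.q s b.castSucc *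
        (heaviside (x - M.edge s b.succ) * (M.D b.succ ^ 2 - M.D b.castSucc ^ 2)))
      + C * M.q s (Fin.last M.B) * (heaviside (x - M.edge s (Fin.last M.B)) *
        ((y / M.kap s) ^ (2 / M.alp s) - M.D (Fin.last M.B) ^ 2)) := by
    filter_upwards [eventually_all.2 fun b => heaviside_eventuallyEq (hne b)] with y hy
    simp only [Lam, coHeaviside, hy, ← hC]
  refine HasDerivAt.congr_of_eventuallyEq ?_ hev
  refine ((((HasDerivAt.fun_sum fun b _ =>
    ((hp.sub_const _).const_mul _).const_mul _).const_mul C).add_const _).add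
    (((hp.sub_const _).const_mul _).const_mul _)).congr_deriv ?_
  rw [LamDeriv, ← hC, Finset.mul_sum, Finset.mul_sum]
  congr 1
  · exact Finset.sum_congr rfl fun b _ => by ring
  · ring

lemma LamDeriv_nonneg (s : S) {x : ℝ} (hx : 0 ≤ x) : 0 ≤ M.LamDeriv s x := by
  have h : 0 ≤ Real.pi * M.lamBS * M.theta s * (2 / M.alp s) * M.kap s ^ (-(2 / M.alp s)) *
      x ^ (2 / M.alp s - 1) :=
    mul_nonneg (mul_nonneg (mul_nonneg (M.planeCoeff_pos s).le
      (div_nonneg zero_le_two (M.alp_pos s).le)) (Real.rpow_nonneg (M.kap_pos s).le _))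
      (Real.rpow_nonneg hx _)
  exact add_nonneg (mul_nonneg h (Finset.sum_nonneg fun b _ => mul_nonneg (M.q_nonneg s _)
    (mul_nonneg (coHeaviside_nonneg _) (heaviside_nonneg _))))
    (mul_nonneg h (mul_nonneg (M.q_nonneg s _) (heaviside_nonneg _)))

lemma measurable_LamDeriv (s : S) : Measurable (M.LamDeriv s) := by
  have h1 : ∀ b, Measurable fun x => heaviside (x - M.edge s b) := fun b =>
    measurable_heaviside.comp (measurable_id.sub_const _)
  have h2 : ∀ b, Measurable fun x => coHeaviside (x - M.edge s b) := fun b =>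
    measurable_coHeaviside.comp (measurable_id.sub_const _)
  have h3 : Measurable fun x : ℝ => x ^ (2 / M.alp s - 1) := measurable_id.pow_const _
  exact ((h3.const_mul _).mul (Finset.measurable_sum _ fun b _ =>
    ((h2 _).mul (h1 _)).const_mul _)).add ((h3.const_mul _).mul ((h1 _).const_mul _))

/-- The Jacobian identity between path-loss and distance. It is checked on the densities themselves
and therefore holds at the ring edges too, where `Lam` need not be differentiable. -/
lemma LamDeriv_kap_mul_rpow (s : S) {r : ℝ} (hr : 0 < r) :
    M.kap s * M.alp s * r ^ (M.alp s - 1) * M.LamDeriv s (M.kap s * r ^ M.alp s) =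
      M.radialDensity s r := by
  have hk := M.kap_pos s
  have ha := M.alp_pos s
  have hx : 0 < M.kap s * r ^ M.alp s := mul_pos hk (Real.rpow_pos_of_pos hr _)
  have hR : M.radius s (M.kap s * r ^ M.alp s) = r := by
    rw [radius, mul_div_cancel_left₀ _ hk.ne', ← Real.rpow_mul hr.le,
      mul_one_div_cancel ha.ne', Real.rpow_one]
  have hst : M.stateProb s r = (∑ b : Fin M.B, M.q s b.castSucc *
      (coHeaviside (M.kap s * r ^ M.alp s - M.edge s b.succ) *
        heaviside (M.kap s * r ^ M.alp s - M.edge s b.castSucc))) +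
      M.q s (Fin.last M.B) * heaviside (M.kap s * r ^ M.alp s - M.edge s (Fin.last M.B)) := by
    rw [stateProb]
    simp only [M.heaviside_sub_edge s hx.le, M.coHeaviside_sub_edge s hx.le, hR]
    congr 1
    · refine Finset.sum_congr rfl fun b _ => ?_
      by_cases h1 : M.D b.castSucc ≤ r <;> by_cases h2 : M.D b.succ ≤ r <;>
        simp [h1, h2]
    · split_ifs <;> simp
  rw [LamDeriv, ← mul_add, ← hst, radialDensity]
  have h1 : (M.kap s * r ^ M.alp s) ^ (2 / M.alp s - 1) =
      M.kap s ^ (2 / M.alp s) / M.kap s * (r ^ 2 / r ^ M.alp s) := by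
    rw [Real.mul_rpow hk.le (Real.rpow_nonneg hr.le _), Real.rpow_sub_one hk.ne',
      ← Real.rpow_mul hr.le, mul_sub, mul_div_cancel₀ _ ha.ne', mul_one, Real.rpow_sub hr,
      Real.rpow_two]
  rw [h1, Real.rpow_neg hk.le, Real.rpow_sub_one hr.ne']
  have := (Real.rpow_pos_of_pos hk (2 / M.alp s)).ne'
  have := (Real.rpow_pos_of_pos hr (M.alp s)).ne'
  have := M.theta_pos s
  field_simp

lemma lintegral_radialDensity_comp (s : S) (G : ℝ → ℝ≥0∞) :
    ∫⁻ r in Ioi 0, ENNReal.ofReal (M.radialDensity s r) * G (M.kap s * r ^ M.alp s) =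
      ∫⁻ x in Ioi 0, ENNReal.ofReal (M.LamDeriv s x) * G x := by
  have hk := M.kap_pos s
  have ha := M.alp_pos s
  have himg : (fun r => M.kap s * r ^ M.alp s) '' Ioi 0 = Ioi 0 := by
    ext x
    constructor
    · rintro ⟨r, hr, rfl⟩
      exact mul_pos hk (Real.rpow_pos_of_pos hr _)
    · exact fun hx => ⟨M.radius s x, M.radius_pos s hx, M.kap_mul_radius_rpow s (le_of_lt hx)⟩
  have hinj : InjOn (fun r => M.kap s * r ^ M.alp s) (Ioi 0) := by
    intro r (hr : 0 < r) t (ht : 0 < t) h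
    exact (Real.rpow_left_inj hr.le ht.le ha.ne').1 (mul_left_cancel₀ hk.ne' h)
  have hder : ∀ r ∈ Ioi (0 : ℝ), HasDerivWithinAt (fun r => M.kap s * r ^ M.alp s)
      (M.kap s * M.alp s * r ^ (M.alp s - 1)) (Ioi 0) r := fun r (hr : 0 < r) =>
    ((((Real.hasDerivAt_rpow_const (p := M.alp s) (Or.inl hr.ne')).const_mul
      (M.kap s))).congr_deriv (by ring)).hasDerivWithinAt
  have h := lintegral_image_eq_lintegral_abs_deriv_mul measurableSet_Ioi hder hinj
    (fun x => ENNReal.ofReal (M.LamDeriv s x) * G x)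
  rw [himg] at h
  rw [h]
  refine setLIntegral_congr_fun measurableSet_Ioi fun r (hr : 0 < r) => ?_
  have hpos : 0 ≤ M.kap s * M.alp s * r ^ (M.alp s - 1) :=
    mul_nonneg (mul_pos hk ha).le (Real.rpow_nonneg hr.le _)
  rw [← mul_assoc, abs_of_nonneg hpos, ← ENNReal.ofReal_mul hpos, M.LamDeriv_kap_mul_rpow s hr]

lemma loss_nonneg (p : Link S) : 0 ≤ M.loss p :=
  mul_nonneg (M.kap_pos _).le (Real.rpow_nonneg (norm_nonneg _) _)

section Intensity

variable [MeasurableSpace S] [MeasurableSingletonClass S]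

lemma measurable_loss : Measurable M.loss := by
  refine measurable_from_prod_countable_right fun s => ?_
  have h : Measurable fun y : EuclideanSpace ℝ (Fin 2) × Bool × ℝ × ℝ × ℝ => ‖y.1‖ :=
    measurable_norm.comp measurable_fst
  exact (h.pow_const (M.alp s)).const_mul (M.kap s)

lemma lintegral_intensity_loss {g : S → ℝ → Bool × ℝ × ℝ × ℝ → ℝ≥0∞}
    (hg : ∀ s, Measurable (Function.uncurry (g s))) :
    ∫⁻ p : Link S, g p.1 (M.loss p) p.2.2 ∂M.intensity =
      ∑ s, ∫⁻ x in Ioi 0, ENNReal.ofReal (M.LamDeriv s x) * ∫⁻ w, g s x w ∂M.markLaw s := by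
  refine (M.lintegral_intensity (g := fun s r w => g s (M.kap s * r ^ M.alp s) w)
    fun s => ?_).trans (Finset.sum_congr rfl fun s _ => ?_)
  · exact (hg s).comp (((measurable_fst.pow_const _).const_mul _).prodMk measurable_snd)
  · exact M.lintegral_radialDensity_comp s fun x => ∫⁻ w, g s x w ∂M.markLaw s

lemma intensity_state_loss_lt (s : S) {x : ℝ} (hx : 0 ≤ x) :
    M.intensity {p | p.state = s ∧ M.loss p < x} = ENNReal.ofReal (M.Lam s x) := by
  classical
  have hms : MeasurableSet {p : Link S | p.state = s ∧ M.loss p < x} :=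
    (measurableSet_state_eq s).inter (measurableSet_lt M.measurable_loss measurable_const)
  rw [← lintegral_indicator_one hms]
  have h := M.lintegral_intensity_loss
    (g := fun s' y _ => if s' = s then if y < x then 1 else 0 else 0) fun s' => by
      by_cases hs : s' = s
      · simp only [hs, if_true]
        exact Measurable.ite (measurableSet_lt measurable_fst measurable_const)
          measurable_const measurable_const
      · simp only [hs, if_false]
        exact measurable_const
  refine Eq.trans (lintegral_congr fun p => ?_) (h.trans ?_)
  · change indicator {p : Link S | p.1 = s ∧ M.loss p < x} 1 p = _
    by_cases hs : p.1 = s <;> by_cases hy : M.loss p < x <;> simp [indicator, hs, hy]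
  · simp only [lintegral_const, measure_univ, mul_one]
    rw [Finset.sum_eq_single s]
    · simp only [if_true]
      rw [← M.lintegral_radialDensity_comp s fun y => if y < x then 1 else 0]
      exact (M.lintegral_radialDensity_lt s hx).2
    · intro s' _ hs
      simp [hs]
    · simp

lemma intensity_loss_lt {x : ℝ} (hx : 0 ≤ x) :
    M.intensity {p | M.loss p < x} = ENNReal.ofReal (∑ s, M.Lam s x) := by
  classical
  rw [ENNReal.ofReal_sum_of_nonneg fun s _ => M.Lam_nonneg s hx]
  simp_rw [← M.intensity_state_loss_lt _ hx]
  rw [← measure_biUnion_finset]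
  · congr 1
    ext p
    simp
  · intro s _ t _ hst
    exact Set.disjoint_left.2 fun p hp hp' => hst (hp.1.symm.trans hp'.1)
  · exact fun s _ => (measurableSet_state_eq s).inter
      (measurableSet_lt M.measurable_loss measurable_const)

lemma intensity_loss_eq (x : ℝ) : M.intensity {p | M.loss p = x} = 0 := by
  have hms : MeasurableSet {p : Link S | M.loss p = x} :=
    M.measurable_loss (measurableSet_singleton x)
  rw [← lintegral_indicator_one hms]
  refine Eq.trans (lintegral_congr fun p => ?_) ((M.lintegral_intensity_loss
    (g := fun _ y _ => indicator {x} 1 y) fun s =>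
      (measurable_one.indicator (measurableSet_singleton x)).comp measurable_fst).trans ?_)
  · simp [indicator]
  · refine Finset.sum_eq_zero fun s _ => ?_
    simp only [lintegral_const, measure_univ, mul_one]
    have h1 : ∀ᵐ y : ℝ, y ≠ x := by simp [ae_iff]
    refine lintegral_eq_zero_of_ae_eq_zero ?_
    filter_upwards [ae_restrict_of_ae h1] with y hy
    simp [indicator, hy]

lemma intensity_loss_le {x : ℝ} (hx : 0 ≤ x) :
    M.intensity {p | M.loss p ≤ x} = ENNReal.ofReal (∑ s, M.Lam s x) := by
  rw [← M.intensity_loss_lt hx]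
  refine le_antisymm ?_ (measure_mono fun p (hp : M.loss p < x) => hp.le)
  have : {p | M.loss p ≤ x} = {p | M.loss p < x} ∪ {p | M.loss p = x} := by
    ext p
    exact le_iff_lt_or_eq (a := M.loss p) (b := x)
  rw [this]
  refine (measure_union_le _ _).trans ?_
  rw [M.intensity_loss_eq, add_zero]

lemma intensity_loss_le_ne_top (x : ℝ) : M.intensity {p | M.loss p ≤ x} ≠ ∞ := by
  have h : M.intensity {p | M.loss p ≤ |x|} ≠ ∞ := by
    rw [M.intensity_loss_le (abs_nonneg x)]
    exact ENNReal.ofReal_ne_top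
  exact ne_top_of_le_ne_top h
    (measure_mono fun p (hp : M.loss p ≤ x) => hp.trans (le_abs_self x))

/-- Beyond the outermost radius some state has positive probability, since the probabilities add up
to 1. Its radial density is bounded below by a positive constant on a half-line. -/
lemma intensity_univ : M.intensity univ = ∞ := by
  obtain ⟨s, hs⟩ : ∃ s, 0 < M.q s (Fin.last M.B) := by
    by_contra! h
    have := M.q_sum (Fin.last M.B)
    have h2 : ∑ s, M.q s (Fin.last M.B) ≤ 0 := Finset.sum_nonpos fun s _ => h s
    linarith
  have h := M.lintegral_intensity (g := fun _ _ _ => 1) fun _ => measurable_const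
  simp only [lintegral_const, measure_univ, mul_one, one_mul] at h
  rw [h, ENNReal.sum_eq_top]
  refine ⟨s, Finset.mem_univ s, ?_⟩
  set c := Real.pi * M.lamBS * M.theta s * (M.q s (Fin.last M.B) * 2) with hc
  have hc0 : 0 < c := mul_pos (M.planeCoeff_pos s) (mul_pos hs two_pos)
  set a := max 1 (M.D (Fin.last M.B)) with ha
  have ha1 : 1 ≤ a := le_max_left _ _
  rw [← top_le_iff]
  calc ∞ = ∫⁻ _ in Ioi a, ENNReal.ofReal c := by
        rw [lintegral_const, Measure.restrict_apply_univ, Real.volume_Ioi, ENNReal.mul_top]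
        simpa using hc0
    _ ≤ ∫⁻ r in Ioi a, ENNReal.ofReal (M.radialDensity s r) := by
        refine setLIntegral_mono (M.measurable_radialDensity s).ennreal_ofReal
          fun r (hr : a < r) => ENNReal.ofReal_le_ofReal ?_
        have h1 : M.D (Fin.last M.B) ≤ r := (le_max_right _ _).trans hr.le
        have h2 : 1 ≤ r := ha1.trans hr.le
        have h3 : M.q s (Fin.last M.B) ≤ M.stateProb s r := by
          rw [stateProb, if_pos h1, le_add_iff_nonneg_left]
          exact Finset.sum_nonneg fun b _ => by split_ifs; exacts [M.q_nonneg s _, le_rfl]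
        have h4 := M.planeCoeff_pos s
        have h5 := M.q_nonneg s (Fin.last M.B)
        rw [hc, radialDensity]
        have h6 : M.q s (Fin.last M.B) * 2 ≤ M.stateProb s r * (2 * r) := by nlinarith
        gcongr
    _ ≤ ∫⁻ r in Ioi 0, ENNReal.ofReal (M.radialDensity s r) :=
        lintegral_mono_set (Ioi_subset_Ioi (by linarith))

end Intensity

/-! ### Averages over the marks -/

lemma mgfFading_nonneg (s : S) {u : ℝ} (hu : 0 ≤ u) : 0 ≤ M.mgfFading s u := by
  have := M.Om_pos s
  have := M.m_pos s
  exact Real.rpow_nonneg (by positivity) _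

lemma mgfFading_le_one (s : S) {u : ℝ} (hu : 0 ≤ u) : M.mgfFading s u ≤ 1 := by
  have := M.Om_pos s
  have := M.m_pos s
  refine Real.rpow_le_one_of_one_le_of_nonpos ?_ (by linarith)
  have : 0 ≤ u * M.Om s / M.m s := by positivity
  linarith

lemma lintegral_one_sub_exp_fadingLaw (s : S) {u : ℝ} (hu : 0 ≤ u) :
    ∫⁻ x, (1 - expNeg (ENNReal.ofReal (u * x))) ∂M.fadingLaw s =
      ENNReal.ofReal (1 - M.mgfFading s u) := by
  have hae : ∀ᵐ x ∂M.fadingLaw s, 0 ≤ x := ae_nonneg_gammaMeasure _ _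
  have h1 : ∀ᵐ x ∂M.fadingLaw s, expNeg (ENNReal.ofReal (u * x)) =
      ENNReal.ofReal (Real.exp (-(u * x))) := by
    filter_upwards [hae] with x hx
    rw [expNeg_ofReal (mul_nonneg hu hx)]
  have hm : Measurable fun x : ℝ => expNeg (ENNReal.ofReal (u * x)) :=
    measurable_expNeg.comp (measurable_id.const_mul u).ennreal_ofReal
  have h2 : ∫⁻ x, expNeg (ENNReal.ofReal (u * x)) ∂M.fadingLaw s =
      ENNReal.ofReal (M.mgfFading s u) := by
    rw [lintegral_congr_ae h1, M.lintegral_exp_fadingLaw s hu]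
  rw [lintegral_sub hm (by rw [h2]; exact ENNReal.ofReal_ne_top)
    (.of_forall fun x => expNeg_le_one _), h2, lintegral_one, measure_univ,
    ENNReal.ofReal_sub _ (M.mgfFading_nonneg s hu), ENNReal.ofReal_one]

lemma lintegral_markLaw_interference (s : S) {u : ℝ} (hu : 0 ≤ u) :
    ∫⁻ w, (if w.1 then 1 - expNeg (ENNReal.ofReal
        (u * (M.antBS.value w.2.1 * M.antMT.value w.2.2.1 * w.2.2.2))) else 0) ∂M.markLaw s =
      ENNReal.ofReal (1 - M.pOff) * ∑ i : Fin M.antBS.K, ∑ j : Fin M.antMT.K,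
        ENNReal.ofReal (M.antBS.width i / (2 * Real.pi)) *
          (ENNReal.ofReal (M.antMT.width j / (2 * Real.pi)) *
            ENNReal.ofReal (1 - M.mgfFading s (u * (M.antBS.gain i * M.antMT.gain j)))) := by
  have hB := M.antBS.measurable_value
  have hT := M.antMT.measurable_value
  have hm0 : Measurable fun v : ℝ × ℝ × ℝ => 1 - expNeg (ENNReal.ofReal
      (u * (M.antBS.value v.1 * M.antMT.value v.2.1 * v.2.2))) :=
    measurable_one_sub_expNeg.comp ((((hB.comp measurable_fst).mul
      (hT.comp measurable_snd.fst)).mul measurable_snd.snd).const_mul u).ennreal_ofReal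
  have hm1 : Measurable fun w : Bool × ℝ × ℝ × ℝ => if w.1 then 1 - expNeg (ENNReal.ofReal
      (u * (M.antBS.value w.2.1 * M.antMT.value w.2.2.1 * w.2.2.2))) else 0 :=
    Measurable.ite (measurable_fst (measurableSet_singleton true)) (hm0.comp measurable_snd)
      measurable_const
  rw [markLaw, lintegral_prod _ hm1.aemeasurable, M.lintegral_activeLaw]
  simp only [if_true, Bool.false_eq_true, if_false, lintegral_zero, mul_zero, add_zero]
  congr 1
  rw [lintegral_prod _ hm0.aemeasurable]
  have hsum : ∀ i, ∑ j : Fin M.antMT.K, ENNReal.ofReal (M.antBS.width i / (2 * Real.pi)) *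
      (ENNReal.ofReal (M.antMT.width j / (2 * Real.pi)) *
        ENNReal.ofReal (1 - M.mgfFading s (u * (M.antBS.gain i * M.antMT.gain j)))) =
      ENNReal.ofReal (M.antBS.width i / (2 * Real.pi)) * ∫⁻ θ, ENNReal.ofReal
        (1 - M.mgfFading s (u * (M.antBS.gain i * M.antMT.value θ))) ∂angleLaw := fun i => by
    rw [← Finset.mul_sum, M.antMT.lintegral_value (φ := fun t => ENNReal.ofReal
      (1 - M.mgfFading s (u * (M.antBS.gain i * t))))]
  simp_rw [hsum]
  rw [← M.antBS.lintegral_value (φ := fun t => ∫⁻ θ, ENNReal.ofReal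
    (1 - M.mgfFading s (u * (t * M.antMT.value θ))) ∂angleLaw)]
  refine lintegral_congr fun θ => ?_
  rw [lintegral_prod (fun y : ℝ × ℝ => 1 - expNeg (ENNReal.ofReal
    (u * (M.antBS.value θ * M.antMT.value y.1 * y.2))))
    (hm0.comp (measurable_prodMk_left (x := θ))).aemeasurable]
  refine lintegral_congr fun θ' => ?_
  rw [← M.lintegral_one_sub_exp_fadingLaw s (mul_nonneg hu
    (mul_nonneg (M.antBS.value_nonneg θ) (M.antMT.value_nonneg θ')))]
  simp only [mul_assoc]

lemma lintegral_markLaw_fading (s : S) {φ : ℝ → ℝ≥0∞} (hφ : Measurable φ) :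
    ∫⁻ w, φ w.2.2.2 ∂M.markLaw s = ∫⁻ x, φ x ∂M.fadingLaw s := by
  have h1 : Measurable fun v : ℝ × ℝ => φ v.2 := hφ.comp measurable_snd
  have h2 : Measurable fun v : ℝ × ℝ × ℝ => φ v.2.2 := h1.comp measurable_snd
  have h3 : Measurable fun v : Bool × ℝ × ℝ × ℝ => φ v.2.2.2 := h2.comp measurable_snd
  rw [markLaw, lintegral_prod _ h3.aemeasurable]
  simp only [lintegral_const, measure_univ, mul_one]
  rw [lintegral_prod _ h2.aemeasurable]
  simp only [lintegral_const, measure_univ, mul_one]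
  rw [lintegral_prod _ h1.aemeasurable]
  simp only [lintegral_const, measure_univ, mul_one]

/-! ### The exponent of the interference -/

/-- This supplies the tail function for the interference: each pair of lobes contributes a
hypergeometric tail integral, weighted by the probability of that pair and by the probability of
activity. -/
lemma lintegral_tail_fading (s : S) {x z t : ℝ} (hx : 0 < x) (hz : 0 ≤ z) (ht : 0 < t) :
    0 ≤ -((1 - M.pOff) * (t ^ 2 * M.hypF s (x * z / (M.kap s * t ^ M.alp s)))) ∧
    ∫⁻ r in Ioi t, ENNReal.ofReal (2 * r) *
      (ENNReal.ofReal (1 - M.pOff) * ∑ i : Fin M.antBS.K, ∑ j : Fin M.antMT.K,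
        ENNReal.ofReal (M.antBS.width i / (2 * Real.pi)) *
          (ENNReal.ofReal (M.antMT.width j / (2 * Real.pi)) *
            ENNReal.ofReal (1 - M.mgfFading s (z * x / (M.kap s * r ^ M.alp s) *
              (M.antBS.gain i * M.antMT.gain j))))) =
      ENNReal.ofReal (-((1 - M.pOff) *
        (t ^ 2 * M.hypF s (x * z / (M.kap s * t ^ M.alp s))))) := by
  have hk := M.kap_pos s
  have hm := M.m_pos s
  have hO := M.Om_pos s
  have hp : 0 ≤ 1 - M.pOff := sub_nonneg.2 M.pOff_le_one
  let c : Fin M.antBS.K → Fin M.antMT.K → ℝ := fun i j =>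
    z * x / M.kap s * (M.antBS.gain i * M.antMT.gain j) * (M.Om s / M.m s)
  have hc : ∀ i j, 0 ≤ c i j := fun i j => by
    have := M.antBS.gain_nonneg i
    have := M.antMT.gain_nonneg j
    simp only [c]
    positivity
  let H : Fin M.antBS.K → Fin M.antMT.K → ℝ := fun i j =>
    gaussHyp (M.m s) (-(2 / M.alp s)) (1 - 2 / M.alp s) (-(c i j * t ^ (-M.alp s)))
  have htail := fun i j => lintegral_tail_gaussHyp (M.alp_gt_two s) hm ht (hc i j)
  let wB : Fin M.antBS.K → ℝ := fun i => M.antBS.width i / (2 * Real.pi)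
  let wT : Fin M.antMT.K → ℝ := fun j => M.antMT.width j / (2 * Real.pi)
  have hwB : ∀ i, 0 ≤ wB i := fun i =>
    div_nonneg (M.antBS.width_nonneg i) (by positivity)
  have hwT : ∀ j, 0 ≤ wT j := fun j =>
    div_nonneg (M.antMT.width_nonneg j) (by positivity)
  have hval : -((1 - M.pOff) * (t ^ 2 * M.hypF s (x * z / (M.kap s * t ^ M.alp s)))) =
      (1 - M.pOff) * ∑ i, ∑ j, wB i * (wT j * (t ^ 2 * (H i j - 1))) := by
    have hH : M.hypF s (x * z / (M.kap s * t ^ M.alp s)) =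
        1 - ∑ i, ∑ j, wB i * wT j * H i j := by
      rw [hypF]
      congr 1
      refine Finset.sum_congr rfl fun i _ => Finset.sum_congr rfl fun j _ => ?_
      simp only [H, wB, wT, c, Real.rpow_neg ht.le]
      congr 3
      have := (Real.rpow_pos_of_pos ht (M.alp s)).ne'
      field_simp
    -- The lobe weights add up to 1, so the constant 1 in `hypF` can be distributed over the lobes.
    have hone : ∑ i, ∑ j, wB i * wT j = 1 := by
      simp_rw [← Finset.mul_sum]
      rw [← Finset.sum_mul, M.antBS.sum_width, M.antMT.sum_width, one_mul]
    have hexp : ∑ i, ∑ j, wB i * (wT j * (t ^ 2 * (H i j - 1))) =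
        t ^ 2 * (∑ i, ∑ j, wB i * wT j * H i j) - t ^ 2 * ∑ i, ∑ j, wB i * wT j := by
      rw [Finset.mul_sum, Finset.mul_sum, ← Finset.sum_sub_distrib]
      refine Finset.sum_congr rfl fun i _ => ?_
      rw [Finset.mul_sum, Finset.mul_sum, ← Finset.sum_sub_distrib]
      exact Finset.sum_congr rfl fun j _ => by ring
    rw [hH, hexp, hone]
    ring
  have hterm : ∀ i j, 0 ≤ wB i * (wT j * (t ^ 2 * (H i j - 1))) := fun i j =>
    mul_nonneg (hwB i) (mul_nonneg (hwT j) (mul_nonneg (sq_nonneg t) (htail i j).1))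
  rw [hval]
  refine ⟨mul_nonneg hp (Finset.sum_nonneg fun i _ => Finset.sum_nonneg fun j _ => hterm i j), ?_⟩
  rw [ENNReal.ofReal_mul hp,
    ENNReal.ofReal_sum_of_nonneg fun i _ => Finset.sum_nonneg fun j _ => hterm i j]
  simp_rw [ENNReal.ofReal_sum_of_nonneg fun j _ => hterm _ j]
  have hmeas : ∀ i j, Measurable fun r : ℝ =>
      ENNReal.ofReal (2 * r * (1 - (1 + c i j * r ^ (-M.alp s)) ^ (-M.m s))) := fun i j => by
    fun_prop
  have hint : ∀ r ∈ Ioi t, ENNReal.ofReal (2 * r) *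
      (ENNReal.ofReal (1 - M.pOff) * ∑ i : Fin M.antBS.K, ∑ j : Fin M.antMT.K,
        ENNReal.ofReal (wB i) * (ENNReal.ofReal (wT j) *
            ENNReal.ofReal (1 - M.mgfFading s (z * x / (M.kap s * r ^ M.alp s) *
              (M.antBS.gain i * M.antMT.gain j))))) =
      ENNReal.ofReal (1 - M.pOff) * ∑ i : Fin M.antBS.K, ∑ j : Fin M.antMT.K,
        ENNReal.ofReal (wB i) * (ENNReal.ofReal (wT j) *
          ENNReal.ofReal (2 * r * (1 - (1 + c i j * r ^ (-M.alp s)) ^ (-M.m s)))) := by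
    intro r (hr : t < r)
    have hr0 : 0 < r := ht.trans hr
    rw [mul_left_comm, Finset.mul_sum]
    simp_rw [Finset.mul_sum (a := ENNReal.ofReal (2 * r))]
    congr 1
    refine Finset.sum_congr rfl fun i _ => Finset.sum_congr rfl fun j _ => ?_
    rw [mul_left_comm, mul_left_comm (ENNReal.ofReal (2 * r)), ← ENNReal.ofReal_mul (by linarith)]
    congr 5
    rw [mgfFading, Real.rpow_neg hr0.le]
    congr 2
    simp only [c]
    have := (Real.rpow_pos_of_pos hr0 (M.alp s)).ne'
    field_simp
  rw [setLIntegral_congr_fun measurableSet_Ioi hint, lintegral_const_mul _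
    (Finset.measurable_sum _ fun i _ => Finset.measurable_sum _ fun j _ =>
      ((hmeas i j).const_mul _).const_mul _),
    lintegral_finsetSum _ fun i _ => Finset.measurable_sum _ fun j _ =>
      ((hmeas i j).const_mul _).const_mul _]
  congr 1
  refine Finset.sum_congr rfl fun i _ => ?_
  rw [lintegral_finsetSum _ fun j _ => ((hmeas i j).const_mul _).const_mul _]
  refine Finset.sum_congr rfl fun j _ => ?_
  rw [lintegral_const_mul _ ((hmeas i j).const_mul _), lintegral_const_mul _ (hmeas i j),
    (htail i j).2, ENNReal.ofReal_mul (hwB i), ENNReal.ofReal_mul (hwT j)]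

/-- At the radius of path-loss `x` the tail function involves `hypF` at `z`, at a ring edge `hypF`
at `x * z / edge`. The Heaviside factors of `T` select between these values as the maximum of the
two radii does. -/
lemma T_eq (s : S) (z : ℝ) {x : ℝ} (hx : 0 < x) {K : ℝ → ℝ} (hK : ∀ t, K t =
      -((1 - M.pOff) * (t ^ 2 * M.hypF s (x * z / (M.kap s * t ^ M.alp s))))) :
    -M.T s z x = Real.pi * M.lamBS * M.theta s * ((∑ b : Fin M.B, M.q s b.castSucc *
          (K (max (M.radius s x) (M.D b.castSucc)) - K (max (M.radius s x) (M.D b.succ))))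
        + M.q s (Fin.last M.B) * K (max (M.radius s x) (M.D (Fin.last M.B)))) := by
  set R := M.radius s x with hR
  have hKR : K R = -((1 - M.pOff) * (R ^ 2 * M.hypF s z)) := by
    rw [hK, M.kap_mul_radius_rpow s hx.le, mul_div_cancel_left₀ _ hx.ne']
  have hKD : ∀ b, K (M.D b) =
      -((1 - M.pOff) * (M.D b ^ 2 * M.hypF s (x * z / M.edge s b))) := fun b => hK _
  rw [T, ← M.radius_sq s hx.le, ← hR, mul_assoc _ (R ^ 2), mul_assoc _ (R ^ 2 * _),
    mul_assoc _ (M.q s (Fin.last M.B)), ← mul_add, ← mul_add, lamI, ← mul_neg,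
    mul_left_comm Real.pi, mul_assoc (1 - M.pOff), mul_assoc (1 - M.pOff), mul_left_comm]
  congr 1
  rw [neg_add, mul_add]
  congr 1
  · rw [Finset.mul_sum, ← Finset.sum_add_distrib, ← Finset.sum_neg_distrib, Finset.mul_sum]
    refine Finset.sum_congr rfl fun b _ => ?_
    rw [M.heaviside_sub_edge s hx.le, M.coHeaviside_sub_edge s hx.le,
      M.coHeaviside_sub_edge s hx.le, ← hR]
    have := M.D_castSucc_le b
    split_ifs with h1 h2 h2
    · rw [max_eq_left h1, max_eq_left h2]; ring
    · exact absurd (this.trans h1) h2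
    · rw [max_eq_right (le_of_not_ge h1), max_eq_left h2, hKR, hKD]; ring
    · rw [max_eq_right (le_of_not_ge h1), max_eq_right (le_of_not_ge h2), hKD, hKD]; ring
  · rw [M.heaviside_sub_edge s hx.le, M.coHeaviside_sub_edge s hx.le, ← hR]
    split_ifs with h1
    · rw [max_eq_left h1, hKR]; ring
    · rw [max_eq_right (le_of_not_ge h1), hKD]; ring

/-- Power received from an interfering link, `0` if the base station is inactive. -/
def interferencePower (p : Link S) : ℝ≥0∞ :=
  if p.active then ENNReal.ofReal (M.powRB * M.gainI p * p.fading / M.loss p) else 0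

lemma interferencePower_ne_top (p : Link S) : M.interferencePower p ≠ ∞ := by
  unfold interferencePower
  split_ifs <;> simp

lemma interferenceExponent_state (s : S) {x z : ℝ} (hx : 0 < x) (hz : 0 ≤ z) :
    0 ≤ -M.T s z x ∧
    ∫⁻ r in Ioi 0, ENNReal.ofReal (M.radialDensity s r) *
      ∫⁻ w, (if M.kap s * r ^ M.alp s ≤ x then 0 else if w.1 then 1 - expNeg (ENNReal.ofReal
        (z * x / (M.kap s * r ^ M.alp s) *
          (M.antBS.value w.2.1 * M.antMT.value w.2.2.1 * w.2.2.2))) else 0) ∂M.markLaw s =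
      ENNReal.ofReal (-M.T s z x) := by
  set R := M.radius s x with hR
  have hR0 : 0 < R := M.radius_pos s hx
  let ψ : ℝ → ℝ≥0∞ := fun r => ENNReal.ofReal (2 * r) *
      (ENNReal.ofReal (1 - M.pOff) * ∑ i : Fin M.antBS.K, ∑ j : Fin M.antMT.K,
        ENNReal.ofReal (M.antBS.width i / (2 * Real.pi)) *
          (ENNReal.ofReal (M.antMT.width j / (2 * Real.pi)) *
            ENNReal.ofReal (1 - M.mgfFading s (z * x / (M.kap s * r ^ M.alp s) *
              (M.antBS.gain i * M.antMT.gain j)))))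
  have hψ : Measurable ψ := by
    unfold ψ mgfFading
    fun_prop
  obtain ⟨hn, he⟩ := M.lintegral_stateProb_mul s hψ
    (fun t ht => (M.lintegral_tail_fading s hx hz (hR0.trans_le ht)).2)
    (fun t ht => (M.lintegral_tail_fading s hx hz (hR0.trans_le ht)).1)
  rw [M.T_eq s z hx (K := fun t =>
    -((1 - M.pOff) * (t ^ 2 * M.hypF s (x * z / (M.kap s * t ^ M.alp s))))) fun t => rfl]
  refine ⟨mul_nonneg (M.planeCoeff_pos s).le hn, ?_⟩
  rw [ENNReal.ofReal_mul (M.planeCoeff_pos s).le, ← he,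
    ← lintegral_const_mul (ENNReal.ofReal (Real.pi * M.lamBS * M.theta s))
      (f := fun r => ENNReal.ofReal (M.stateProb s r) * ψ r)
      ((M.measurable_stateProb s).ennreal_ofReal.mul hψ),
    ← lintegral_indicator measurableSet_Ioi, ← lintegral_indicator measurableSet_Ioi]
  refine lintegral_congr fun r => ?_
  simp only [indicator, mem_Ioi]
  by_cases hr : 0 < r
  · rw [if_pos hr]
    simp only [M.kap_mul_rpow_le_iff s hr.le hx.le, ← hR]
    by_cases hrR : r ≤ R
    · rw [if_neg (not_lt.2 hrR)]
      simp [hrR]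
    · rw [if_pos (not_le.1 hrR)]
      simp only [hrR, if_false]
      have hpos := mul_pos (M.kap_pos s) (Real.rpow_pos_of_pos hr (M.alp s))
      rw [M.lintegral_markLaw_interference s (by positivity), radialDensity,
        ENNReal.ofReal_mul (M.planeCoeff_pos s).le, ENNReal.ofReal_mul (M.stateProb_nonneg s r),
        mul_assoc (ENNReal.ofReal _), mul_assoc (ENNReal.ofReal (M.stateProb s r))]
  · rw [if_neg hr, if_neg fun h => hr (hR0.trans h)]

lemma sum_T_nonpos {x z : ℝ} (hx : 0 < x) (hz : 0 ≤ z) : ∑ s, M.T s z x ≤ 0 :=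
  Finset.sum_nonpos fun s _ => by linarith [(M.interferenceExponent_state s hx hz).1]

lemma measurable_gainI [MeasurableSpace S] : Measurable M.gainI :=
  (M.antBS.measurable_value.comp measurable_snd.snd.snd.fst).mul
    (M.antMT.measurable_value.comp measurable_snd.snd.snd.snd.fst)

section Intensity

variable [MeasurableSpace S] [MeasurableSingletonClass S]

lemma measurable_interferencePower : Measurable M.interferencePower := by
  refine Measurable.ite (measurable_snd.snd.fst (measurableSet_singleton true)) ?_
    measurable_const
  exact (((M.measurable_gainI.const_mul _).mul measurable_snd.snd.snd.snd.snd).div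
    M.measurable_loss).ennreal_ofReal

/-- Campbell's exponent of the interference. -/
lemma lintegral_interferenceExponent {x z : ℝ} (hx : 0 < x) (hz : 0 ≤ z) :
    ∫⁻ p, (if M.loss p ≤ x then 0 else 1 - expNeg (ENNReal.ofReal (z / M.powRB) *
      (ENNReal.ofReal x * M.interferencePower p))) ∂M.intensity =
      ENNReal.ofReal (-∑ s, M.T s z x) := by
  rw [← Finset.sum_neg_distrib,
    ENNReal.ofReal_sum_of_nonneg fun s _ => (M.interferenceExponent_state s hx hz).1]
  simp_rw [← (M.interferenceExponent_state _ hx hz).2]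
  rw [← M.lintegral_intensity (g := fun s r w => if M.kap s * r ^ M.alp s ≤ x then 0 else
    if w.1 then 1 - expNeg (ENNReal.ofReal (z * x / (M.kap s * r ^ M.alp s) *
      (M.antBS.value w.2.1 * M.antMT.value w.2.2.1 * w.2.2.2))) else 0)]
  · refine lintegral_congr fun p => ?_
    have hP := M.powRB_pos
    change (if M.loss p ≤ x then 0 else _) = if M.loss p ≤ x then 0 else _
    split_ifs with h1 h2
    · rfl
    · have h2' : p.active = true := h2
      rw [interferencePower, if_pos h2', ← ENNReal.ofReal_mul hx.le,
        ← ENNReal.ofReal_mul (by positivity)]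
      congr 3
      change z / M.powRB * (x * (M.powRB * M.gainI p * p.fading / M.loss p)) =
        z * x / M.loss p * (M.gainI p * p.fading)
      have hl : M.loss p ≠ 0 := (hx.trans (not_le.1 h1)).ne'
      field_simp
    · have h2' : ¬ p.active = true := h2
      rw [interferencePower, if_neg h2']
      simp
  · intro s
    have hk : Measurable fun v : ℝ × Bool × ℝ × ℝ × ℝ => M.kap s * v.1 ^ M.alp s :=
      (measurable_fst.pow_const _).const_mul _
    refine Measurable.ite (measurableSet_le hk measurable_const) measurable_const ?_
    refine Measurable.ite (measurable_snd.fst (measurableSet_singleton true)) ?_ measurable_const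
    refine measurable_one_sub_expNeg.comp (Measurable.ennreal_ofReal ?_)
    exact (hk.const_div _).mul (((M.antBS.measurable_value.comp measurable_snd.snd.fst).mul
      (M.antMT.measurable_value.comp measurable_snd.snd.snd.fst)).mul measurable_snd.snd.snd.snd)

end Intensity

/-- A crude power bound, with all Heaviside factors replaced by 1. It serves both at large
path-loss, for finite mean interference, and at small path-loss, for integrability of the rate. -/
lemma exists_LamDeriv_le (s : S) :
    ∃ C, 0 ≤ C ∧ ∀ x, 0 < x → M.LamDeriv s x ≤ C * x ^ (2 / M.alp s - 1) := by
  set c := Real.pi * M.lamBS * M.theta s * (2 / M.alp s) * M.kap s ^ (-(2 / M.alp s)) with hc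
  have hc0 : 0 ≤ c := mul_nonneg (mul_nonneg (M.planeCoeff_pos s).le
    (div_nonneg zero_le_two (M.alp_pos s).le)) (Real.rpow_nonneg (M.kap_pos s).le _)
  have hh : ∀ y, heaviside y ≤ 1 := fun y => by unfold heaviside; split_ifs <;> norm_num
  have hch : ∀ y, coHeaviside y ≤ 1 := fun y => by
    unfold coHeaviside; linarith [heaviside_nonneg y]
  refine ⟨c * ((∑ b : Fin M.B, M.q s b.castSucc) + M.q s (Fin.last M.B)),
    mul_nonneg hc0 (add_nonneg (Finset.sum_nonneg fun b _ => M.q_nonneg s _) (M.q_nonneg s _)),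
    fun x hx => ?_⟩
  rw [LamDeriv, ← hc, ← mul_add, mul_right_comm c (_ + _)]
  refine mul_le_mul_of_nonneg_left (add_le_add (Finset.sum_le_sum fun b _ => ?_) ?_) ?_
  · exact mul_le_of_le_one_right (M.q_nonneg s _)
      (mul_le_one₀ (hch _) (heaviside_nonneg _) (hh _))
  · exact mul_le_of_le_one_right (M.q_nonneg s _) (hh _)
  · exact mul_nonneg hc0 (Real.rpow_nonneg hx.le _)

lemma interferencePower_le {x : ℝ} (hx : 0 < x) (p : Link S) (hp : x < M.loss p) :
    M.interferencePower p ≤ ENNReal.ofReal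
      (M.powRB * ((∑ i, M.antBS.gain i) * ∑ j, M.antMT.gain j) / M.loss p) *
        ENNReal.ofReal p.fading := by
  unfold interferencePower
  split_ifs
  · have hl := hx.trans hp
    have hB := M.antBS.value_nonneg p.angleBS
    have hT := M.antMT.value_nonneg p.angleMT
    have hB' := M.antBS.value_le p.angleBS
    have hT' := M.antMT.value_le p.angleMT
    have hP := M.powRB_pos
    rw [← ENNReal.ofReal_mul (div_nonneg (mul_nonneg hP.le
      (mul_nonneg (hB.trans hB') (hT.trans hT'))) hl.le)]
    rcases le_or_gt p.fading 0 with hf | hf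
    · rw [ENNReal.ofReal_of_nonpos]
      · exact zero_le
      · exact div_nonpos_of_nonpos_of_nonneg (mul_nonpos_of_nonneg_of_nonpos
          (mul_nonneg hP.le (mul_nonneg hB hT)) hf) hl.le
    · refine ENNReal.ofReal_le_ofReal ?_
      have hB0 := hB.trans hB'
      rw [div_mul_eq_mul_div, gainI]
      gcongr
  · exact zero_le

section Intensity

variable [MeasurableSpace S]

lemma setLIntegral_interferencePower (c : Measure (Link S)) (x : ℝ) :
    M.interference c x = ∫⁻ p in {p | x < M.loss p}, M.interferencePower p ∂c := by
  have hm : MeasurableSet {p : Link S | p.active = true} :=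
    measurable_snd.snd.fst (measurableSet_singleton true)
  have h : M.interferencePower = {p : Link S | p.active = true}.indicator fun p =>
      ENNReal.ofReal (M.powRB * M.gainI p * p.fading / M.loss p) := by
    ext p
    simp only [interferencePower, indicator, mem_ofPred_eq]
  rw [h, setLIntegral_indicator hm]
  rfl

variable [MeasurableSingletonClass S]

lemma measurableSet_lt_loss (x : ℝ) : MeasurableSet {p : Link S | x < M.loss p} :=
  measurableSet_lt measurable_const M.measurable_loss

/-- The mean interference is at most a constant times ∫_x^∞ y^{2/α-1} y^{-1} dy, summed over states;
it is finite because α > 2. -/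
lemma lintegral_interferencePower_ne_top {x : ℝ} (hx : 0 < x) :
    ∫⁻ p in {p | x < M.loss p}, M.interferencePower p ∂M.intensity ≠ ∞ := by
  set c := M.powRB * ((∑ i, M.antBS.gain i) * ∑ j, M.antMT.gain j) with hc
  have hc0 : 0 ≤ c := mul_nonneg M.powRB_pos.le (mul_nonneg
    (Finset.sum_nonneg fun i _ => M.antBS.gain_nonneg i)
    (Finset.sum_nonneg fun j _ => M.antMT.gain_nonneg j))
  let φ : ℝ → ℝ≥0∞ := (Ioi x).indicator fun y => ENNReal.ofReal (c / y)
  have hφ : Measurable φ := Measurable.indicator (by fun_prop) measurableSet_Ioi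
  have h1 : ∫⁻ p in {p | x < M.loss p}, M.interferencePower p ∂M.intensity ≤
      ∫⁻ p, φ (M.loss p) * ENNReal.ofReal p.2.2.2.2.2 ∂M.intensity := by
    rw [← lintegral_indicator (M.measurableSet_lt_loss x)]
    refine lintegral_mono fun p => ?_
    by_cases hp : x < M.loss p
    · rw [indicator_of_mem (by exact hp)]
      simp only [φ, indicator, mem_Ioi, hp, if_true]
      exact M.interferencePower_le hx p hp
    · rw [indicator_of_notMem (by exact hp)]
      exact zero_le
  have h2 := M.lintegral_intensity_loss (g := fun _ y w => φ y * ENNReal.ofReal w.2.2.2)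
    fun s => (hφ.comp measurable_fst).mul measurable_snd.snd.snd.snd.ennreal_ofReal
  refine ne_top_of_le_ne_top ?_ (h1.trans_eq h2)
  rw [ENNReal.sum_ne_top]
  intro s _
  have hfad : ∀ y, ∫⁻ w, φ y * ENNReal.ofReal w.2.2.2 ∂M.markLaw s =
      φ y * ENNReal.ofReal (M.Om s) := fun y => by
    rw [lintegral_const_mul _ measurable_snd.snd.snd.ennreal_ofReal,
      M.lintegral_markLaw_fading s ENNReal.measurable_ofReal, M.lintegral_ofReal_fadingLaw]
  simp_rw [hfad]
  obtain ⟨C, hC, hle⟩ := M.exists_LamDeriv_le s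
  have hδ : 2 / M.alp s < 1 := by
    rw [div_lt_one (M.alp_pos s)]
    exact M.alp_gt_two s
  have hi : IntegrableOn (fun y : ℝ => C * c * M.Om s * y ^ (2 / M.alp s - 2)) (Ioi x) :=
    (integrableOn_Ioi_rpow_of_lt (by linarith) hx).const_mul _
  refine ne_top_of_le_ne_top hi.lintegral_lt_top.ne ?_
  rw [← lintegral_indicator measurableSet_Ioi, ← lintegral_indicator measurableSet_Ioi]
  refine lintegral_mono fun y => ?_
  by_cases hy : x < y
  · have hy0 := hx.trans hy
    simp only [φ, indicator, mem_Ioi, hy, hy0, if_true]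
    have hO := M.Om_pos s
    rw [← ENNReal.ofReal_mul (by positivity), ← ENNReal.ofReal_mul (M.LamDeriv_nonneg s hy0.le)]
    refine ENNReal.ofReal_le_ofReal ?_
    calc M.LamDeriv s y * (c / y * M.Om s)
        ≤ C * y ^ (2 / M.alp s - 1) * (c / y * M.Om s) := by
          gcongr
          exact hle y hy0
      _ = C * c * M.Om s * y ^ (2 / M.alp s - 2) := by
          have : y ^ (2 / M.alp s - 2) = y ^ (2 / M.alp s - 1) / y := by
            rw [← Real.rpow_sub_one hy0.ne']
            ring_nf
          rw [this]
          ring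
  · simp [φ, indicator, hy]

variable {Ω : Type*} [MeasurableSpace Ω] {P : Measure Ω}
  {η : Ω → Measure (Link S)}

lemma measurable_interference (hη : IsPoissonPointProcess P M.intensity η) (x : ℝ) :
    Measurable fun ω => M.interference (η ω) x := by
  simp_rw [M.setLIntegral_interferencePower]
  exact hη.measurable_setLIntegral M.measurable_interferencePower (M.measurableSet_lt_loss x)

lemma ae_interference_ne_top (hη : IsPoissonPointProcess P M.intensity η) {x : ℝ} (hx : 0 < x) :
    ∀ᵐ ω ∂P, M.interference (η ω) x ≠ ∞ := by
  refine (ae_lt_top (M.measurable_interference hη x) ?_).mono fun ω h => h.ne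
  have h := hη.lintegral_lintegral
    (M.measurable_interferencePower.indicator (M.measurableSet_lt_loss x))
  simp_rw [lintegral_indicator (M.measurableSet_lt_loss x)] at h
  simp_rw [M.setLIntegral_interferencePower, h]
  exact M.lintegral_interferencePower_ne_top hx

lemma integral_exp_neg_interference [IsProbabilityMeasure P]
    (hη : IsPoissonPointProcess P M.intensity η) {x z : ℝ} (hx : 0 < x) (hz : 0 ≤ z) :
    ∫ ω, Real.exp (-(z * x / M.powRB * (M.interference (η ω) x).toReal)) ∂P =
      Real.exp (∑ r, M.T r z x) := by
  have hP := M.powRB_pos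
  have hmi := M.measurable_interferencePower
  have hml : MeasurableSet {p : Link S | M.loss p ≤ x} :=
    measurableSet_le M.measurable_loss measurable_const
  have hmeas : Measurable fun ω =>
      Real.exp (-(z * x / M.powRB * (M.interference (η ω) x).toReal)) :=
    ((M.measurable_interference hη x).ennreal_toReal.const_mul _).neg.exp
  rw [integral_eq_lintegral_of_nonneg_ae (.of_forall fun ω => (Real.exp_pos _).le)
    hmeas.aestronglyMeasurable]
  have h1 : ∫⁻ ω, ENNReal.ofReal
      (Real.exp (-(z * x / M.powRB * (M.interference (η ω) x).toReal))) ∂P =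
      ∫⁻ ω, expNeg (∫⁻ p, (if M.loss p ≤ x then 0 else ENNReal.ofReal (z / M.powRB) *
        (ENNReal.ofReal x * M.interferencePower p)) ∂η ω) ∂P := by
    refine lintegral_congr_ae ?_
    filter_upwards [M.ae_interference_ne_top hη hx] with ω hω
    have e : ∫⁻ p, (if M.loss p ≤ x then 0 else ENNReal.ofReal (z / M.powRB) *
        (ENNReal.ofReal x * M.interferencePower p)) ∂η ω =
        ENNReal.ofReal (z * x / M.powRB) * M.interference (η ω) x := by
      rw [M.setLIntegral_interferencePower, ← lintegral_indicator (M.measurableSet_lt_loss x),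
        ← lintegral_const_mul _ (hmi.indicator (M.measurableSet_lt_loss x))]
      refine lintegral_congr fun p => ?_
      by_cases hp : M.loss p ≤ x
      · simp [indicator, hp, not_lt.2 hp]
      · simp only [hp, if_false, indicator, mem_ofPred_eq, not_le.1 hp, if_true]
        rw [← mul_assoc, ← ENNReal.ofReal_mul (by positivity), div_mul_eq_mul_div]
    rw [e, expNeg_of_ne_top (ENNReal.mul_ne_top ENNReal.ofReal_ne_top hω), ENNReal.toReal_mul,
      ENNReal.toReal_ofReal (by positivity)]
  rw [h1, hη.lintegral_expNeg
    (Measurable.ite hml measurable_const ((hmi.const_mul _).const_mul _))]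
  have h2 := M.lintegral_interferenceExponent hx hz
  have h3 : ∫⁻ p, (1 - expNeg (if M.loss p ≤ x then 0 else ENNReal.ofReal (z / M.powRB) *
        (ENNReal.ofReal x * M.interferencePower p))) ∂M.intensity =
      ENNReal.ofReal (-∑ s, M.T s z x) := by
    rw [← h2]
    refine lintegral_congr fun p => ?_
    split_ifs <;> simp
  rw [h3, expNeg_ofReal (by linarith [M.sum_T_nonpos hx hz]), neg_neg,
    ENNReal.toReal_ofReal (Real.exp_pos _).le]

lemma ae_hasLowestPoint [IsProbabilityMeasure P]
    (hη : IsPoissonPointProcess P M.intensity η) : ∀ᵐ ω ∂P, HasLowestPoint M.loss (η ω) :=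
  hη.ae_hasLowestPoint M.measurable_loss M.loss_nonneg M.intensity_loss_le_ne_top
    M.intensity_loss_eq M.intensity_univ

end Intensity

end Network

/-! ### Frullani's representation of the logarithm -/

lemma lintegral_exp_neg_mul_Ioi {t : ℝ} (ht : 0 < t) :
    ∫⁻ z in Ioi (0 : ℝ), ENNReal.ofReal (Real.exp (-t * z)) = ENNReal.ofReal t⁻¹ := by
  rw [← ofReal_integral_eq_lintegral_ofReal (integrableOn_exp_mul_Ioi (neg_neg_of_pos ht) 0)
    (.of_forall fun z => (Real.exp_pos _).le), integral_exp_mul_Ioi (neg_neg_of_pos ht)]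
  congr 1
  simp [neg_div_neg_eq]

lemma lintegral_exp_neg_mul_Ioc {a b z : ℝ} (hab : a ≤ b) (hz : 0 < z) :
    ∫⁻ t in Ioc a b, ENNReal.ofReal (Real.exp (-t * z)) =
      ENNReal.ofReal ((Real.exp (-(z * a)) - Real.exp (-(z * b))) * z⁻¹) := by
  have hd : ∀ t : ℝ, HasDerivAt (fun t => -(Real.exp (-(z * t)) * z⁻¹)) (Real.exp (-t * z)) t :=
    fun t => (((((hasDerivAt_id t).const_mul z).neg.exp).mul_const z⁻¹).neg).congr_deriv (by
      simp only [id, Pi.neg_apply]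
      field_simp)
  have hc : Continuous fun t : ℝ => Real.exp (-t * z) := by fun_prop
  rw [← ofReal_integral_eq_lintegral_ofReal (hc.integrableOn_Icc.mono_set Ioc_subset_Icc_self)
    (.of_forall fun z => (Real.exp_pos _).le), ← intervalIntegral.integral_of_le hab,
    intervalIntegral.integral_eq_sub_of_hasDerivAt (fun t _ => hd t) (hc.intervalIntegrable _ _)]
  congr 1
  ring

/-- The integrand is ∫ e^{-tz} dt over (v, v + u]. Exchanging the integrals leaves ∫ dt/t. -/
lemma lintegral_log_one_add_div {u v : ℝ} (hu : 0 ≤ u) (hv : 0 < v) :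
    ∫⁻ z in Ioi (0 : ℝ), ENNReal.ofReal ((1 - Real.exp (-(z * u))) * Real.exp (-(z * v)) * z⁻¹) =
      ENNReal.ofReal (Real.log (1 + u / v)) := by
  have huv : v ≤ v + u := by linarith
  have hm : Measurable (Function.uncurry fun z t : ℝ => ENNReal.ofReal (Real.exp (-t * z))) := by
    fun_prop
  calc ∫⁻ z in Ioi (0 : ℝ),
        ENNReal.ofReal ((1 - Real.exp (-(z * u))) * Real.exp (-(z * v)) * z⁻¹)
      = ∫⁻ z in Ioi (0 : ℝ), ∫⁻ t in Ioc v (v + u), ENNReal.ofReal (Real.exp (-t * z)) := by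
        refine setLIntegral_congr_fun measurableSet_Ioi fun z (hz : 0 < z) => ?_
        rw [lintegral_exp_neg_mul_Ioc huv hz]
        congr 2
        rw [mul_add, neg_add, Real.exp_add]
        ring
    _ = ∫⁻ t in Ioc v (v + u), ∫⁻ z in Ioi (0 : ℝ), ENNReal.ofReal (Real.exp (-t * z)) :=
        lintegral_lintegral_swap hm.aemeasurable
    _ = ∫⁻ t in Ioc v (v + u), ENNReal.ofReal t⁻¹ :=
        setLIntegral_congr_fun measurableSet_Ioc fun t ht =>
          lintegral_exp_neg_mul_Ioi (hv.trans ht.1)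
    _ = ENNReal.ofReal (Real.log (1 + u / v)) := by
        have hc : ContinuousOn (fun t : ℝ => t⁻¹) (Icc v (v + u)) :=
          continuousOn_id.inv₀ fun t ht => (hv.trans_le ht.1).ne'
        rw [← ofReal_integral_eq_lintegral_ofReal
          (hc.integrableOn_Icc.mono_set Ioc_subset_Icc_self)
          ((ae_restrict_iff' measurableSet_Ioc).2 (.of_forall fun t ht =>
            inv_nonneg.2 (hv.trans ht.1).le)), ← intervalIntegral.integral_of_le huv,
          integral_inv_of_pos hv (by linarith), add_div, div_self hv.ne']

lemma lintegral_rpow_mul_exp_neg_mul {a r : ℝ} (ha : 0 < a) (hr : 0 < r) :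
    ∫⁻ t in Ioi (0 : ℝ), ENNReal.ofReal (t ^ (a - 1) * Real.exp (-(r * t))) =
      ENNReal.ofReal ((1 / r) ^ a * Real.Gamma a) := by
  have h := Real.integral_rpow_mul_exp_neg_mul_Ioi ha hr
  have h0 : 0 < (1 / r) ^ a * Real.Gamma a :=
    mul_pos (Real.rpow_pos_of_pos (by positivity) _) (Real.Gamma_pos_of_pos ha)
  rw [← h, ofReal_integral_eq_lintegral_ofReal (Integrable.of_integral_ne_zero (by
    rw [h]; exact h0.ne')) ((ae_restrict_iff' measurableSet_Ioi).2 (.of_forall fun t ht =>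
      mul_nonneg (Real.rpow_nonneg (le_of_lt ht) _) (Real.exp_pos _).le))]

lemma min_one_le_rpow {t ε : ℝ} (ht : 0 < t) (h0 : 0 ≤ ε) (h1 : ε ≤ 1) : min 1 t ≤ t ^ ε := by
  rcases le_or_gt t 1 with h | h
  · rw [min_eq_right h]
    simpa using Real.rpow_le_rpow_of_exponent_ge ht h h1
  · rw [min_eq_left h.le]
    exact Real.one_le_rpow h.le h0

namespace Network

variable {S : Type*} [Fintype S] (M : Network S)

/-! ### The density of the rate -/

/-- The quantity is at most 1 and, by 1 - e^{-t} ≤ t, at most the mean `Om s * z`. Interpolating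
between the two gives every power in [0, 1]. -/
lemma one_sub_mgfFading_le (s : S) {z : ℝ} (hz : 0 < z) {ε : ℝ} (h0 : 0 ≤ ε) (h1 : ε ≤ 1) :
    1 - M.mgfFading s z ≤ (M.Om s * z) ^ ε := by
  have hO := M.Om_pos s
  refine le_trans (le_min (by linarith [M.mgfFading_nonneg s hz.le]) ?_)
    (min_one_le_rpow (mul_pos hO hz) h0 h1)
  rw [← ENNReal.ofReal_le_ofReal_iff (mul_pos hO hz).le,
    ← M.lintegral_one_sub_exp_fadingLaw s hz.le]
  calc ∫⁻ x, (1 - expNeg (ENNReal.ofReal (z * x))) ∂M.fadingLaw s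
      ≤ ∫⁻ x, ENNReal.ofReal z * ENNReal.ofReal x ∂M.fadingLaw s := by
        refine lintegral_mono fun x => (one_sub_expNeg_le _).trans_eq ?_
        rw [ENNReal.ofReal_mul hz.le]
    _ = ENNReal.ofReal (M.Om s * z) := by
        rw [lintegral_const_mul _ ENNReal.measurable_ofReal, M.lintegral_ofReal_fadingLaw,
          ← ENNReal.ofReal_mul hz.le, mul_comm]

lemma measurable_mgfFading (s : S) : Measurable (M.mgfFading s) := by
  unfold mgfFading
  fun_prop

lemma mgfInterference_le_one {x z : ℝ} (hx : 0 < x) (hz : 0 ≤ z) : M.mgfInterference z x ≤ 1 :=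
  Real.exp_le_one_iff.2 (M.sum_T_nonpos hx hz)

lemma servingDensity_nonneg (s : S) {x : ℝ} (hx : 0 < x) : 0 ≤ M.servingDensity s x :=
  mul_nonneg (M.LamDeriv_nonneg s hx.le) (Real.exp_pos _).le

lemma integrand_nonneg (s : S) {x z : ℝ} (hx : 0 < x) (hz : 0 < z) : 0 ≤ M.integrand s x z :=
  div_nonneg (mul_nonneg (mul_nonneg (mul_nonneg (Real.exp_pos _).le (Real.exp_pos _).le)
    (sub_nonneg.2 (M.mgfFading_le_one s hz.le))) (M.servingDensity_nonneg s hx)) hz.le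

/-- The exponent 1/α is a compromise. It must be positive for 1/z to become integrable at 0, and
smaller than 2/α because the z-integral then costs x^{-1/α} against a density of order x^{2/α-1}. -/
lemma integrand_le (s : S) {x z : ℝ} (hx : 0 < x) (hz : 0 < z) :
    M.integrand s x z ≤ M.Om s ^ (1 / M.alp s) * M.servingDensity s x *
      (z ^ (1 / M.alp s - 1) * Real.exp (-(x * M.noise / (M.gain0 * M.powRB) * z))) := by
  have ha := M.alp_gt_two s
  have hε0 : 0 ≤ 1 / M.alp s := one_div_nonneg.2 (M.alp_pos s).le
  have hε1 : 1 / M.alp s ≤ 1 := by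
    rw [div_le_one (M.alp_pos s)]
    linarith
  have hL := M.servingDensity_nonneg s hx
  have hF := M.one_sub_mgfFading_le s hz hε0 hε1
  have hF0 : 0 ≤ 1 - M.mgfFading s z := sub_nonneg.2 (M.mgfFading_le_one s hz.le)
  have hI := M.mgfInterference_le_one hx (div_nonneg hz.le M.gain0_pos.le)
  have hI0 : 0 ≤ M.mgfInterference (z / M.gain0) x := (Real.exp_pos _).le
  have hE := Real.exp_pos (-(z * x * M.noise / (M.gain0 * M.powRB)))
  rw [Real.mul_rpow (M.Om_pos s).le hz.le] at hF
  calc M.integrand s x z ≤ Real.exp (-(z * x * M.noise / (M.gain0 * M.powRB))) * 1 *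
        (M.Om s ^ (1 / M.alp s) * z ^ (1 / M.alp s)) * M.servingDensity s x / z := by
        unfold integrand
        gcongr
    _ = _ := by
        rw [Real.rpow_sub_one hz.ne',
          show x * M.noise / (M.gain0 * M.powRB) * z = z * x * M.noise / (M.gain0 * M.powRB) by ring]
        ring

lemma exists_servingDensity_le (s : S) : ∃ C, 0 ≤ C ∧ ∀ x, 0 < x →
    (1 / x) ^ (1 / M.alp s) * M.servingDensity s x ≤
      (Iic (1 : ℝ)).indicator (fun x => C * x ^ (1 / M.alp s - 1)) x + M.servingDensity s x := by
  obtain ⟨C, hC, hle⟩ := M.exists_LamDeriv_le s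
  refine ⟨C, hC, fun x hx => ?_⟩
  have hL := M.servingDensity_nonneg s hx
  have hε0 : 0 ≤ 1 / M.alp s := one_div_nonneg.2 (M.alp_pos s).le
  by_cases h1 : x ≤ 1
  · rw [indicator_of_mem (by exact h1)]
    refine le_add_of_le_of_nonneg ?_ hL
    have hS : M.servingDensity s x ≤ C * x ^ (2 / M.alp s - 1) := by
      refine (mul_le_of_le_one_right (M.LamDeriv_nonneg s hx.le) ?_).trans (hle x hx)
      exact Real.exp_le_one_iff.2 (neg_nonpos.2 (Finset.sum_nonneg fun r _ => M.Lam_nonneg r hx.le))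
    calc (1 / x) ^ (1 / M.alp s) * M.servingDensity s x
        ≤ (1 / x) ^ (1 / M.alp s) * (C * x ^ (2 / M.alp s - 1)) := by gcongr
      _ = C * x ^ (1 / M.alp s - 1) := by
        rw [one_div x, Real.inv_rpow hx.le, ← Real.rpow_neg hx.le, mul_left_comm,
          ← Real.rpow_add hx]
        congr 2
        ring
  · rw [indicator_of_notMem (by exact h1), zero_add]
    refine mul_le_of_le_one_left hL (Real.rpow_le_one (by positivity) ?_ hε0)
    rw [div_le_one hx]
    linarith

section Intensity

variable [MeasurableSpace S] [MeasurableSingletonClass S]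

/-- Exponent of the probability that there is no path-loss up to `x`, weighted by the
interference. -/
def voidExponent (z x : ℝ) : ℝ≥0∞ :=
  ∫⁻ q, (if M.loss q ≤ x then 1 else 1 - expNeg (ENNReal.ofReal (z / (M.gain0 * M.powRB)) *
    (ENNReal.ofReal x * M.interferencePower q))) ∂M.intensity

lemma measurable_voidExponent : Measurable fun v : ℝ × ℝ => M.voidExponent v.1 v.2 := by
  refine Measurable.lintegral_prod_right' (f := fun w : (ℝ × ℝ) × Link S =>
    if M.loss w.2 ≤ w.1.2 then (1 : ℝ≥0∞) else
      1 - expNeg (ENNReal.ofReal (w.1.1 / (M.gain0 * M.powRB)) *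
        (ENNReal.ofReal w.1.2 * M.interferencePower w.2))) ?_
  refine Measurable.ite (measurableSet_le (M.measurable_loss.comp measurable_snd)
    measurable_fst.snd) measurable_const (measurable_one_sub_expNeg.comp ?_)
  exact (measurable_fst.fst.div_const _).ennreal_ofReal.mul
    (measurable_fst.snd.ennreal_ofReal.mul (M.measurable_interferencePower.comp measurable_snd))

/-- The void up to `x` and the interference beyond it concern disjoint regions, so their exponents
add and the two closed forms multiply. -/
lemma expNeg_voidExponent {x z : ℝ} (hx : 0 < x) (hz : 0 ≤ z) :
    expNeg (M.voidExponent z x) =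
      ENNReal.ofReal (Real.exp (-∑ s, M.Lam s x) * M.mgfInterference (z / M.gain0) x) := by
  have hz' : 0 ≤ z / M.gain0 := div_nonneg hz M.gain0_pos.le
  have hms : MeasurableSet {q : Link S | M.loss q ≤ x} :=
    measurableSet_le M.measurable_loss measurable_const
  have h : M.voidExponent z x = M.intensity {q | M.loss q ≤ x} +
      ENNReal.ofReal (-∑ s, M.T s (z / M.gain0) x) := by
    rw [← M.lintegral_interferenceExponent hx hz', ← lintegral_indicator_one hms,
      ← lintegral_add_left (measurable_one.indicator hms), voidExponent]
    refine lintegral_congr fun q => ?_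
    by_cases hq : M.loss q ≤ x
    · simp [hq]
    · simp [hq, div_div]
  rw [h, M.intensity_loss_le hx.le, expNeg_add,
    expNeg_ofReal (Finset.sum_nonneg fun s _ => M.Lam_nonneg s hx.le),
    expNeg_ofReal (by linarith [M.sum_T_nonpos hx hz']), neg_neg,
    ← ENNReal.ofReal_mul (Real.exp_pos _).le, mgfInterference]

/-- A measurable version of `integrand`. -/
def rateDensity (s : S) (x z : ℝ) : ℝ≥0∞ :=
  ENNReal.ofReal z⁻¹ * (ENNReal.ofReal (M.LamDeriv s x) * (expNeg (M.voidExponent z x) *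
    (ENNReal.ofReal (1 - M.mgfFading s z) *
      ENNReal.ofReal (Real.exp (-(z * x * M.noise / (M.gain0 * M.powRB)))))))

lemma measurable_rateDensity (s : S) : Measurable fun v : ℝ × ℝ => M.rateDensity s v.1 v.2 := by
  have h1 : Measurable fun v : ℝ × ℝ => expNeg (M.voidExponent v.2 v.1) :=
    measurable_expNeg.comp (M.measurable_voidExponent.comp measurable_swap)
  have h2 : Measurable fun v : ℝ × ℝ => M.LamDeriv s v.1 :=
    (M.measurable_LamDeriv s).comp measurable_fst
  have h3 : Measurable fun v : ℝ × ℝ => M.mgfFading s v.2 :=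
    (M.measurable_mgfFading s).comp measurable_snd
  have h4 : Measurable fun v : ℝ × ℝ =>
      Real.exp (-(v.2 * v.1 * M.noise / (M.gain0 * M.powRB))) := by fun_prop
  exact measurable_snd.inv.ennreal_ofReal.mul (h2.ennreal_ofReal.mul
    (h1.mul ((h3.const_sub 1).ennreal_ofReal.mul h4.ennreal_ofReal)))

lemma rateDensity_eq (s : S) {x z : ℝ} (hx : 0 < x) (hz : 0 < z) :
    M.rateDensity s x z = ENNReal.ofReal (M.integrand s x z) := by
  have h1 : 0 ≤ 1 - M.mgfFading s z := sub_nonneg.2 (M.mgfFading_le_one s hz.le)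
  have h2 : 0 ≤ Real.exp (-∑ s, M.Lam s x) * M.mgfInterference (z / M.gain0) x :=
    mul_nonneg (Real.exp_pos _).le (Real.exp_pos _).le
  rw [rateDensity, M.expNeg_voidExponent hx hz.le, ← ENNReal.ofReal_mul h1,
    ← ENNReal.ofReal_mul h2, ← ENNReal.ofReal_mul (M.LamDeriv_nonneg s hx.le),
    ← ENNReal.ofReal_mul (inv_nonneg.2 hz.le), integrand, servingDensity]
  congr 1
  ring

lemma lintegral_servingDensity_le {Ω : Type*} [MeasurableSpace Ω] {P : Measure Ω}
    [IsProbabilityMeasure P] {η : Ω → Measure (Link S)}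
    (hη : IsPoissonPointProcess P M.intensity η) (s : S) :
    ∫⁻ x in Ioi 0, ENNReal.ofReal (M.servingDensity s x) ≤ 1 := by
  have h := hη.lintegral_expNeg_measure_le_le M.measurable_loss M.loss_nonneg
    M.intensity_loss_le_ne_top
  have hanti : Antitone fun x : ℝ => expNeg (M.intensity {q | M.loss q ≤ x}) :=
    fun x y hxy => antitone_expNeg (measure_mono fun q (hq : M.loss q ≤ x) => hq.trans hxy)
  have h2 := M.lintegral_intensity_loss
    (g := fun _ x _ => expNeg (M.intensity {q | M.loss q ≤ x}))
    fun s => hanti.measurable.comp measurable_fst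
  simp only [lintegral_const, measure_univ, mul_one] at h2
  rw [h2] at h
  refine le_trans ?_ h
  refine le_trans (le_of_eq ?_) (Finset.single_le_sum (f := fun s => ∫⁻ x in Ioi 0,
    ENNReal.ofReal (M.LamDeriv s x) * expNeg (M.intensity {q | M.loss q ≤ x}))
    (fun _ _ => zero_le) (Finset.mem_univ s))
  refine setLIntegral_congr_fun measurableSet_Ioi fun x (hx : 0 < x) => ?_
  rw [M.intensity_loss_le hx.le, expNeg_ofReal (Finset.sum_nonneg fun s _ => M.Lam_nonneg s hx.le),
    ← ENNReal.ofReal_mul (M.LamDeriv_nonneg s hx.le), servingDensity]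

/-- The noise bounds the z-integral by a constant times x^{-1/α} times the serving density. For x ≤
1 this is O(x^{1/α-1}), which is integrable; for larger x it is at most the serving density, of
total mass at most 1. -/
lemma lintegral_rateDensity_ne_top {Ω : Type*} [MeasurableSpace Ω] {P : Measure Ω}
    [IsProbabilityMeasure P] {η : Ω → Measure (Link S)}
    (hη : IsPoissonPointProcess P M.intensity η) (s : S) :
    ∫⁻ x in Ioi 0, ∫⁻ z in Ioi 0, M.rateDensity s x z ≠ ∞ := by
  obtain ⟨C, hC, hle⟩ := M.exists_servingDensity_le s
  set ε := 1 / M.alp s with hε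
  have hε0 : 0 < ε := one_div_pos.2 (M.alp_pos s)
  set a := M.noise / (M.gain0 * M.powRB) with ha
  have ha0 : 0 < a := div_pos M.noise_pos (mul_pos M.gain0_pos M.powRB_pos)
  set c := M.Om s ^ ε * ((1 / a) ^ ε * Real.Gamma ε) with hc
  have hO : 0 ≤ M.Om s ^ ε := Real.rpow_nonneg (M.Om_pos s).le _
  have hc0 : 0 ≤ c := mul_nonneg hO (mul_nonneg (Real.rpow_nonneg (by positivity) _)
    (Real.Gamma_pos_of_pos hε0).le)
  have hz : ∀ x ∈ Ioi (0 : ℝ), ∫⁻ z in Ioi 0, M.rateDensity s x z ≤ ENNReal.ofReal c *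
      (ENNReal.ofReal ((Iic (1 : ℝ)).indicator (fun x => C * x ^ (ε - 1)) x) +
        ENNReal.ofReal (M.servingDensity s x)) := fun x (hx : 0 < x) => by
    have hL := M.servingDensity_nonneg s hx
    have hsplit : (1 / (x * a)) ^ ε = (1 / x) ^ ε * (1 / a) ^ ε := by
      rw [← Real.mul_rpow (by positivity) (by positivity)]
      congr 1
      field_simp
    calc ∫⁻ z in Ioi 0, M.rateDensity s x z
        ≤ ∫⁻ z in Ioi (0 : ℝ), ENNReal.ofReal (M.Om s ^ ε * M.servingDensity s x) *
            ENNReal.ofReal (z ^ (ε - 1) * Real.exp (-(x * a * z))) := by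
          refine setLIntegral_mono (by fun_prop) fun z (hz : 0 < z) => ?_
          rw [M.rateDensity_eq s hx hz, ← ENNReal.ofReal_mul (mul_nonneg hO hL), ha, ← mul_div_assoc]
          exact ENNReal.ofReal_le_ofReal (M.integrand_le s hx hz)
      _ = ENNReal.ofReal (c * ((1 / x) ^ ε * M.servingDensity s x)) := by
          rw [lintegral_const_mul _ (by fun_prop),
            lintegral_rpow_mul_exp_neg_mul hε0 (mul_pos hx ha0),
            ← ENNReal.ofReal_mul (mul_nonneg hO hL), hsplit, hc]
          congr 1
          ring
      _ ≤ _ := by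
          have hi : 0 ≤ (Iic (1 : ℝ)).indicator (fun x => C * x ^ (ε - 1)) x := by
            rw [indicator_apply]
            split_ifs
            exacts [mul_nonneg hC (Real.rpow_nonneg hx.le _), le_rfl]
          rw [← ENNReal.ofReal_add hi hL, ← ENNReal.ofReal_mul hc0]
          exact ENNReal.ofReal_le_ofReal (mul_le_mul_of_nonneg_left (hle x hx) hc0)
  have hmi : Measurable fun x : ℝ =>
      ENNReal.ofReal ((Iic (1 : ℝ)).indicator (fun x => C * x ^ (ε - 1)) x) :=
    (Measurable.indicator (by fun_prop) measurableSet_Iic).ennreal_ofReal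
  refine ne_top_of_le_ne_top ?_ (setLIntegral_mono' measurableSet_Ioi hz)
  rw [lintegral_const_mul' _ _ ENNReal.ofReal_ne_top, lintegral_add_left hmi]
  refine ENNReal.mul_ne_top ENNReal.ofReal_ne_top (ENNReal.add_ne_top.2 ⟨?_,
    ne_top_of_le_ne_top ENNReal.one_ne_top (M.lintegral_servingDensity_le hη s)⟩)
  have hi : IntegrableOn (fun x : ℝ => C * x ^ (ε - 1)) (Ioc 0 1) :=
    ((intervalIntegrable_iff_integrableOn_Ioc_of_le zero_le_one).1
      (intervalIntegral.intervalIntegrable_rpow' (by linarith))).const_mul C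
  refine ne_top_of_le_ne_top hi.lintegral_lt_top.ne ?_
  rw [← lintegral_indicator measurableSet_Ioi, ← lintegral_indicator measurableSet_Ioc]
  refine lintegral_mono fun x => ?_
  by_cases h0 : 0 < x <;> by_cases h1 : x ≤ 1 <;> simp [indicator, h0, h1]

end Intensity

end Network

namespace Network

lemma measurable_fading {S : Type*} [MeasurableSpace S] : Measurable (Link.fading : Link S → ℝ) :=
  measurable_snd.snd.snd.snd.snd

variable {S : Type*} [Fintype S] (M : Network S)

/-! ### The rate of the typical terminal -/

/-- Integrand of Frullani's representation of the rate, for the fading gain `g` and the path-loss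
`x` of the serving base station and the interference `i`. -/
def frullani (g : ℝ≥0∞) (x : ℝ) (i : ℝ≥0∞) (z : ℝ) : ℝ≥0∞ :=
  ENNReal.ofReal z⁻¹ * (((1 - expNeg (ENNReal.ofReal z * g)) *
    ENNReal.ofReal (Real.exp (-(z * x * M.noise / (M.gain0 * M.powRB))))) *
    expNeg (ENNReal.ofReal (z / (M.gain0 * M.powRB)) * (ENNReal.ofReal x * i)))

lemma measurable_frullani :
    Measurable fun v : (ℝ≥0∞ × ℝ × ℝ≥0∞) × ℝ => M.frullani v.1.1 v.1.2.1 v.1.2.2 v.2 := by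
  have h1 : Measurable fun v : (ℝ≥0∞ × ℝ × ℝ≥0∞) × ℝ =>
      1 - expNeg (ENNReal.ofReal v.2 * v.1.1) :=
    measurable_one_sub_expNeg.comp (measurable_snd.ennreal_ofReal.mul measurable_fst.fst)
  have h2 : Measurable fun v : (ℝ≥0∞ × ℝ × ℝ≥0∞) × ℝ =>
      Real.exp (-(v.2 * v.1.2.1 * M.noise / (M.gain0 * M.powRB))) := by fun_prop
  have h3 : Measurable fun v : (ℝ≥0∞ × ℝ × ℝ≥0∞) × ℝ =>
      expNeg (ENNReal.ofReal (v.2 / (M.gain0 * M.powRB)) * (ENNReal.ofReal v.1.2.1 * v.1.2.2)) :=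
    measurable_expNeg.comp ((measurable_snd.div_const _).ennreal_ofReal.mul
      (measurable_fst.snd.fst.ennreal_ofReal.mul measurable_fst.snd.snd))
  exact measurable_snd.inv.ennreal_ofReal.mul ((h1.mul h2.ennreal_ofReal).mul h3)

lemma lintegral_frullani {g x : ℝ} {i : ℝ≥0∞} (hx : 0 < x) (hi : i ≠ ∞) :
    ∫⁻ z in Ioi 0, M.frullani (ENNReal.ofReal g) x i z = ENNReal.ofReal (Real.log (1 +
      (ENNReal.ofReal (M.powRB * M.gain0 * g / x) / (ENNReal.ofReal M.noise + i)).toReal)) := by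
  have hP := M.powRB_pos
  have hG := M.gain0_pos
  have hN := M.noise_pos
  lift i to ℝ≥0 using hi
  -- `ENNReal.ofReal` truncates negative gains, so the positive part represents every real `g`.
  set u := max g 0 with hu
  have hu0 : 0 ≤ u := le_max_right _ _
  have hgu : ENNReal.ofReal g = ENNReal.ofReal u := by
    rcases le_total g 0 with h | h
    · rw [hu, max_eq_right h, ENNReal.ofReal_of_nonpos h, ENNReal.ofReal_zero]
    · rw [hu, max_eq_left h]
  -- Chosen such that `u / v` is the signal-to-interference-plus-noise ratio.
  set v := x * (M.noise + i) / (M.gain0 * M.powRB) with hv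
  have hv0 : 0 < v := by positivity
  have huv : (ENNReal.ofReal (M.powRB * M.gain0 * g / x) /
      (ENNReal.ofReal M.noise + (i : ℝ≥0∞))).toReal = u / v := by
    rw [mul_div_right_comm, ENNReal.ofReal_mul (by positivity), hgu,
      ← ENNReal.ofReal_mul (by positivity), ENNReal.toReal_div,
      ENNReal.toReal_ofReal (by positivity), ENNReal.toReal_add ENNReal.ofReal_ne_top
      ENNReal.coe_ne_top, ENNReal.toReal_ofReal hN.le, ENNReal.coe_toReal, hv]
    field_simp
  rw [huv, ← lintegral_log_one_add_div hu0 hv0]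
  refine setLIntegral_congr_fun measurableSet_Ioi fun z (hz : 0 < z) => ?_
  have hexp : Real.exp (-(z * u)) ≤ 1 := Real.exp_le_one_iff.2 (neg_nonpos.2 (by positivity))
  have hi' : (i : ℝ≥0∞) = ENNReal.ofReal i := (ENNReal.ofReal_coe_nnreal).symm
  rw [frullani, hgu, hi', ← ENNReal.ofReal_mul hz.le, ← ENNReal.ofReal_mul hx.le,
    ← ENNReal.ofReal_mul (by positivity), expNeg_ofReal (by positivity),
    expNeg_ofReal (by positivity), ← ENNReal.ofReal_one, ← ENNReal.ofReal_sub _ (Real.exp_pos _).le,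
    ← ENNReal.ofReal_mul (sub_nonneg.2 hexp), ← ENNReal.ofReal_mul
      (mul_nonneg (sub_nonneg.2 hexp) (Real.exp_pos _).le), ← ENNReal.ofReal_mul (by positivity),
    mul_assoc (1 - _), ← Real.exp_add, mul_comm z⁻¹]
  congr 4
  rw [hv]
  field_simp
  ring

lemma sinr_nonneg [MeasurableSpace S] (c : Measure (Link S)) : 0 ≤ M.sinr c := ENNReal.toReal_nonneg

lemma log_one_add_sinr_nonneg [MeasurableSpace S] (c : Measure (Link S)) :
    0 ≤ Real.log (1 + M.sinr c) :=
  Real.log_nonneg (by linarith [M.sinr_nonneg c])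

lemma integrand_ae_nonneg (s : S) :
    0 ≤ᵐ[volume.restrict (Ioi 0 ×ˢ Ioi 0)] fun v : ℝ × ℝ => M.integrand s v.1 v.2 :=
  (ae_restrict_iff' (measurableSet_Ioi.prod measurableSet_Ioi)).2
    (.of_forall fun _ hv => M.integrand_nonneg s hv.1 hv.2)

section Intensity

variable [MeasurableSpace S] [MeasurableSingletonClass S]
  {Ω : Type*} [MeasurableSpace Ω] {P : Measure Ω} [IsProbabilityMeasure P]
  {η : Ω → Measure (Link S)}

/-- Fading gain of the serving base station. -/
def servingFading (c : Measure (Link S)) : ℝ≥0∞ :=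
  ∫⁻ p in {p | M.loss p = M.servingLoss c}, ENNReal.ofReal p.fading ∂c

lemma ae_exists_serving (hη : IsPoissonPointProcess P M.intensity η) :
    ∀ᵐ ω ∂P, 0 < M.servingLoss (η ω) ∧ M.interference (η ω) (M.servingLoss (η ω)) ≠ ∞ ∧
      ∃ p, M.loss p = M.servingLoss (η ω) ∧ ∀ f : Link S → ℝ≥0∞, Measurable f →
        ∫⁻ q in {q | M.loss q = M.servingLoss (η ω)}, f q ∂η ω = f p := by
  -- Finiteness holds almost surely at each fixed level, but the serving level is random.
  -- Interference decreases in the level, so a rational level below the serving one suffices.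
  have hI : ∀ᵐ ω ∂P, ∀ r : ℚ, 0 < (r : ℝ) → M.interference (η ω) r ≠ ∞ :=
    ae_all_iff.2 fun r => by
      by_cases hr : 0 < (r : ℝ)
      · exact (M.ae_interference_ne_top hη hr).mono fun ω h _ => h
      · exact .of_forall fun ω h => absurd h hr
  filter_upwards [M.ae_hasLowestPoint hη, hη.ae_isConfiguration, hI] with ω hω hc hI
  have hpos : 0 < M.servingLoss (η ω) := hω.pos
  have hone : η ω {q | M.loss q = M.servingLoss (η ω)} = 1 := hω.eq_one
  refine ⟨hpos, ?_, ?_⟩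
  · obtain ⟨r, hr0, hr⟩ := exists_rat_btwn hpos
    refine ne_top_of_le_ne_top (hI r hr0) ?_
    rw [M.setLIntegral_interferencePower, M.setLIntegral_interferencePower]
    exact lintegral_mono_set fun p (hp : M.servingLoss (η ω) < M.loss p) => hr.trans hp
  · obtain ⟨p, hp, h⟩ := (hc.exists_lintegral_eq (M.measurable_loss (measurableSet_singleton _))
      (by rw [show M.loss ⁻¹' {M.servingLoss (η ω)} = {q | M.loss q = M.servingLoss (η ω)} from rfl,
        hone]; exact one_ne_zero)
      (by rw [show M.loss ⁻¹' {M.servingLoss (η ω)} = {q | M.loss q = M.servingLoss (η ω)} from rfl,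
        hone]; exact ENNReal.one_lt_two)).2
    exact ⟨p, hp, h⟩

lemma aemeasurable_interference_servingLoss (hη : IsPoissonPointProcess P M.intensity η) :
    AEMeasurable (fun ω => M.interference (η ω) (M.servingLoss (η ω))) P := by
  simp_rw [M.setLIntegral_interferencePower]
  exact hη.aemeasurable_lintegral_above_lowest M.measurable_loss (M.ae_hasLowestPoint hη)
    M.measurable_interferencePower

lemma aemeasurable_sinr (hη : IsPoissonPointProcess P M.intensity η) :
    AEMeasurable (fun ω => M.sinr (η ω)) P := by
  have h : Measurable fun p : Link S =>
      ENNReal.ofReal (M.powRB * M.gain0 * p.fading / M.loss p) :=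
    ((measurable_fading.const_mul _).div M.measurable_loss).ennreal_ofReal
  exact ((hη.aemeasurable_lintegral_lowest M.measurable_loss (M.ae_hasLowestPoint hη) h).div
    ((M.aemeasurable_interference_servingLoss hη).const_add _)).ennreal_toReal

lemma ae_lintegral_frullani (hη : IsPoissonPointProcess P M.intensity η) :
    ∀ᵐ ω ∂P, ENNReal.ofReal (Real.log (1 + M.sinr (η ω))) =
      ∫⁻ z in Ioi 0, M.frullani (M.servingFading (η ω)) (M.servingLoss (η ω))
        (M.interference (η ω) (M.servingLoss (η ω))) z := by
  filter_upwards [M.ae_exists_serving hη] with ω ⟨hL, hI, p, hp, h⟩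
  rw [servingFading, h _ measurable_fading.ennreal_ofReal, M.lintegral_frullani hL hI, sinr, signal,
    h (fun q => ENNReal.ofReal (M.powRB * M.gain0 * q.fading / M.loss q))
      ((measurable_fading.const_mul _).div M.measurable_loss).ennreal_ofReal, hp]

lemma lintegral_frullani_prob (hη : IsPoissonPointProcess P M.intensity η) {z : ℝ} (hz : 0 < z) :
    ∫⁻ ω, M.frullani (M.servingFading (η ω)) (M.servingLoss (η ω))
        (M.interference (η ω) (M.servingLoss (η ω))) z ∂P =
      ∑ s, ∫⁻ x in Ioi 0, M.rateDensity s x z := by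
  have hmd : Measurable fun x : ℝ =>
      ENNReal.ofReal (Real.exp (-(z * x * M.noise / (M.gain0 * M.powRB)))) := by fun_prop
  have hmf : Measurable fun x : ℝ => 1 - expNeg (ENNReal.ofReal z * ENNReal.ofReal x) :=
    measurable_one_sub_expNeg.comp (ENNReal.measurable_ofReal.const_mul _)
  have hmv : Measurable fun x : ℝ => expNeg (M.voidExponent z x) :=
    measurable_expNeg.comp (M.measurable_voidExponent.comp measurable_prodMk_left)
  -- Collects the Frullani factors that depend only on the serving station, its fading and the
  -- noise. The remaining factor is the exponential of the normalised interference, handled by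
  -- `lintegral_lowest`.
  let f : Link S → ℝ≥0∞ := fun p => (1 - expNeg (ENNReal.ofReal z * ENNReal.ofReal p.fading)) *
    ENNReal.ofReal (Real.exp (-(z * M.loss p * M.noise / (M.gain0 * M.powRB))))
  have hf : Measurable f := (hmf.comp measurable_fading).mul (hmd.comp M.measurable_loss)
  have hf1 : ∀ p, f p ≤ 1 := fun p => by
    refine mul_le_one' tsub_le_self (ENNReal.ofReal_le_one.2 (Real.exp_le_one_iff.2 ?_))
    have := M.loss_nonneg p
    have := M.noise_pos
    have := M.gain0_pos
    have := M.powRB_pos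
    exact neg_nonpos.2 (by positivity)
  have hlow := hη.lintegral_lowest M.measurable_loss M.loss_nonneg M.intensity_loss_le_ne_top
    (M.ae_hasLowestPoint hη) hf hf1 M.measurable_interferencePower M.interferencePower_ne_top
    (fun x hx => M.lintegral_interferencePower_ne_top hx)
    (c := ENNReal.ofReal (z / (M.gain0 * M.powRB))) ENNReal.ofReal_ne_top
  have hA : ∫⁻ ω, M.frullani (M.servingFading (η ω)) (M.servingLoss (η ω))
        (M.interference (η ω) (M.servingLoss (η ω))) z ∂P =
      ENNReal.ofReal z⁻¹ * ∫⁻ p, expNeg (M.voidExponent z (M.loss p)) * f p ∂M.intensity := by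
    refine Eq.trans ?_ (congrArg (ENNReal.ofReal z⁻¹ * ·) hlow)
    rw [← lintegral_const_mul' _ _ ENNReal.ofReal_ne_top]
    refine lintegral_congr_ae ?_
    filter_upwards [M.ae_exists_serving hη] with ω ⟨hL, hI, p, hp, h⟩
    have h1 := h f hf
    have h2 := M.setLIntegral_interferencePower (η ω) (M.servingLoss (η ω))
    change M.frullani _ _ _ _ = ENNReal.ofReal z⁻¹ *
      ((∫⁻ q in {q | M.loss q = M.servingLoss (η ω)}, f q ∂η ω) *
        expNeg (ENNReal.ofReal (z / (M.gain0 * M.powRB)) * (ENNReal.ofReal (M.servingLoss (η ω)) *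
          ∫⁻ q in {q | M.servingLoss (η ω) < M.loss q}, M.interferencePower q ∂η ω)))
    rw [h1, ← h2, servingFading, h _ measurable_fading.ennreal_ofReal, frullani]
    simp only [f, hp]
  have hB := M.lintegral_intensity_loss (g := fun _ x w => expNeg (M.voidExponent z x) *
    ((1 - expNeg (ENNReal.ofReal z * ENNReal.ofReal w.2.2.2)) *
      ENNReal.ofReal (Real.exp (-(z * x * M.noise / (M.gain0 * M.powRB)))))) fun s =>
    (hmv.comp measurable_fst).mul ((hmf.comp measurable_snd.snd.snd.snd).mul
      (hmd.comp measurable_fst))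
  refine hA.trans ((congrArg (ENNReal.ofReal z⁻¹ * ·) hB).trans ?_)
  rw [Finset.mul_sum]
  refine Finset.sum_congr rfl fun s _ => ?_
  rw [← lintegral_const_mul' _ _ ENNReal.ofReal_ne_top]
  refine lintegral_congr fun x => ?_
  have hmw : Measurable fun w : Bool × ℝ × ℝ × ℝ =>
      1 - expNeg (ENNReal.ofReal z * ENNReal.ofReal w.2.2.2) := hmf.comp measurable_snd.snd.snd
  rw [lintegral_const_mul _ (hmw.mul_const _), lintegral_mul_const _ hmw,
    M.lintegral_markLaw_fading s hmf]
  simp_rw [← ENNReal.ofReal_mul hz.le]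
  rw [M.lintegral_one_sub_exp_fadingLaw s hz.le, rateDensity]

/-- Tonelli twice: the expectation is brought inside the Frullani integral to use the law of the
serving station at fixed z, then the order of x and z is restored. -/
lemma lintegral_log_one_add_sinr (hη : IsPoissonPointProcess P M.intensity η) :
    ∫⁻ ω, ENNReal.ofReal (Real.log (1 + M.sinr (η ω))) ∂P =
      ∑ s, ∫⁻ x in Ioi 0, ∫⁻ z in Ioi 0, M.rateDensity s x z := by
  have hlow := M.ae_hasLowestPoint hη
  have hm : AEMeasurable (fun ω => (M.servingFading (η ω), M.servingLoss (η ω),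
      M.interference (η ω) (M.servingLoss (η ω)))) P :=
    (hη.aemeasurable_lintegral_lowest M.measurable_loss hlow
      measurable_fading.ennreal_ofReal).prodMk
      ((hη.aemeasurable_lowestLevel M.measurable_loss hlow).prodMk
        (M.aemeasurable_interference_servingLoss hη))
  have hm2 : AEMeasurable (Function.uncurry fun ω z => M.frullani (M.servingFading (η ω))
      (M.servingLoss (η ω)) (M.interference (η ω) (M.servingLoss (η ω))) z)
      (P.prod (volume.restrict (Ioi 0))) :=
    M.measurable_frullani.comp_aemeasurable (hm.comp_fst.prodMk measurable_snd.aemeasurable)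
  rw [lintegral_congr_ae (M.ae_lintegral_frullani hη), lintegral_lintegral_swap hm2,
    setLIntegral_congr_fun measurableSet_Ioi fun z hz => M.lintegral_frullani_prob hη hz,
    lintegral_finsetSum _ fun s _ => ?_]
  · refine Finset.sum_congr rfl fun s _ => ?_
    exact lintegral_lintegral_swap (((M.measurable_rateDensity s).comp measurable_swap).aemeasurable)
  · exact ((M.measurable_rateDensity s).comp measurable_swap).lintegral_prod_right'

lemma aestronglyMeasurable_log_sinr (hη : IsPoissonPointProcess P M.intensity η) :
    AEStronglyMeasurable (fun ω => Real.log (1 + M.sinr (η ω))) P :=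
  (Real.measurable_log.comp_aemeasurable
    ((M.aemeasurable_sinr hη).const_add 1)).aestronglyMeasurable

lemma integrable_log_one_add_sinr (hη : IsPoissonPointProcess P M.intensity η) :
    Integrable (fun ω => Real.log (1 + M.sinr (η ω))) P := by
  refine (lintegral_ofReal_ne_top_iff_integrable (M.aestronglyMeasurable_log_sinr hη)
    (.of_forall fun ω => M.log_one_add_sinr_nonneg _)).1 ?_
  rw [M.lintegral_log_one_add_sinr hη, ENNReal.sum_ne_top]
  exact fun s _ => M.lintegral_rateDensity_ne_top hη s

lemma rateDensity_ae_eq (s : S) : (fun v : ℝ × ℝ => M.rateDensity s v.1 v.2)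
    =ᵐ[volume.restrict (Ioi 0 ×ˢ Ioi 0)] fun v => ENNReal.ofReal (M.integrand s v.1 v.2) :=
  (ae_restrict_iff' (measurableSet_Ioi.prod measurableSet_Ioi)).2
    (.of_forall fun _ hv => M.rateDensity_eq s hv.1 hv.2)

/-- Measurability is inherited from `rateDensity`, which is built from a parametric integral and
agrees with the integrand on the quadrant. The hypergeometric expressions need no separate
treatment. -/
lemma aestronglyMeasurable_integrand (s : S) :
    AEStronglyMeasurable (fun v : ℝ × ℝ => M.integrand s v.1 v.2)
      (volume.restrict (Ioi 0 ×ˢ Ioi 0)) := by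
  refine ((M.measurable_rateDensity s).ennreal_toReal.aemeasurable.congr ?_).aestronglyMeasurable
  filter_upwards [M.rateDensity_ae_eq s, M.integrand_ae_nonneg s] with v hv h0
  rw [hv, ENNReal.toReal_ofReal h0]

lemma lintegral_integrand (s : S) :
    ∫⁻ v in Ioi (0 : ℝ) ×ˢ Ioi (0 : ℝ), ENNReal.ofReal (M.integrand s v.1 v.2) =
      ∫⁻ x in Ioi 0, ∫⁻ z in Ioi 0, M.rateDensity s x z := by
  rw [← lintegral_congr_ae (M.rateDensity_ae_eq s), Measure.volume_eq_prod,
    ← Measure.prod_restrict, lintegral_prod _ (M.measurable_rateDensity s).aemeasurable]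

lemma integrableOn_integrand (hη : IsPoissonPointProcess P M.intensity η) (s : S) :
    IntegrableOn (fun v : ℝ × ℝ => M.integrand s v.1 v.2) (Ioi 0 ×ˢ Ioi 0) := by
  refine (lintegral_ofReal_ne_top_iff_integrable (M.aestronglyMeasurable_integrand s)
    (M.integrand_ae_nonneg s)).1 ?_
  rw [M.lintegral_integrand s]
  exact M.lintegral_rateDensity_ne_top hη s

lemma integral_integrand (hη : IsPoissonPointProcess P M.intensity η) (s : S) :
    ∫ x in Ioi 0, ∫ z in Ioi 0, M.integrand s x z =
      (∫⁻ x in Ioi 0, ∫⁻ z in Ioi 0, M.rateDensity s x z).toReal := by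
  have h := M.integrableOn_integrand hη s
  rw [← M.lintegral_integrand s, ← integral_eq_lintegral_of_nonneg_ae (M.integrand_ae_nonneg s)
    (M.aestronglyMeasurable_integrand s)]
  rw [IntegrableOn, Measure.volume_eq_prod, ← Measure.prod_restrict] at h
  rw [Measure.volume_eq_prod, ← Measure.prod_restrict, integral_prod _ h]

lemma integral_log_one_add_sinr (hη : IsPoissonPointProcess P M.intensity η) :
    ∫ ω, Real.log (1 + M.sinr (η ω)) ∂P =
      ∑ s, ∫ x in Ioi 0, ∫ z in Ioi 0, M.integrand s x z := by
  rw [integral_eq_lintegral_of_nonneg_ae (.of_forall fun ω => M.log_one_add_sinr_nonneg _)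
    (M.aestronglyMeasurable_log_sinr hη), M.lintegral_log_one_add_sinr hη,
    ENNReal.toReal_sum fun s _ => M.lintegral_rateDensity_ne_top hη s]
  exact Finset.sum_congr rfl fun s _ => (M.integral_integrand hη s).symm

end Intensity

end Network

end CellNet

end

/-! ### The proposition. -/

theorem proposition1 {S : Type*} [Fintype S] [MeasurableSpace S] [MeasurableSingletonClass S]
    (M : CellNet.Network S)
    {Ω : Type*} [MeasurableSpace Ω] (P : Measure Ω) [IsProbabilityMeasure P]
    (η : Ω → Measure (CellNet.Link S))
    (hη : CellNet.IsPoissonPointProcess P M.intensity η) :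
    -- the path-losses of each state have the approximated intensity measure
    (∀ (s : S) (x : ℝ), 0 < x →
      ∫⁻ ω, η ω {p | p.state = s ∧ M.loss p < x} ∂P = ENNReal.ofReal (M.Lam s x)) ∧
    (∀ (s : S) (x : ℝ), 0 < x → (∀ b, x ≠ M.edge s b) →
      HasDerivAt (M.Lam s) (M.LamDeriv s x) x) ∧
    -- almost surely there is exactly one serving base station
    (∀ᵐ ω ∂P, η ω {p | M.loss p = M.servingLoss (η ω)} = 1 ∧
      η ω {p | M.loss p < M.servingLoss (η ω)} = 0) ∧
    -- moment generating function of the interference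
    (∀ x : ℝ, 0 < x → (∀ᵐ ω ∂P, M.interference (η ω) x ≠ ⊤) ∧
      ∀ z : ℝ, 0 ≤ z →
        ∫ ω, Real.exp (-(z * x / M.powRB * (M.interference (η ω) x).toReal)) ∂P =
          Real.exp (∑ r, M.T r z x)) ∧
    -- area spectral efficiency
    Integrable (fun ω => Real.log (1 + M.sinr (η ω))) P ∧
    (∀ s : S, IntegrableOn (fun y : ℝ × ℝ => M.integrand s y.1 y.2)
      (Set.Ioi 0 ×ˢ Set.Ioi 0)) ∧
    M.ase P η = M.lamMT * M.pSel / Real.log 2 *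
      ∑ s : S, ∫ x in Set.Ioi 0, ∫ z in Set.Ioi 0, M.integrand s x z := by
  refine ⟨fun s x hx => ?_, fun s x hx hne => M.hasDerivAt_Lam s hx hne, ?_,
    fun x hx => ⟨M.ae_interference_ne_top hη hx,
      fun z hz => M.integral_exp_neg_interference hη hx hz⟩,
    M.integrable_log_one_add_sinr hη, M.integrableOn_integrand hη, ?_⟩
  · have h := M.intensity_state_loss_lt s hx.le
    have hms : MeasurableSet {p : CellNet.Link S | p.state = s ∧ M.loss p < x} :=
      (CellNet.Network.measurableSet_state_eq s).inter
        (measurableSet_lt M.measurable_loss measurable_const)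
    rw [hη.lintegral_count hms (by rw [h]; exact ENNReal.ofReal_ne_top), h]
  · filter_upwards [M.ae_hasLowestPoint hη] with ω hω
    exact ⟨hω.eq_one, hω.eq_zero⟩
  · rw [CellNet.Network.ase, M.integral_log_one_add_sinr hη]
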